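/- Let $\Bbbk$ be an algebraically closed field of characteristic $0$. Let $\eta\ge 1$ be an integer and let $\zeta_0,\dots,\zeta_\eta$ be nonnegative integers with $\zeta_0-\zeta_1\le\zeta_1-\zeta_2\le\dots\le\zeta_{\eta-1}-\zeta_\eta$. Put $\zeta_{\max}=\max_i\zeta_i$, $g(i)=\zeta_{\max}-\zeta_i$, and let $P\subset\mathbb R^2$ be the convex hull of the segment $[0,\eta]\times\{\zeta_{\max}\}$ and of the points $(i,g(i))$, $0\le i\le\eta$; its integer points are the $(i,j)$ with $0\le i\le \eta$ and $g(i)\le j\le\zeta_{\max}$. (For example, $P$ is a Hirzebruch trapezoid or a dilated unimodular triangle.) **Rings.** Let $R(P)=\Bbbk[C(P)\cap\mathbb Z^{3}]$, where $C(P)\subset\mathbb R^3$ is the cone generated by the vectors $(a,1)$, $a\in P$; for an integer point $\alpha$ of $P$ let $Y_\alpha=z^\alpha w\in R(P)$ be the element of $(\alpha,1)$. For a $\Bbbk$-algebra $R$ let $J^\infty(R)$ be its arc ring, generated by elements $r^{(j)}$ ($r\in R$, $j\ge0$) and representing the functor $A\mapsto\mathrm{Hom}(R,A[[s]])$, and let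 $J^\infty_{\mathrm{red}}(R)$ be its quotient by the nilradical. Let $\mathbb J=\Bbbk[X_\alpha^{(j)}]$ be the polynomial ring in variables indexed by the integer points $\alpha$ of $P$ and by $j\ge0$, and $X_\alpha(s)=\sum_{j\ge0}X_\alpha^{(j)}s^j$. The ideal of relations $\mathcal I\subset\mathbb J$ is the kernel of $\mathbb J\to J^\infty_{\mathrm{red}}(R(P))$, $X_\alpha^{(j)}\mapsto Y_\alpha^{(j)}$. **Curves.** Let $\alpha=(\alpha_1,\alpha_2)$, $\beta=(\beta_1,\beta_2)$ be distinct integer points of $P$, ordered so that $\alpha_1<\beta_1$, or $\alpha_1=\beta_1$ and $\alpha_2<\beta_2$. For integers $x\in[\alpha_1,\beta_1]$ define $$c(x)=\begin{cases}\max(\alpha_2,g(x))&\text{if }\alpha_2\le\beta_2,\\ \max(\beta_2,g(x))&\text{if }\alpha_2>\beta_2,\ x>\alpha_1,\\ \max(\beta_2+1,g(\alpha_1))&\text{if }\alpha_2>\beta_2,\ x=\alpha_1.\end{cases}$$ If $\alpha_2\le\beta_2$, let $e_1,e_2,\dots$ be the vectors $(1,c(x+1)-c(x))$ for $x=\alpha_1,\dots,\beta_1-1$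 in this order, followed by $\beta_2-c(\beta_1)$ vectors $(0,1)$. If $\alpha_2>\beta_2$, let them be $\alpha_2-c(\alpha_1)$ vectors $(0,-1)$, followed by $(1,c(x+1)-c(x))$ for $x=\alpha_1,\dots,\beta_1-1$ in this order. Let $k(\alpha,\beta)+1$ be the number of these vectors. (They are the successive segments of a curve from $\alpha$ to $\beta$, and $\alpha+\sum_{j\in I}e_j\in P$ for all $I\subset\{1,\dots,k(\alpha,\beta)+1\}$.) For $k'\ge0$ put $$W'_{\alpha,\beta,k'}(X)=\sum_{I\subset\{1,\dots,k(\alpha,\beta)\}}(-1)^{|I|}\,\frac{\partial^{k'}X_{\alpha+\sum_{j\in I}e_j}(s)}{\partial s^{k'}}\,X_{\beta-\sum_{j\in I}e_j}(s).$$ **Order.** Give $X_\alpha^{(j)}$ the multidegree the basis vector $\epsilon_\alpha$, so that $\mathbb J$ is graded by the vectors $r=(r_\alpha)$ of nonnegative integers. Order these vectors by comparing lexicographically first $\left(\sum_\alpha r_\alpha, r_0,\dots,r_\eta\right)$, where $r_i=\sum_j r_{(i,j)}$, and, if these are equal, by comparing $r_\alpha$ with $r'_\alpha$ at the first $\alpha$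 where they differ, the points being ordered by $\alpha_2$ and then by $\alpha_1$. The initial part $\mathrm{In}_\prec f$ of $f\ne0$ in $\mathbb J$ is its nonzero component of largest multidegree, and $\mathrm{In}_\prec\mathcal I$ is the ideal spanned by the initial parts of the nonzero elements of $\mathcal I$. **Theorem.** Let $\alpha,\beta$ run over all pairs of distinct integer points of $P$, ordered as above, and let $0\le k'<k(\alpha,\beta)$. 1. The coefficients of all the series $W'_{\alpha,\beta,k'}(X)$ generate the ideal of relations $\mathcal I$ of $J^\infty_{\mathrm{red}}(R(P))$. 2. The initial part of each coefficient of $W'_{\alpha,\beta,k'}(X)$ is the corresponding coefficient of $\dfrac{\partial^{k'}X_\alpha(s)}{\partial s^{k'}}X_\beta(s)$, and the coefficients of all these series generate the initial ideal $\mathrm{In}_\prec\mathcal I$. -/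

import Mathlib

namespace ToricArc

/-! ### Arc rings -/

/-- The generating series `X_i(s) = ∑_j X_i^{(j)} s^j`, where `X_i^{(j)}` is the variable `(i, j)`. -/
noncomputable def current (𝕜 : Type*) [Field 𝕜] {σ : Type*} (i : σ) :
    PowerSeries (MvPolynomial (σ × ℕ) 𝕜) :=
  PowerSeries.mk fun j => MvPolynomial.X (i, j)

/-- The ideal generated by all `s`-coefficients of the series `f(X(s))`, `f ∈ I`. -/
noncomputable def arcIdeal {𝕜 : Type*} [Field 𝕜] {σ : Type*} (I : Ideal (MvPolynomial σ 𝕜)) :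
    Ideal (MvPolynomial (σ × ℕ) 𝕜) :=
  Ideal.span {p | ∃ f ∈ I, ∃ n : ℕ,
    p = PowerSeries.coeff n (MvPolynomial.aeval (current 𝕜 (σ := σ)) f)}

/-- The arc ring `J^∞(R)`, built from the presentation of `R` in which every element of `R` is a
generator and all polynomial relations between them are imposed; `r^{(j)}` is the class of the
variable `(r, j)`. It represents the functor `A ↦ Hom(R, A[[s]])`. -/
abbrev ArcRing (𝕜 : Type*) [Field 𝕜] (R : Type*) [CommRing R] [Algebra 𝕜 R] : Type _ :=
  MvPolynomial (R × ℕ) 𝕜 ⧸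
    arcIdeal (RingHom.ker (MvPolynomial.aeval (R := 𝕜) (id : R → R)))

/-- The reduced arc ring: the arc ring modulo its nilradical. -/
abbrev ReducedArcRing (𝕜 : Type*) [Field 𝕜] (R : Type*) [CommRing R] [Algebra 𝕜 R] : Type _ :=
  ArcRing 𝕜 R ⧸ nilradical (ArcRing 𝕜 R)

/-- The element `r^{(j)}` of the reduced arc ring. -/
noncomputable def arcCoeff (𝕜 : Type*) [Field 𝕜] {R : Type*} [CommRing R] [Algebra 𝕜 R]
    (r : R) (j : ℕ) : ReducedArcRing 𝕜 R :=
  Ideal.Quotient.mk _ (Ideal.Quotient.mk _ (MvPolynomial.X (r, j)))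

/-- The ideal of relations in the reduced arc ring of `R` between the `y_i^{(j)}`: the kernel of
`X_i^{(j)} ↦ y_i^{(j)}`. -/
noncomputable def relationIdeal (𝕜 : Type*) [Field 𝕜] {R : Type*} [CommRing R] [Algebra 𝕜 R]
    {σ : Type*} (y : σ → R) : Ideal (MvPolynomial (σ × ℕ) 𝕜) :=
  RingHom.ker (MvPolynomial.aeval (R := 𝕜)
    (fun v : σ × ℕ => (arcCoeff 𝕜 (y v.1) v.2 : ReducedArcRing 𝕜 R)))

/-! ### Initial parts and initial ideals -/

/-- The component of multidegree `r` of a polynomial in the variables `X_i^{(j)}`, for the grading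
in which `X_i^{(j)}` has degree the `i`-th basis vector, whatever `j` is. -/
noncomputable def component {𝕜 : Type*} [Field 𝕜] {σ : Type*} (r : σ →₀ ℕ)
    (g : MvPolynomial (σ × ℕ) 𝕜) : MvPolynomial (σ × ℕ) 𝕜 :=
  MvPolynomial.weightedHomogeneousComponent
    (fun v : σ × ℕ => (Finsupp.single v.1 1 : σ →₀ ℕ)) r g

/-- `h` is the initial part of `g`: the nonzero component of `g` of largest multidegree. -/
def IsInitialPart {𝕜 : Type*} [Field 𝕜] {σ : Type*} (lt : (σ →₀ ℕ) → (σ →₀ ℕ) → Prop)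
    (g h : MvPolynomial (σ × ℕ) 𝕜) : Prop :=
  ∃ r : σ →₀ ℕ, component r g ≠ 0 ∧ h = component r g ∧
    ∀ r' : σ →₀ ℕ, component r' g ≠ 0 → r' = r ∨ lt r' r

/-- The initial ideal of `I`. -/
noncomputable def initialIdeal {𝕜 : Type*} [Field 𝕜] {σ : Type*}
    (lt : (σ →₀ ℕ) → (σ →₀ ℕ) → Prop) (I : Ideal (MvPolynomial (σ × ℕ) 𝕜)) :
    Ideal (MvPolynomial (σ × ℕ) 𝕜) :=
  Ideal.span {h | ∃ g ∈ I, IsInitialPart lt g h}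

/-! ### The toric ring of a polygon -/

/-- The integer points of a planar set. -/
abbrev LatticePoint (P : Set (ℝ × ℝ)) : Type :=
  {a : ℤ × ℤ // ((a.1 : ℝ), (a.2 : ℝ)) ∈ P}

/-- The inclusion of `ℤ³` into `ℝ³`. -/
def latticeHom : ℤ × ℤ × ℤ →+ ℝ × ℝ × ℝ :=
  (Int.castAddHom ℝ).prodMap ((Int.castAddHom ℝ).prodMap (Int.castAddHom ℝ))

/-- The semigroup of integer points of the cone generated by the vectors `(a, 1)`, `a ∈ P`. -/
def coneMonoid (P : Set (ℝ × ℝ)) : AddSubmonoid (ℤ × ℤ × ℤ) :=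
  (PointedCone.hull ℝ ((fun a : ℝ × ℝ => ((a.1, a.2, 1) : ℝ × ℝ × ℝ)) '' P)).toAddSubmonoid.comap
    latticeHom

/-- The toric ring `R(P)`: the semigroup algebra of the integer points of the cone over `P`. -/
abbrev ToricRing (𝕜 : Type*) [Field 𝕜] (P : Set (ℝ × ℝ)) : Type _ :=
  AddMonoidAlgebra 𝕜 (coneMonoid P)

theorem latticePoint_mem_coneMonoid {P : Set (ℝ × ℝ)} (a : LatticePoint P) :
    ((a.1.1, a.1.2, 1) : ℤ × ℤ × ℤ) ∈ coneMonoid P :=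
  Submodule.subset_span ⟨_, a.2, by simp [latticeHom]⟩

/-- The element `Y_a = z^a w` of `R(P)`. -/
noncomputable def toricGen (𝕜 : Type*) [Field 𝕜] (P : Set (ℝ × ℝ)) (a : LatticePoint P) :
    ToricRing 𝕜 P :=
  AddMonoidAlgebra.single ⟨(a.1.1, a.1.2, 1), latticePoint_mem_coneMonoid a⟩ 1

/-! ### The polygon -/

/-- The maximum of `ζ_0, …, ζ_η`. -/
def zetaMax (η : ℕ) (ζ : ℕ → ℕ) : ℕ := (Finset.range (η + 1)).sup ζ

/-- The polygon spanned by the segment `[0, η] × {ζ_max}` and the points `(i, ζ_max - ζ_i)`. -/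
def polygon (η : ℕ) (ζ : ℕ → ℕ) : Set (ℝ × ℝ) :=
  convexHull ℝ ({p | 0 ≤ p.1 ∧ p.1 ≤ η ∧ p.2 = zetaMax η ζ} ∪
    {p | ∃ i : ℕ, i ≤ η ∧ p = ((i : ℝ), (zetaMax η ζ : ℝ) - (ζ i : ℝ))})

/-- The height of the lower boundary of the polygon above an integer `0 ≤ x ≤ η`. -/
def low (η : ℕ) (ζ : ℕ → ℕ) (x : ℤ) : ℤ := (zetaMax η ζ : ℤ) - (ζ x.toNat : ℤ)

/-! ### The polygonal curves -/

/-- `α_1 < β_1`, or `α_1 = β_1` and `α_2 < β_2`. -/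
def Precedes (α β : ℤ × ℤ) : Prop := α.1 < β.1 ∨ (α.1 = β.1 ∧ α.2 < β.2)

/-- The height above `x` of the part, from `x = α_1` to `x = β_1`, of the convex curve joining `α`
to `β` that is the graph of a function. The curve consists of this graph and of vertical unit steps
at its higher end. It is horizontal at the height of the lower end as long as it can be and then
follows the lower boundary of the polygon; the only exception is that, when `β` is lower than `α`
and `(α_1, β_2)` lies in the polygon, it leaves the vertical line at height `β_2 + 1`. -/
def pathHeight (η : ℕ) (ζ : ℕ → ℕ) (α β : ℤ × ℤ) (x : ℤ) : ℤ :=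
  if α.2 ≤ β.2 then max α.2 (low η ζ x)
  else if x = α.1 then max (β.2 + 1) (low η ζ x)
  else max β.2 (low η ζ x)

/-- The number of non-vertical segments of the curve. -/
def pathWidth (α β : ℤ × ℤ) : ℕ := (β.1 - α.1).toNat

/-- The number of vertical segments of the curve. -/
def pathVert (η : ℕ) (ζ : ℕ → ℕ) (α β : ℤ × ℤ) : ℕ :=
  if α.2 ≤ β.2 then (β.2 - pathHeight η ζ α β β.1).toNat
  else (α.2 - pathHeight η ζ α β α.1).toNat

/-- The number `k(α, β)`; the curve has `k(α, β) + 1` segments. -/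
def pathK (η : ℕ) (ζ : ℕ → ℕ) (α β : ℤ × ℤ) : ℕ := pathWidth α β + pathVert η ζ α β - 1

/-- The vectors `e_1, …, e_{k+1}` of the successive segments of the curve; `pathEdge … l` is
`e_{l+1}`, and only `l ≤ k(α, β)` matters. The curve goes to the top right (then the vertical
segments come last) or to the bottom right (then they come first). -/
def pathEdge (η : ℕ) (ζ : ℕ → ℕ) (α β : ℤ × ℤ) (l : ℕ) : ℤ × ℤ :=
  if α.2 ≤ β.2 then
    if l < pathWidth α β then
      (1, pathHeight η ζ α β (α.1 + l + 1) - pathHeight η ζ α β (α.1 + l))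
    else (0, 1)
  else
    if l < pathVert η ζ α β then (0, -1)
    else
      (1, pathHeight η ζ α β (α.1 + (l - pathVert η ζ α β : ℕ) + 1)
        - pathHeight η ζ α β (α.1 + (l - pathVert η ζ α β : ℕ)))

/-- The sum of the vectors of the segments with labels in `I`. -/
def pathSum (η : ℕ) (ζ : ℕ → ℕ) (α β : ℤ × ℤ) (I : Finset ℕ) : ℤ × ℤ :=
  ∑ l ∈ I, pathEdge η ζ α β l

/-! ### The series -/

open Classical in
/-- The series `X_p(s)` for an integer point `p` of `P` (and `0` for other `p`). -/
noncomputable def currentAt (𝕜 : Type*) [Field 𝕜] (P : Set (ℝ × ℝ)) (p : ℤ × ℤ) :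
    PowerSeries (MvPolynomial (LatticePoint P × ℕ) 𝕜) :=
  if h : ((p.1 : ℝ), (p.2 : ℝ)) ∈ P then current 𝕜 (⟨p, h⟩ : LatticePoint P) else 0

/-- The series `∂^m f / ∂s^m`. -/
noncomputable def iterDeriv {A : Type*} [CommRing A] (m : ℕ) (f : PowerSeries A) : PowerSeries A :=
  (PowerSeries.derivative A)^[m] f

/-- The series `W'_{α,β,m}(X)`: the sum over `I ⊆ {1, …, k(α,β)}` of
`(-1)^|I| ∂^m X_{α + e_I}(s) / ∂s^m · X_{β - e_I}(s)` with `e_I = ∑_{j ∈ I} e_j(α,β)`. All points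
that occur lie in the polygon, see `path_mem_polygon` and `sub_path_mem_polygon` below. -/
noncomputable def seriesW (𝕜 : Type*) [Field 𝕜] (η : ℕ) (ζ : ℕ → ℕ) (α β : ℤ × ℤ) (m : ℕ) :
    PowerSeries (MvPolynomial (LatticePoint (polygon η ζ) × ℕ) 𝕜) :=
  ∑ I ∈ (Finset.range (pathK η ζ α β)).powerset,
    (-1) ^ I.card *
      (iterDeriv m (currentAt 𝕜 (polygon η ζ) (α + pathSum η ζ α β I)) *
        currentAt 𝕜 (polygon η ζ) (β - pathSum η ζ α β I))

/-- The series `∂^m X_α(s) / ∂s^m · X_β(s)`. -/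
noncomputable def seriesIn (𝕜 : Type*) [Field 𝕜] {P : Set (ℝ × ℝ)} (α β : LatticePoint P) (m : ℕ) :
    PowerSeries (MvPolynomial (LatticePoint P × ℕ) 𝕜) :=
  iterDeriv m (current 𝕜 α) * current 𝕜 β

/-! ### The monomial order -/

/-- The order of the integer points by rows, and from left to right within a row. -/
def RowLT (α β : ℤ × ℤ) : Prop := α.2 < β.2 ∨ (α.2 = β.2 ∧ α.1 < β.1)

/-- The sum of the exponents in the column `i`. -/
noncomputable def columnSum {P : Set (ℝ × ℝ)} (r : LatticePoint P →₀ ℕ) (i : ℤ) : ℕ :=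
  r.mapDomain (fun α => α.1.1) i

/-- The monomial order: total degree first, then lexicographically the column sums
`r_0, r_1, …, r_η`, then lexicographically the exponents with respect to `RowLT`. -/
def MonomialLT {P : Set (ℝ × ℝ)} (r r' : LatticePoint P →₀ ℕ) : Prop :=
  r.degree < r'.degree ∨
  (r.degree = r'.degree ∧
    ((∃ i : ℤ, columnSum r i < columnSum r' i ∧ ∀ i' < i, columnSum r i' = columnSum r' i') ∨
    ((∀ i : ℤ, columnSum r i = columnSum r' i) ∧
      ∃ α : LatticePoint P, r α < r' α ∧ ∀ β : LatticePoint P, RowLT β.1 α.1 → r β = r' β)))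

/-! ### The curves stay in the polygon -/

/-- The integer points of the polygon. -/
theorem mem_polygon_iff {η : ℕ} {ζ : ℕ → ℕ} (hη : 0 < η)
    (hζ : ∀ i : ℕ, i + 2 ≤ η → (ζ i : ℤ) - ζ (i + 1) ≤ (ζ (i + 1) : ℤ) - ζ (i + 2))
    (p : ℤ × ℤ) : ((p.1 : ℝ), (p.2 : ℝ)) ∈ polygon η ζ ↔
      0 ≤ p.1 ∧ p.1 ≤ η ∧ low η ζ p.1 ≤ p.2 ∧ p.2 ≤ zetaMax η ζ := by
  obtain ⟨x, y⟩ := p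
  simp only
  have hmax : ∀ i : ℕ, i ≤ η → ζ i ≤ zetaMax η ζ := fun i hi =>
    Finset.le_sup (f := ζ) (Finset.mem_range.2 (Nat.lt_succ_of_le hi))
  constructor
  · intro h
    have half : ∀ (a b c : ℝ), (∀ q ∈ ({p | 0 ≤ p.1 ∧ p.1 ≤ η ∧ p.2 = zetaMax η ζ} ∪
        {p | ∃ i : ℕ, i ≤ η ∧ p = ((i : ℝ), (zetaMax η ζ : ℝ) - (ζ i : ℝ))} : Set (ℝ × ℝ)),
        a * q.1 + b * q.2 ≤ c) → a * (x : ℝ) + b * (y : ℝ) ≤ c := by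
      intro a b c hq
      have hc : Convex ℝ {q : ℝ × ℝ | a * q.1 + b * q.2 ≤ c} := by
        intro q hq q' hq' s t hs ht hst
        simp only [Set.mem_ofPred_eq, Prod.fst_add, Prod.smul_fst, Prod.snd_add, Prod.smul_snd,
          smul_eq_mul] at *
        have : c = s * c + t * c := by rw [← add_mul, hst, one_mul]
        nlinarith [mul_le_mul_of_nonneg_left hq hs, mul_le_mul_of_nonneg_left hq' ht]
      exact convexHull_min (fun q hq' => hq q hq') hc h
    have h0 : 0 ≤ x := by
      have := half (-1) 0 0 (by
        rintro q (⟨h1, _, _⟩ | ⟨i, _, rfl⟩)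
        · linarith
        · simp)
      have : (0 : ℝ) ≤ x := by linarith
      exact_mod_cast this
    have h1 : x ≤ η := by
      have := half 1 0 η (by
        rintro q (⟨_, h1, _⟩ | ⟨i, hi, rfl⟩)
        · linarith
        · simpa using hi)
      have : (x : ℝ) ≤ η := by linarith
      exact_mod_cast this
    have h2 : y ≤ zetaMax η ζ := by
      have := half 0 1 (zetaMax η ζ) (by
        rintro q (⟨_, _, h1⟩ | ⟨i, hi, rfl⟩)
        · linarith
        · simp)
      have : (y : ℝ) ≤ zetaMax η ζ := by linarith
      exact_mod_cast this
    refine ⟨h0, h1, ?_, h2⟩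
    lift x to ℕ using h0
    have hx : x ≤ η := by exact_mod_cast h1
    have key : ∃ s : ℤ, ∀ i : ℕ, i ≤ η → (ζ i : ℤ) ≤ ζ x + s * ((i : ℤ) - x) := by
      have step : ∀ i j : ℕ, i ≤ j → j + 1 ≤ η →
          (ζ (j + 1) : ℤ) - ζ j ≤ (ζ (i + 1) : ℤ) - ζ i := by
        intro i j hij
        induction j, hij using Nat.le_induction with
        | base => intro _; exact le_rfl
        | succ j _ ih =>
          intro hj
          have := ih (by omega)
          have := hζ j (by omega)
          rw [show j + 1 + 1 = j + 2 from rfl]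
          omega
      obtain ⟨a, ha, hax, hxa⟩ : ∃ a : ℕ, a + 1 ≤ η ∧ a ≤ x ∧ x ≤ a + 1 := by
        rcases Nat.lt_or_ge x η with h | h
        · exact ⟨x, by omega, le_rfl, by omega⟩
        · exact ⟨η - 1, by omega, by omega, by omega⟩
      refine ⟨(ζ (a + 1) : ℤ) - ζ a, ?_⟩
      have up : ∀ i : ℕ, x ≤ i → i ≤ η →
          (ζ i : ℤ) ≤ ζ x + ((ζ (a + 1) : ℤ) - ζ a) * ((i : ℤ) - x) := by
        intro i hi
        induction i, hi using Nat.le_induction with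
        | base => intro _; simp
        | succ i hi ih =>
          intro hi'
          have h1 := ih (by omega)
          have h2 := step a i (by omega) hi'
          push_cast
          linarith
      have down : ∀ d : ℕ, d ≤ x →
          (ζ (x - d) : ℤ) ≤ ζ x + ((ζ (a + 1) : ℤ) - ζ a) * (-(d : ℤ)) := by
        intro d
        induction d with
        | zero => intro _; simp
        | succ d ih =>
          intro hd
          have h1 := ih (by omega)
          have h2 := step (x - (d + 1)) a (by omega) ha
          rw [show x - (d + 1) + 1 = x - d by omega] at h2
          push_cast
          linarith
      intro i hi
      rcases le_total x i with h | h
      · exact up i h hi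
      · have := down (x - i) (by omega)
        rw [show x - (x - i) = i by omega] at this
        rw [Nat.cast_sub h] at this
        linarith
    obtain ⟨s, hs⟩ := key
    have hsR : ∀ i : ℕ, i ≤ η → (ζ i : ℝ) ≤ ζ x + s * ((i : ℝ) - x) := fun i hi => by
      exact_mod_cast hs i hi
    have hfin := half (-(s : ℝ)) (-1) (ζ x - s * x - zetaMax η ζ) (by
      rintro q (⟨h1, h2, h3⟩ | ⟨i, hi, rfl⟩)
      · have e0 := hsR 0 (by omega)
        have e1 := hsR η le_rfl
        have p0 : (0 : ℝ) ≤ ζ 0 := Nat.cast_nonneg _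
        have p1 : (0 : ℝ) ≤ ζ η := Nat.cast_nonneg _
        push_cast at e0
        rcases le_total (0 : ℝ) s with hs0 | hs0
        · nlinarith
        · nlinarith
      · have := hsR i hi
        simp only
        linarith)
    have : ((zetaMax η ζ : ℤ) - (ζ x : ℤ) : ℝ) ≤ y := by
      push_cast at hfin ⊢
      linarith
    simp only [low, Int.toNat_natCast]
    exact_mod_cast this
  · rintro ⟨h0, h1, h2, h3⟩
    lift x to ℕ using h0
    have hx : x ≤ η := by exact_mod_cast h1
    simp only [low, Int.toNat_natCast] at h2
    have A : (((x : ℤ) : ℝ), (zetaMax η ζ : ℝ)) ∈ polygon η ζ :=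
      subset_convexHull _ _ (Or.inl ⟨by simp, by simpa using hx, rfl⟩)
    have B : (((x : ℤ) : ℝ), (zetaMax η ζ : ℝ) - (ζ x : ℝ)) ∈ polygon η ζ :=
      subset_convexHull _ _ (Or.inr ⟨x, hx, by simp⟩)
    rcases Nat.eq_zero_or_pos (ζ x) with hz | hz
    · have : y = zetaMax η ζ := by omega
      subst this
      exact_mod_cast A
    · have hzR : (0 : ℝ) < ζ x := by exact_mod_cast hz
      have h2R : ((zetaMax η ζ : ℝ) - (ζ x : ℝ)) ≤ y := by exact_mod_cast h2
      have h3R : (y : ℝ) ≤ zetaMax η ζ := by exact_mod_cast h3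
      have := (convex_convexHull ℝ _ : Convex ℝ (polygon η ζ)) A B
        (a := 1 - ((zetaMax η ζ : ℝ) - y) / ζ x) (b := ((zetaMax η ζ : ℝ) - y) / ζ x)
        (by rw [sub_nonneg, div_le_one hzR]; linarith)
        (div_nonneg (by linarith) hzR.le) (by ring)
      have e : (((x : ℤ) : ℝ), (y : ℝ)) =
          (1 - ((zetaMax η ζ : ℝ) - y) / ζ x) • (((x : ℤ) : ℝ), (zetaMax η ζ : ℝ)) +
            (((zetaMax η ζ : ℝ) - y) / ζ x) •
              (((x : ℤ) : ℝ), (zetaMax η ζ : ℝ) - (ζ x : ℝ)) := by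
        refine Prod.ext ?_ ?_
        · simp only [Prod.fst_add, Prod.smul_fst, smul_eq_mul]
          ring
        · simp only [Prod.snd_add, Prod.smul_snd, smul_eq_mul]
          field_simp
          ring
      rw [e]
      exact this

theorem sum_range_card_le (d : ℕ → ℤ) (w : ℕ) (hd : ∀ l, l + 1 < w → d l ≤ d (l + 1))
    (J : Finset ℕ) (hJ : J ⊆ Finset.range w) :
    ∑ l ∈ Finset.range J.card, d l ≤ ∑ l ∈ J, d l := by
  have mono : ∀ i j : ℕ, i ≤ j → j < w → d i ≤ d j := by
    intro i j hij
    induction j, hij using Nat.le_induction with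
    | base => intro _; exact le_rfl
    | succ j _ ih => intro hj; exact (ih (by omega)).trans (hd j hj)
  induction J using Finset.induction_on_max with
  | empty => simp
  | insert a s hs ih =>
    have ha : a ∉ s := fun h => lt_irrefl _ (hs a h)
    rw [Finset.card_insert_of_notMem ha, Finset.sum_range_succ, Finset.sum_insert ha]
    have h1 := ih ((Finset.subset_insert _ _).trans hJ)
    have h2 : s.card ≤ a := by
      have : s ⊆ Finset.range a := fun x hx => Finset.mem_range.2 (hs x hx)
      simpa using Finset.card_le_card this
    have h3 := mono _ _ h2 (Finset.mem_range.1 (hJ (Finset.mem_insert_self _ _)))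
    linarith

theorem path_aux {η : ℕ} {ζ : ℕ → ℕ} (hη : 0 < η)
    (hζ : ∀ i : ℕ, i + 2 ≤ η → (ζ i : ℤ) - ζ (i + 1) ≤ (ζ (i + 1) : ℤ) - ζ (i + 2))
    (α β : LatticePoint (polygon η ζ)) (hαβ : Precedes α.1 β.1) :
    pathSum η ζ α.1 β.1 (Finset.range (pathK η ζ α.1 β.1 + 1)) = β.1 - α.1 ∧
    ∀ I ⊆ Finset.range (pathK η ζ α.1 β.1 + 1),
      ((((α.1 + pathSum η ζ α.1 β.1 I).1 : ℤ) : ℝ), (((α.1 + pathSum η ζ α.1 β.1 I).2 : ℤ) : ℝ))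
        ∈ polygon η ζ := by
  obtain ⟨⟨a1, a2⟩, ha⟩ := α
  obtain ⟨⟨b1, b2⟩, hb⟩ := β
  have ha' := (mem_polygon_iff hη hζ _).1 ha
  have hb' := (mem_polygon_iff hη hζ _).1 hb
  simp only [Precedes] at ha' hb' hαβ ⊢
  obtain ⟨ha0, ha1, ha2, ha3⟩ := ha'
  obtain ⟨hb0, hb1, hb2, hb3⟩ := hb'
  obtain ⟨w, hw⟩ : ∃ w : ℕ, b1 = a1 + w := ⟨(b1 - a1).toNat, by omega⟩
  subst hw
  have hW : pathWidth (a1, a2) (a1 + w, b2) = w := by simp [pathWidth]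
  set H := pathHeight η ζ (a1, a2) (a1 + w, b2) with hH
  set d : ℕ → ℤ := fun l => H (a1 + l + 1) - H (a1 + l) with hd
  have tele : ∀ m : ℕ, ∑ l ∈ Finset.range m, d l = H (a1 + m) - H a1 := by
    intro m
    have := Finset.sum_range_sub (fun l : ℕ => H (a1 + l)) m
    simpa [hd, add_assoc] using this
  have conv : ∀ l : ℕ, l + 1 < w → low η ζ (a1 + l + 1) - low η ζ (a1 + l)
      ≤ low η ζ (a1 + l + 1 + 1) - low η ζ (a1 + l + 1) := by
    intro l hl
    have h := hζ (a1.toNat + l) (by omega)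
    simp only [low]
    rw [show (a1 + l + 1 + 1).toNat = a1.toNat + l + 2 by omega,
      show (a1 + l + 1).toNat = a1.toNat + l + 1 by omega,
      show (a1 + l).toNat = a1.toNat + l by omega]
    omega
  have Hlow : ∀ x, low η ζ x ≤ H x := by
    intro x
    simp only [hH, pathHeight]
    split_ifs <;> omega
  have hmono : ∀ l : ℕ, l + 1 < w → d l ≤ d (l + 1) := by
    intro l hl
    have h := conv l hl
    simp only [hd, hH, pathHeight]
    push_cast
    rw [show a1 + ((l : ℤ) + 1) + 1 = a1 + l + 1 + 1 by ring,
      show a1 + ((l : ℤ) + 1) = a1 + l + 1 by ring]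
    by_cases hc : a2 ≤ b2
    · simp only [hc, if_true]
      omega
    · simp only [hc, if_false]
      split_ifs <;> omega
  have hmem : ∀ p : ℤ × ℤ, 0 ≤ p.1 → p.1 ≤ η → low η ζ p.1 ≤ p.2 → p.2 ≤ zetaMax η ζ →
      ((p.1 : ℝ), (p.2 : ℝ)) ∈ polygon η ζ := fun p h0 h1 h2 h3 =>
    (mem_polygon_iff hη hζ p).2 ⟨h0, h1, h2, h3⟩
  by_cases hc : a2 ≤ b2
  · have hH0 : H a1 = a2 := by
      simp only [hH, pathHeight, hc, if_true]
      omega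
    have hHw : H (a1 + w) ≤ b2 := by
      simp only [hH, pathHeight, hc, if_true]
      omega
    have hHge : ∀ x, a2 ≤ H x := by
      intro x
      simp only [hH, pathHeight, hc, if_true]
      omega
    have hV : (pathVert η ζ (a1, a2) (a1 + w, b2) : ℤ) = b2 - H (a1 + w) := by
      simp only [pathVert, hc, if_true, ← hH]
      omega
    set V := pathVert η ζ (a1, a2) (a1 + w, b2) with hVdef
    have hK : pathK η ζ (a1, a2) (a1 + w, b2) + 1 = w + V := by
      simp only [pathK, hW, ← hVdef]
      rcases Nat.eq_zero_or_pos w with h | h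
      · subst h
        simp only [Nat.cast_zero, add_zero] at hV hαβ
        omega
      · omega
    have hsum : ∀ I : Finset ℕ, pathSum η ζ (a1, a2) (a1 + w, b2) I =
        (((I.filter (· < w)).card : ℤ),
          (∑ l ∈ I.filter (· < w), d l) + ((I.filter (fun l => ¬ l < w)).card : ℤ)) := by
      intro I
      simp only [pathSum, pathEdge, hc, if_true, hW, ← hH]
      rw [Finset.sum_ite]
      refine Prod.ext ?_ ?_
      · simp [Prod.fst_sum]
      · simp [Prod.snd_sum, hd]
    have dnn : ∀ l, l < w → 0 ≤ d l := by
      intro l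
      induction l with
      | zero =>
        intro _
        have := hHge (a1 + 1)
        simp only [hd, Nat.cast_zero, add_zero, hH0]
        omega
      | succ l ih => intro hl; exact (ih (by omega)).trans (hmono l hl)
    rw [hK]
    have f1 : (Finset.range (w + V)).filter (· < w) = Finset.range w := by
      ext x; simp only [Finset.mem_filter, Finset.mem_range]; omega
    have f2 : ((Finset.range (w + V)).filter (fun l => ¬ l < w)).card = V := by
      have := Finset.card_filter_add_card_filter_not (s := Finset.range (w + V)) (· < w)
      rw [f1] at this
      simp only [Finset.card_range] at this
      omega
    refine ⟨?_, ?_⟩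
    · rw [hsum, f1, f2, tele, hH0]
      refine Prod.ext ?_ ?_
      · simp
      · simp only [Prod.snd_sub]
        omega
    · intro I hI
      rw [hsum]
      set J := I.filter (· < w) with hJ
      have hJw : J ⊆ Finset.range w := by
        rw [← f1]; exact Finset.filter_subset_filter _ hI
      have hcard : J.card ≤ w := by simpa using Finset.card_le_card hJw
      have h1 := sum_range_card_le d w hmono J hJw
      rw [tele, hH0] at h1
      have h2 : ∑ l ∈ J, d l ≤ ∑ l ∈ Finset.range w, d l :=
        Finset.sum_le_sum_of_subset_of_nonneg hJw fun i hi _ => dnn i (Finset.mem_range.1 hi)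
      rw [tele, hH0] at h2
      have h3 : (I.filter (fun l => ¬ l < w)).card ≤ V := by
        rw [← f2]; exact Finset.card_le_card (Finset.filter_subset_filter _ hI)
      have h4 := Hlow (a1 + J.card)
      refine hmem _ ?_ ?_ ?_ ?_ <;> simp only [Prod.fst_add, Prod.snd_add] <;> omega
  · have hw0 : 0 < w := by omega
    have hHw : H (a1 + w) = b2 := by
      simp only [hH, pathHeight, hc, if_false]
      rw [if_neg (by omega)]
      omega
    have hH0 : H a1 ≤ a2 := by
      simp only [hH, pathHeight, hc, if_false, if_true]
      omega
    have hHge : ∀ x, b2 ≤ H x := by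
      intro x
      simp only [hH, pathHeight, hc, if_false]
      split_ifs <;> omega
    have hV : (pathVert η ζ (a1, a2) (a1 + w, b2) : ℤ) = a2 - H a1 := by
      simp only [pathVert, hc, if_false, ← hH]
      omega
    set V := pathVert η ζ (a1, a2) (a1 + w, b2) with hVdef
    have hK : pathK η ζ (a1, a2) (a1 + w, b2) + 1 = w + V := by
      simp only [pathK, hW, ← hVdef]
      omega
    have hsum : ∀ I : Finset ℕ, pathSum η ζ (a1, a2) (a1 + w, b2) I =
        ((((I.filter (fun l => ¬ l < V)).image (· - V)).card : ℤ),
          (∑ l ∈ (I.filter (fun l => ¬ l < V)).image (· - V), d l)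
            - ((I.filter (· < V)).card : ℤ)) := by
      intro I
      have inj : Set.InjOn (· - V) ((I.filter (fun l => ¬ l < V) : Finset ℕ) : Set ℕ) := by
        intro x hx y hy hxy
        simp only [Finset.coe_filter, Set.mem_ofPred_eq] at hx hy hxy
        omega
      rw [Finset.card_image_of_injOn inj, Finset.sum_image inj]
      simp only [pathSum, pathEdge, hc, if_false, ← hVdef, ← hH]
      rw [Finset.sum_ite]
      refine Prod.ext ?_ ?_
      · simp [Prod.fst_sum]
      · simp only [Prod.snd_add, Prod.snd_sum, hd, Finset.sum_const, nsmul_eq_mul,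
          Prod.snd_mul, Prod.snd_natCast]
        ring
    have dnp : ∀ l, l < w → d l ≤ 0 := by
      have hlast : d (w - 1) ≤ 0 := by
        have h := hHge (a1 + ((w - 1 : ℕ) : ℤ))
        simp only [hd]
        rw [show a1 + ((w - 1 : ℕ) : ℤ) + 1 = a1 + w by omega, hHw]
        omega
      have : ∀ j, j < w → d (w - 1 - j) ≤ 0 := by
        intro j
        induction j with
        | zero => intro _; exact hlast
        | succ j ih =>
          intro hj
          have h := hmono (w - 1 - (j + 1)) (by omega)
          rw [show w - 1 - (j + 1) + 1 = w - 1 - j by omega] at h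
          exact h.trans (ih (by omega))
      intro l hl
      have h := this (w - 1 - l) (by omega)
      rwa [show w - 1 - (w - 1 - l) = l by omega] at h
    rw [hK]
    have f1 : ((Finset.range (w + V)).filter (fun l => ¬ l < V)).image (· - V)
        = Finset.range w := by
      ext x
      simp only [Finset.mem_image, Finset.mem_filter, Finset.mem_range]
      constructor
      · rintro ⟨y, hy, rfl⟩; omega
      · intro hx; exact ⟨x + V, by omega, by omega⟩
    have f2 : (Finset.range (w + V)).filter (· < V) = Finset.range V := by
      ext x; simp only [Finset.mem_filter, Finset.mem_range]; omega
    refine ⟨?_, ?_⟩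
    · rw [hsum, f1, f2, tele, hHw]
      refine Prod.ext ?_ ?_
      · simp
      · simp only [Prod.snd_sub, Finset.card_range]
        omega
    · intro I hI
      rw [hsum]
      set J := (I.filter (fun l => ¬ l < V)).image (· - V) with hJ
      have hJw : J ⊆ Finset.range w := by
        rw [← f1]; exact Finset.image_subset_image (Finset.filter_subset_filter _ hI)
      have hcard : J.card ≤ w := by simpa using Finset.card_le_card hJw
      have h1 := sum_range_card_le d w hmono J hJw
      rw [tele] at h1
      have h2 : ∑ l ∈ J, d l ≤ 0 :=
        Finset.sum_nonpos fun i hi => dnp i (Finset.mem_range.1 (hJw hi))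
      have h3 : (I.filter (· < V)).card ≤ V := by
        have := Finset.card_le_card (Finset.filter_subset_filter (· < V) hI)
        rwa [f2, Finset.card_range] at this
      have h4 := Hlow (a1 + J.card)
      refine hmem _ ?_ ?_ ?_ ?_ <;> simp only [Prod.fst_add, Prod.snd_add] <;> omega

/-- `α + ∑_{j ∈ I} e_j` lies in the polygon for every `I ⊆ {1, …, k + 1}`. -/
theorem path_mem_polygon {η : ℕ} {ζ : ℕ → ℕ} (hη : 0 < η)
    (hζ : ∀ i : ℕ, i + 2 ≤ η → (ζ i : ℤ) - ζ (i + 1) ≤ (ζ (i + 1) : ℤ) - ζ (i + 2))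
    (α β : LatticePoint (polygon η ζ)) (hαβ : Precedes α.1 β.1) (I : Finset ℕ)
    (hI : I ⊆ Finset.range (pathK η ζ α.1 β.1 + 1)) :
    ((((α.1 + pathSum η ζ α.1 β.1 I).1 : ℤ) : ℝ), (((α.1 + pathSum η ζ α.1 β.1 I).2 : ℤ) : ℝ))
      ∈ polygon η ζ :=
  (path_aux hη hζ α β hαβ).2 I hI

/-- `β - ∑_{j ∈ I} e_j` lies in the polygon for every `I ⊆ {1, …, k + 1}`. -/
theorem sub_path_mem_polygon {η : ℕ} {ζ : ℕ → ℕ} (hη : 0 < η)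
    (hζ : ∀ i : ℕ, i + 2 ≤ η → (ζ i : ℤ) - ζ (i + 1) ≤ (ζ (i + 1) : ℤ) - ζ (i + 2))
    (α β : LatticePoint (polygon η ζ)) (hαβ : Precedes α.1 β.1) (I : Finset ℕ)
    (hI : I ⊆ Finset.range (pathK η ζ α.1 β.1 + 1)) :
    ((((β.1 - pathSum η ζ α.1 β.1 I).1 : ℤ) : ℝ), (((β.1 - pathSum η ζ α.1 β.1 I).2 : ℤ) : ℝ))
      ∈ polygon η ζ := by
  obtain ⟨h1, h2⟩ := path_aux hη hζ α β hαβ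
  have h3 := h2 (Finset.range (pathK η ζ α.1 β.1 + 1) \ I) Finset.sdiff_subset
  have h4 : pathSum η ζ α.1 β.1 (Finset.range (pathK η ζ α.1 β.1 + 1) \ I) +
      pathSum η ζ α.1 β.1 I = β.1 - α.1 := by
    rw [← h1]; exact Finset.sum_sdiff hI
  have h5 : β.1 - pathSum η ζ α.1 β.1 I =
      α.1 + pathSum η ζ α.1 β.1 (Finset.range (pathK η ζ α.1 β.1 + 1) \ I) := by
    rw [eq_sub_iff_add_eq.2 h4]; abel
  rw [h5]
  exact h3

end ToricArc
open ToricArc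

/-!
Let `I` be the ideal of relations and `Q` the ideal generated by the coefficients of the series
`∂^m X_α · X_β`, `m < k(α, β)`. It suffices to show that

* the coefficients of the series `W'` belong to `I` (`coeff_seriesW_mem_relationIdeal`);
* their initial parts are the corresponding coefficients of `∂^m X_α · X_β`
  (`isInitialPart_coeff_seriesW`);
* the initial part of every element of `I` belongs to `Q` (`initialPart_mem_span`).

Then `Q` is the initial ideal, and the coefficients of `W'` generate `I` by induction on the largest
multidegree of an element, since the order of the multidegrees is a translation invariant well-order
(`span_eq_of_isInitialPart`).

**Relations.** A polynomial is a relation if it vanishes at the arcs over all domains that are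
quotients of the arc ring. In a domain, write `F(S)` and `G(S)` for the series at the points
`α + e_S` and `β - e_S`, `S ⊆ {1, …, k}`. If they are not zero, a step `e_j`
multiplies `F` by some `z_j` and `G` by `z_j⁻¹`, so that the alternating sum of
`∂^m F(S) · G(S)` is given by the `k`-fold commutator of `∂^m` with multiplication operators,
and it vanishes for `m < k`, see `alternating_cube_sum_eq_zero`.

**Initial parts of `W'`.** The points `α + e_S` and `β - e_S` with `S ≠ ∅` lie either strictly between
the columns of `α` and `β`, or in these two columns and after the first of `α` and `β` in the row
order (`pathSum_between`).

**Leading components of relations.** Let `f ∈ I` have leading multidegree `r` of total degree `L`,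
and choose a labelling `σ₀ : Fin L → P` of `L` positions by lattice points in which each point `α`
occurs `r_α` times. A relation vanishes at the arcs `Y_α = z₁^{α₁} z₂^{α₂} w` with polynomials
`z₁, z₂, w`. Polarization turns this into a pairing of `f` with families of polynomials in
`s_1, …, s_L` indexed by all labellings, and the pairing vanishes on the families
`σ ↦ p ∏_i z₁(s_i)^{x(σ_i)} z₂(s_i)^{y(σ_i)}` (`pairing_eq_zero_of_arcs`).

Consider such products, times monomials in permuted variables, as functions of a labelling `σ` of
multidegree at most `r` and of a permutation `w`. They span an algebra. Antisymmetrizing an element of it over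
`w` and dividing by the Vandermonde product `Δ` gives a family that pairs to zero with `f`
(`exists_antisymmetrization`). If on the support of a function `b` in this algebra the label at a position `d`
has coordinate `t ≥ m_d`, then `b ∏_d (s_c - s_d)^{t - m_d}` belongs to the algebra as well, because
it arises by dividing a polynomial in an auxiliary variable by a monic one and evaluating the
quotient (`mul_prod_mem_arcAlg`). The factor `d = c` is zero unless the coordinate of the label at
`c` equals `m_c`. Doing this for all `c`, first with the columns and then with the rows, selects the
rearrangements of `σ₀` among the labellings of multidegree at most `r`, in accordance with the way
in which the monomial order compares multidegrees (`selection_mem_arcAlg`). A pair of positions with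
labels `α ≠ β` contributes the exponent `k(α, β) + 1` to the value of the selected function
(`pairExponent_add_eq`), one of which cancels against `Δ`. For equal labels the factor of `Δ` is
supplied by a multiplier. Hence `f` pairs to zero at `σ₀` with all multiples of
`∏_{c<d} (s_c - s_d)^{k(σ₀ c, σ₀ d)}` (`pairing_single_eq_zero`).

Conversely, a linear functional that kills `Q` has a generating polynomial, for monomials labelled by
`σ₀`, whose derivatives of order less than `k(σ₀ c, σ₀ d)` vanish on `s_c = s_d`. It therefore is such
a multiple in characteristic `0`, and the functional kills the leading component of `f`
(`component_mem_of_pairing_eq_zero`).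
-/

namespace ToricArc

/-! ### An alternating sum over a cube -/

/-- The Leibniz formula for the iterates of a derivation. -/
theorem iterate_derivation_mul {R A : Type*} [CommRing R] [CommRing A] [Algebra R A]
    (D : Derivation R A A) (m : ℕ) (a b : A) :
    D^[m] (a * b) = ∑ l ∈ Finset.range (m + 1), (m.choose l : A) * (D^[m - l] a * D^[l] b) := by
  have key : D^[m] (a * b) =
      ∑ ij ∈ Finset.HasAntidiagonal.antidiagonal m, m.choose ij.1 • (D^[ij.1] b * D^[ij.2] a) := by
    induction m with
    | zero => simp [mul_comm]
    | succ m ih =>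
      rw [Function.iterate_succ_apply', ih,
        Finset.sum_antidiagonal_choose_succ_nsmul (fun i j => D^[i] b * D^[j] a) m, map_sum,
        ← Finset.sum_add_distrib]
      refine Finset.sum_congr rfl fun ij h => ?_
      rw [map_nsmul, Derivation.leibniz, smul_add, smul_eq_mul, smul_eq_mul,
        Function.iterate_succ_apply', Function.iterate_succ_apply',
        Nat.choose_symm_of_eq_add (Finset.HasAntidiagonal.mem_antidiagonal.1 h).symm, mul_comm (D^[ij.2] a)]
  rw [key, Finset.Nat.sum_antidiagonal_eq_sum_range_succ_mk]
  refine Finset.sum_congr rfl fun l _ => ?_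
  rw [nsmul_eq_mul, mul_comm (D^[l] b)]

/-- Let `F` and `G` be functions on a `k`-dimensional cube such that each step in a direction `j`
multiplies `F` by a quantity `z_j` and `G` by its inverse. Then `∑ (-1)^|I| D^m F(I) · G(I)` is, up
to a factor, the value of the iterated commutator of `D^m` with the multiplications by the `z_j`,
which vanishes for `m < k` because `D^m` has order `m`. The hypotheses are free of denominators, and
the proof is an induction on `k` by the Leibniz formula. -/
theorem alternating_cube_sum_eq_zero {R A : Type*} [CommRing R] [CommRing A] [IsDomain A]
    [Algebra R A] (D : Derivation R A A) (k : ℕ) :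
    ∀ F G : Finset ℕ → A,
      (∀ I ⊆ Finset.range k, F I ≠ 0) →
      (∀ j < k, ∀ I ⊆ Finset.range k, ∀ J ⊆ Finset.range k, j ∉ I → j ∉ J →
        F (insert j I) * F J = F I * F (insert j J)) →
      (∀ j < k, ∀ I ⊆ Finset.range k, ∀ J ⊆ Finset.range k, j ∉ I → j ∉ J →
        G (insert j I) * F (insert j J) = G I * F J) →
      ∀ m < k, ∑ I ∈ (Finset.range k).powerset, (-1) ^ I.card * (D^[m] (F I) * G I) = 0 := by
  induction k with
  | zero => intro F G _ _ _ m hm; omega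
  | succ k ih =>
    intro F G hF hFF hFG m hm
    have sub : ∀ {I : Finset ℕ}, I ⊆ Finset.range k → I ⊆ Finset.range (k + 1) := fun h =>
      h.trans (Finset.range_subset_range.2 (Nat.le_succ k))
    have ins : ∀ {I : Finset ℕ}, I ⊆ Finset.range k → insert k I ⊆ Finset.range (k + 1) :=
      fun h => Finset.insert_subset (Finset.self_mem_range_succ k) (sub h)
    have nk : ∀ {I : Finset ℕ}, I ⊆ Finset.range k → k ∉ I := fun h hk =>
      absurd (Finset.mem_range.1 (h hk)) (lt_irrefl k)
    have e0 : (∅ : Finset ℕ) ⊆ Finset.range k := Finset.empty_subset _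
    have nins : ∀ {j : ℕ} {I : Finset ℕ}, j < k → j ∉ I → j ∉ insert k I := fun hj h hk => by
      rcases Finset.mem_insert.1 hk with rfl | h'
      · exact lt_irrefl _ hj
      · exact h h'
    -- the two faces that occur in the Leibniz expansion
    have S1 : ∀ l < m, ∑ I ∈ (Finset.range k).powerset,
        (-1) ^ I.card * (D^[l] (F I) * G (insert k I)) = 0 := fun l hl =>
      ih F (fun I => G (insert k I)) (fun I hI => hF I (sub hI))
        (fun j hj I hI J hJ h1 h2 => hFF j (by omega) I (sub hI) J (sub hJ) h1 h2)
        (fun j hj I hI J hJ h1 h2 => by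
          rw [Finset.insert_comm]
          exact hFG j (by omega) _ (ins hI) J (sub hJ) (nins hj h1) h2) l (by omega)
    have S2 : ∀ l < m, ∑ I ∈ (Finset.range k).powerset,
        (-1) ^ I.card * (D^[l] (F (insert k I)) * G (insert k I)) = 0 := fun l hl =>
      ih (fun I => F (insert k I)) (fun I => G (insert k I)) (fun I hI => hF _ (ins hI))
        (fun j hj I hI J hJ h1 h2 => by
          rw [Finset.insert_comm k j I, Finset.insert_comm k j J]
          exact hFF j (by omega) _ (ins hI) _ (ins hJ) (nins hj h1) (nins hj h2))
        (fun j hj I hI J hJ h1 h2 => by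
          rw [Finset.insert_comm k j I, Finset.insert_comm k j J]
          exact hFG j (by omega) _ (ins hI) _ (ins hJ) (nins hj h1) (nins hj h2)) l (by omega)
    have hγ : F ∅ ≠ 0 := hF ∅ (Finset.empty_subset _)
    refine (mul_eq_zero_iff_left hγ).1 ?_
    rw [Finset.range_add_one, Finset.sum_powerset_insert Finset.notMem_range_self,
      ← Finset.sum_add_distrib, Finset.mul_sum]
    have term : ∀ I ∈ (Finset.range k).powerset,
        F ∅ * ((-1) ^ I.card * (D^[m] (F I) * G I) +
          (-1) ^ (insert k I).card * (D^[m] (F (insert k I)) * G (insert k I))) =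
        ∑ l ∈ Finset.range m, ((m.choose l : A) * D^[m - l] (F ∅) *
            ((-1) ^ I.card * (D^[l] (F (insert k I)) * G (insert k I))) -
          (m.choose l : A) * D^[m - l] (F {k}) *
            ((-1) ^ I.card * (D^[l] (F I) * G (insert k I)))) := by
      intro I hI
      rw [Finset.mem_powerset] at hI
      have h1 := hFF k (by omega) I (sub hI) ∅ (sub e0) (nk hI) (by simp)
      have h2 := hFG k (by omega) I (sub hI) ∅ (sub e0) (nk hI) (by simp)
      have h3 : D^[m] (F ∅ * F (insert k I)) = D^[m] (F {k} * F I) := by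
        rw [mul_comm, h1, mul_comm]; rfl
      rw [iterate_derivation_mul, iterate_derivation_mul, Finset.sum_range_succ,
        Finset.sum_range_succ] at h3
      simp only [Nat.choose_self, Nat.cast_one, one_mul, Nat.sub_self, Function.iterate_zero,
        id_eq] at h3
      rw [Finset.card_insert_of_notMem (nk hI), pow_succ]
      have h4 : ∑ l ∈ Finset.range m, ((m.choose l : A) * D^[m - l] (F ∅) *
            ((-1) ^ I.card * (D^[l] (F (insert k I)) * G (insert k I))) -
          (m.choose l : A) * D^[m - l] (F {k}) *
            ((-1) ^ I.card * (D^[l] (F I) * G (insert k I)))) =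
          (-1) ^ I.card * G (insert k I) *
          (∑ l ∈ Finset.range m, (m.choose l : A) * (D^[m - l] (F ∅) * D^[l] (F (insert k I))) -
          ∑ l ∈ Finset.range m, (m.choose l : A) * (D^[m - l] (F {k}) * D^[l] (F I))) := by
        rw [mul_sub, Finset.mul_sum, Finset.mul_sum, ← Finset.sum_sub_distrib]
        refine Finset.sum_congr rfl fun l _ => ?_
        ring
      rw [h4]
      have h2' : G (insert k I) * F {k} = G I * F ∅ := h2
      linear_combination -(-1) ^ I.card * G (insert k I) * h3 - (-1) ^ I.card * D^[m] (F I) * h2'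
    rw [Finset.sum_congr rfl term, Finset.sum_comm]
    refine Finset.sum_eq_zero fun l hl => ?_
    rw [Finset.sum_sub_distrib, ← Finset.mul_sum, ← Finset.mul_sum, S1 l (Finset.mem_range.1 hl),
      S2 l (Finset.mem_range.1 hl)]
    simp

/-! ### The two descriptions of the ideal of relations -/

theorem quotient_mk_aeval {𝕜 A τ : Type*} [Field 𝕜] [CommRing A] [Algebra 𝕜 A] (p : Ideal A)
    (v : τ → A) (f : MvPolynomial τ 𝕜) :
    Ideal.Quotient.mk p (MvPolynomial.aeval v f) =
      MvPolynomial.aeval (fun i => Ideal.Quotient.mk p (v i)) f := by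
  induction f using MvPolynomial.induction_on with
  | C a => simp only [MvPolynomial.aeval_C]; rfl
  | add p q hp hq => simp only [map_add, hp, hq]
  | mul_X p i hp => simp only [map_mul, MvPolynomial.aeval_X, hp]

/-- A polynomial belongs to the ideal of relations if it vanishes at the universal arc over every
domain that is a quotient of the arc ring. -/
theorem mem_relationIdeal_of_forall_prime {𝕜 : Type*} [Field 𝕜] {R : Type*} [CommRing R]
    [Algebra 𝕜 R] {σ : Type*} (y : σ → R) (f : MvPolynomial (σ × ℕ) 𝕜)
    (h : ∀ p : Ideal (ArcRing 𝕜 R), p.IsPrime →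
      MvPolynomial.aeval (R := 𝕜) (fun v : σ × ℕ =>
        (Ideal.Quotient.mk p (Ideal.Quotient.mk _ (MvPolynomial.X (y v.1, v.2))) :
          ArcRing 𝕜 R ⧸ p)) f = 0) :
    f ∈ relationIdeal 𝕜 y := by
  have hmem : MvPolynomial.aeval (R := 𝕜) (fun v : σ × ℕ =>
      (Ideal.Quotient.mk _ (MvPolynomial.X (y v.1, v.2)) : ArcRing 𝕜 R)) f ∈
      nilradical (ArcRing 𝕜 R) := by
    rw [nilradical_eq_sInf, Submodule.mem_sInf]
    intro p hp
    rw [← Ideal.Quotient.eq_zero_iff_mem, quotient_mk_aeval]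
    exact h p hp
  rw [← Ideal.Quotient.eq_zero_iff_mem, quotient_mk_aeval] at hmem
  rw [relationIdeal, RingHom.mem_ker]
  exact hmem

/-- The generating series of the elements `r^{(j)}` of the arc ring are multiplicative in `r`. -/
theorem mk_arc_mul {𝕜 : Type*} [Field 𝕜] {R : Type*} [CommRing R] [Algebra 𝕜 R] (r r' : R) :
    (PowerSeries.mk fun j => (Ideal.Quotient.mk _ (MvPolynomial.X (r * r', j)) : ArcRing 𝕜 R)) =
      (PowerSeries.mk fun j => (Ideal.Quotient.mk _ (MvPolynomial.X (r, j)) : ArcRing 𝕜 R)) *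
      PowerSeries.mk fun j => (Ideal.Quotient.mk _ (MvPolynomial.X (r', j)) : ArcRing 𝕜 R) := by
  set π := Ideal.Quotient.mk (arcIdeal (RingHom.ker (MvPolynomial.aeval (R := 𝕜) (id : R → R))))
  have hc : ∀ r : R, (PowerSeries.mk fun j => π (MvPolynomial.X (r, j))) =
      PowerSeries.map π (current 𝕜 r) := fun r => by
    ext n; simp [current]
  rw [hc, hc, hc, ← map_mul, ← sub_eq_zero, ← map_sub]
  ext n
  rw [PowerSeries.coeff_map, map_zero, Ideal.Quotient.eq_zero_iff_mem]
  refine Ideal.subset_span ⟨MvPolynomial.X (r * r') - MvPolynomial.X r * MvPolynomial.X r', ?_,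
    n, ?_⟩
  · simp [RingHom.mem_ker]
  · simp

/-- An arc of `R` over `𝕜` is a zero of the ideal of relations. -/
theorem aeval_arc_eq_zero {𝕜 : Type*} [Field 𝕜] {R : Type*} [CommRing R] [Algebra 𝕜 R]
    {σ : Type*} (y : σ → R) (ψ : R →ₐ[𝕜] PowerSeries 𝕜) {f : MvPolynomial (σ × ℕ) 𝕜}
    (hf : f ∈ relationIdeal 𝕜 y) :
    MvPolynomial.aeval (fun v : σ × ℕ => PowerSeries.coeff v.2 (ψ (y v.1))) f = 0 := by
  set ev : MvPolynomial (R × ℕ) 𝕜 →ₐ[𝕜] 𝕜 :=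
    MvPolynomial.aeval (fun v : R × ℕ => PowerSeries.coeff v.2 (ψ v.1)) with hev
  have h1 : ∀ a ∈ arcIdeal (RingHom.ker (MvPolynomial.aeval (R := 𝕜) (id : R → R))), ev a = 0 := by
    intro a ha
    have : arcIdeal (RingHom.ker (MvPolynomial.aeval (R := 𝕜) (id : R → R))) ≤ RingHom.ker ev := by
      refine Ideal.span_le.2 ?_
      rintro _ ⟨g, hg, n, rfl⟩
      have h2 : ∀ g : MvPolynomial R 𝕜,
          PowerSeries.map (ev : MvPolynomial (R × ℕ) 𝕜 →+* 𝕜)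
            (MvPolynomial.aeval (current 𝕜 (σ := R)) g) =
          ψ (MvPolynomial.aeval (R := 𝕜) (id : R → R) g) := by
        intro g
        induction g using MvPolynomial.induction_on with
        | C a =>
          simp only [MvPolynomial.aeval_C, AlgHom.commutes]
          ext n
          simp [PowerSeries.algebraMap_apply, PowerSeries.coeff_C, hev]
        | add p q hp hq => simp only [map_add, hp, hq]
        | mul_X p i hp =>
          rw [map_mul, map_mul, map_mul, map_mul, hp]
          congr 1
          ext n
          simp [current, hev]
      have h3 := congrArg (PowerSeries.coeff n) (h2 g)
      rw [PowerSeries.coeff_map, (RingHom.mem_ker).1 hg, map_zero, map_zero] at h3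
      exact h3
    exact this ha
  set φ : ArcRing 𝕜 R →+* 𝕜 := Ideal.Quotient.lift _ (ev : MvPolynomial (R × ℕ) 𝕜 →+* 𝕜) h1
  -- the relation holds up to a nilpotent element, which vanishes in the field `𝕜`
  have h2 : MvPolynomial.aeval (R := 𝕜) (fun v : σ × ℕ =>
      (Ideal.Quotient.mk _ (MvPolynomial.X (y v.1, v.2)) : ArcRing 𝕜 R)) f ∈
      nilradical (ArcRing 𝕜 R) := by
    rw [← Ideal.Quotient.eq_zero_iff_mem, quotient_mk_aeval]
    exact (RingHom.mem_ker).1 hf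
  have h3 := IsNilpotent.eq_zero ((mem_nilradical.1 h2).map φ)
  have h4 : MvPolynomial.aeval (R := 𝕜) (fun v : σ × ℕ =>
      (Ideal.Quotient.mk _ (MvPolynomial.X (y v.1, v.2)) : ArcRing 𝕜 R)) f =
      Ideal.Quotient.mk _ (MvPolynomial.aeval (R := 𝕜)
        (fun v : σ × ℕ => (MvPolynomial.X (y v.1, v.2) : MvPolynomial (R × ℕ) 𝕜)) f) :=
    (quotient_mk_aeval _ _ f).symm
  rw [h4] at h3
  have h5 : ev (MvPolynomial.aeval (R := 𝕜)
        (fun v : σ × ℕ => (MvPolynomial.X (y v.1, v.2) : MvPolynomial (R × ℕ) 𝕜)) f) = 0 := h3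
  rw [MvPolynomial.comp_aeval_apply] at h5
  simpa [hev] using h5

/-! ### The series `W'` vanish on all arcs over domains -/

theorem map_iterDeriv {A B : Type*} [CommRing A] [CommRing B] (φ : A →+* B) (m : ℕ)
    (f : PowerSeries A) :
    PowerSeries.map φ (iterDeriv m f) = iterDeriv m (PowerSeries.map φ f) := by
  induction m with
  | zero => rfl
  | succ m ih =>
    unfold iterDeriv at ih ⊢
    rw [Function.iterate_succ_apply', Function.iterate_succ_apply', ← ih]
    ext n
    simp [PowerSeries.coeff_derivative]

theorem toricGen_mul_toricGen (𝕜 : Type*) [Field 𝕜] {P : Set (ℝ × ℝ)} {a b a' b' : LatticePoint P}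
    (h : a.1 + b.1 = a'.1 + b'.1) :
    toricGen 𝕜 P a * toricGen 𝕜 P b = toricGen 𝕜 P a' * toricGen 𝕜 P b' := by
  unfold toricGen
  rw [AddMonoidAlgebra.single_mul_single, AddMonoidAlgebra.single_mul_single]
  congr 1
  have h1 := congrArg Prod.fst h
  have h2 := congrArg Prod.snd h
  simp only [Prod.fst_add, Prod.snd_add] at h1 h2
  ext <;> simp [h1, h2]

theorem pathSum_insert (η : ℕ) (ζ : ℕ → ℕ) (α β : ℤ × ℤ) {j : ℕ} {I : Finset ℕ} (h : j ∉ I) :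
    pathSum η ζ α β (insert j I) = pathEdge η ζ α β j + pathSum η ζ α β I :=
  Finset.sum_insert h

/-- A polynomial belongs to the ideal of relations if it vanishes at every multiplicative family of
power series over a domain. -/
theorem mem_relationIdeal_of_forall_domain.{u, v, w} {𝕜 : Type u} [Field 𝕜] {R : Type v}
    [CommRing R] [Algebra 𝕜 R] {σ : Type w} (y : σ → R) (f : MvPolynomial (σ × ℕ) 𝕜)
    (h : ∀ (A : Type (max u v)) [CommRing A] [IsDomain A] (φ : MvPolynomial (σ × ℕ) 𝕜 →+* A)
      (Y : R → PowerSeries A), (∀ r r', Y (r * r') = Y r * Y r') →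
      (∀ i j, φ (MvPolynomial.X (i, j)) = PowerSeries.coeff j (Y (y i))) → φ f = 0) :
    f ∈ relationIdeal 𝕜 y := by
  refine mem_relationIdeal_of_forall_prime _ _ fun p hp => ?_
  have : IsDomain (ArcRing 𝕜 R ⧸ p) := Ideal.Quotient.isDomain p
  refine h (ArcRing 𝕜 R ⧸ p) (MvPolynomial.aeval (R := 𝕜) (fun v : σ × ℕ =>
        (Ideal.Quotient.mk p (Ideal.Quotient.mk _ (MvPolynomial.X (y v.1, v.2))) :
          ArcRing 𝕜 R ⧸ p))).toRingHom
    (fun r => PowerSeries.mk fun j =>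
      Ideal.Quotient.mk p (Ideal.Quotient.mk _ (MvPolynomial.X (r, j)))) ?_ ?_
  · intro r r'
    have h := congrArg (PowerSeries.map (Ideal.Quotient.mk p)) (mk_arc_mul (𝕜 := 𝕜) r r')
    rw [map_mul] at h
    exact h
  · intro i j
    rw [PowerSeries.coeff_mk]
    exact MvPolynomial.aeval_X _ _

/-- Over a domain the terms of `W'` are either all zero, or products of nonzero series whose
ratios are those of monomials, and then the alternating sum over the cube vanishes. -/
theorem coeff_seriesW_mem_relationIdeal (𝕜 : Type*) [Field 𝕜] {η : ℕ} (hη : 0 < η) {ζ : ℕ → ℕ}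
    (hζ : ∀ i : ℕ, i + 2 ≤ η → (ζ i : ℤ) - ζ (i + 1) ≤ (ζ (i + 1) : ℤ) - ζ (i + 2))
    (α β : LatticePoint (polygon η ζ)) (hαβ : Precedes α.1 β.1) {m : ℕ}
    (hm : m < pathK η ζ α.1 β.1) (n : ℕ) :
    PowerSeries.coeff n (seriesW 𝕜 η ζ α.1 β.1 m) ∈
      relationIdeal 𝕜 (toricGen 𝕜 (polygon η ζ)) := by
  refine mem_relationIdeal_of_forall_domain _ _ fun A _ _ φ Y hYmul hφ => ?_
  have hcur : ∀ q : LatticePoint (polygon η ζ), PowerSeries.map φ (currentAt 𝕜 (polygon η ζ) q.1) =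
      Y (toricGen 𝕜 (polygon η ζ) q) := by
    intro q
    rw [currentAt, dif_pos q.2]
    ext j
    rw [PowerSeries.coeff_map, current, PowerSeries.coeff_mk, hφ]
  set y : ℤ × ℤ → PowerSeries A := fun q =>
    PowerSeries.map φ (currentAt 𝕜 (polygon η ζ) q) with hy
  have hymul : ∀ a b a' b' : ℤ × ℤ, ((a.1 : ℝ), (a.2 : ℝ)) ∈ polygon η ζ →
      ((b.1 : ℝ), (b.2 : ℝ)) ∈ polygon η ζ → ((a'.1 : ℝ), (a'.2 : ℝ)) ∈ polygon η ζ →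
      ((b'.1 : ℝ), (b'.2 : ℝ)) ∈ polygon η ζ → a + b = a' + b' → y a * y b = y a' * y b' := by
    intro a b a' b' ha hb ha' hb' h
    have e : ∀ (q : ℤ × ℤ) (hq : ((q.1 : ℝ), (q.2 : ℝ)) ∈ polygon η ζ),
        y q = Y (toricGen 𝕜 (polygon η ζ) ⟨q, hq⟩) := fun q hq => hcur ⟨q, hq⟩
    rw [e a ha, e b hb, e a' ha', e b' hb', ← hYmul, ← hYmul, toricGen_mul_toricGen]
    exact h
  set k := pathK η ζ α.1 β.1 with hk
  set F : Finset ℕ → PowerSeries A := fun I => y (α.1 + pathSum η ζ α.1 β.1 I) with hF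
  set G : Finset ℕ → PowerSeries A := fun I => y (β.1 - pathSum η ζ α.1 β.1 I) with hG
  have sub : ∀ {I : Finset ℕ}, I ⊆ Finset.range k → I ⊆ Finset.range (k + 1) := fun h =>
    h.trans (Finset.range_subset_range.2 (Nat.le_succ k))
  have memF : ∀ I ⊆ Finset.range k, _ := fun I hI =>
    path_mem_polygon hη hζ α β hαβ I (sub hI)
  have memG : ∀ I ⊆ Finset.range k, _ := fun I hI =>
    sub_path_mem_polygon hη hζ α β hαβ I (sub hI)
  have hmap : PowerSeries.map φ (seriesW 𝕜 η ζ α.1 β.1 m) =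
      ∑ I ∈ (Finset.range k).powerset,
        (-1) ^ I.card * ((PowerSeries.derivative A)^[m] (F I) * G I) := by
    rw [seriesW, map_sum]
    refine Finset.sum_congr rfl fun I _ => ?_
    rw [map_mul (PowerSeries.map φ), map_mul (PowerSeries.map φ), map_iterDeriv, map_pow, map_neg, map_one]
    simp only [hF, hG, hy, iterDeriv]
  have hzero : PowerSeries.map φ (seriesW 𝕜 η ζ α.1 β.1 m) = 0 := by
    rw [hmap]
    have hconst : ∀ I ⊆ Finset.range k, ∀ J ⊆ Finset.range k, F I * G I = F J * G J :=
      fun I hI J hJ => hymul _ _ _ _ (memF I hI) (memG I hI) (memF J hJ) (memG J hJ) (by abel)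
    by_cases h0 : F ∅ * G ∅ = 0
    · refine Finset.sum_eq_zero fun I hI => ?_
      have h1 := hconst I (Finset.mem_powerset.1 hI) ∅ (Finset.empty_subset _)
      rw [h0] at h1
      rcases mul_eq_zero.1 h1 with h | h
      · rw [h, iterate_map_zero]; simp
      · rw [h]; simp
    · refine alternating_cube_sum_eq_zero (PowerSeries.derivative A) k F G ?_ ?_ ?_ m hm
      · intro I hI hz
        have h1 := hconst I hI ∅ (Finset.empty_subset _)
        rw [hz, zero_mul] at h1
        exact h0 h1.symm
      · intro j hj I hI J hJ hjI hjJ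
        have hj' := Finset.mem_range.2 hj
        refine hymul _ _ _ _ (memF _ (Finset.insert_subset hj' hI)) (memF J hJ) (memF I hI)
          (memF _ (Finset.insert_subset hj' hJ)) ?_
        rw [pathSum_insert _ _ _ _ hjI, pathSum_insert _ _ _ _ hjJ]
        abel
      · intro j hj I hI J hJ hjI hjJ
        have hj' := Finset.mem_range.2 hj
        refine hymul _ _ _ _ (memG _ (Finset.insert_subset hj' hI))
          (memF _ (Finset.insert_subset hj' hJ)) (memG I hI) (memF J hJ) ?_
        rw [pathSum_insert _ _ _ _ hjI, pathSum_insert _ _ _ _ hjJ]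
        abel
  have h := congrArg (PowerSeries.coeff n) hzero
  rw [PowerSeries.coeff_map, map_zero] at h
  exact h

/-! ### Arcs in the torus and their limits -/

/-- The points of the cone over the polygon have nonnegative coordinates. -/
theorem nonneg_of_mem_coneMonoid {η : ℕ} {ζ : ℕ → ℕ} {c : ℤ × ℤ × ℤ}
    (hc : c ∈ coneMonoid (polygon η ζ)) : 0 ≤ c.1 ∧ 0 ≤ c.2.1 ∧ 0 ≤ c.2.2 := by
  have hpoly : ∀ q ∈ polygon η ζ, 0 ≤ q.1 ∧ 0 ≤ q.2 := by
    intro q hq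
    have hconv : Convex ℝ {q : ℝ × ℝ | 0 ≤ q.1 ∧ 0 ≤ q.2} := by
      intro q hq q' hq' s t hs ht _
      simp only [Set.mem_ofPred_eq, Prod.fst_add, Prod.smul_fst, Prod.snd_add, Prod.smul_snd,
        smul_eq_mul] at *
      exact ⟨add_nonneg (mul_nonneg hs hq.1) (mul_nonneg ht hq'.1),
        add_nonneg (mul_nonneg hs hq.2) (mul_nonneg ht hq'.2)⟩
    refine convexHull_min ?_ hconv hq
    rintro q (⟨h1, _, h3⟩ | ⟨i, hi, rfl⟩)
    · exact ⟨h1, by rw [h3]; positivity⟩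
    · refine ⟨by positivity, sub_nonneg.2 ?_⟩
      exact_mod_cast (Finset.le_sup (f := ζ) (Finset.mem_range.2 (Nat.lt_succ_of_le hi)) :
        ζ i ≤ zetaMax η ζ)
  have hcone : ∀ v ∈ PointedCone.hull ℝ ((fun a : ℝ × ℝ => ((a.1, a.2, 1) : ℝ × ℝ × ℝ)) ''
      polygon η ζ), 0 ≤ v.1 ∧ 0 ≤ v.2.1 ∧ 0 ≤ v.2.2 := by
    intro v hv
    refine Submodule.span_induction ?_ ?_ ?_ ?_ hv
    · rintro _ ⟨a, ha, rfl⟩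
      exact ⟨(hpoly a ha).1, (hpoly a ha).2, zero_le_one⟩
    · simp
    · rintro x y _ _ ⟨h1, h2, h3⟩ ⟨h4, h5, h6⟩
      exact ⟨add_nonneg h1 h4, add_nonneg h2 h5, add_nonneg h3 h6⟩
    · rintro ⟨a, ha⟩ x _ ⟨h1, h2, h3⟩
      exact ⟨mul_nonneg ha h1, mul_nonneg ha h2, mul_nonneg ha h3⟩
  have h := hcone _ hc
  simpa [latticeHom] using h

/-- Any three series `z₁, z₂, w` define an arc `z^{(a, b)} w^c ↦ z₁^a z₂^b w^c` of the toric ring,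
since all exponents are nonnegative. -/
noncomputable def torusArc {𝕜 : Type*} [Field 𝕜] (η : ℕ) (ζ : ℕ → ℕ) (z₁ z₂ w : PowerSeries 𝕜) :
    ToricRing 𝕜 (polygon η ζ) →ₐ[𝕜] PowerSeries 𝕜 :=
  AddMonoidAlgebra.lift 𝕜 (PowerSeries 𝕜) (coneMonoid (polygon η ζ))
    { toFun := fun c => z₁ ^ (Multiplicative.toAdd c).1.1.toNat *
        z₂ ^ (Multiplicative.toAdd c).1.2.1.toNat * w ^ (Multiplicative.toAdd c).1.2.2.toNat
      map_one' := by simp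
      map_mul' := fun a b => by
        obtain ⟨h1, h2, h3⟩ := nonneg_of_mem_coneMonoid (Multiplicative.toAdd a).2
        obtain ⟨h4, h5, h6⟩ := nonneg_of_mem_coneMonoid (Multiplicative.toAdd b).2
        simp only [toAdd_mul, AddSubmonoid.coe_add, Prod.fst_add, Prod.snd_add]
        rw [Int.toNat_add h1 h4, Int.toNat_add h2 h5, Int.toNat_add h3 h6, pow_add, pow_add,
          pow_add]
        ring }

theorem torusArc_toricGen {𝕜 : Type*} [Field 𝕜] (η : ℕ) (ζ : ℕ → ℕ) (z₁ z₂ w : PowerSeries 𝕜)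
    (a : LatticePoint (polygon η ζ)) :
    torusArc η ζ z₁ z₂ w (toricGen 𝕜 (polygon η ζ) a) =
      z₁ ^ a.1.1.toNat * z₂ ^ a.1.2.toNat * w := by
  rw [torusArc, toricGen, AddMonoidAlgebra.lift_single]
  simp

/-- A relation vanishes on the arcs `Y_α = z₁^{α₁} z₂^{α₂} w`. -/
theorem aeval_torusArc_eq_zero {𝕜 : Type*} [Field 𝕜] {η : ℕ} {ζ : ℕ → ℕ}
    {f : MvPolynomial (LatticePoint (polygon η ζ) × ℕ) 𝕜}
    (hf : f ∈ relationIdeal 𝕜 (toricGen 𝕜 (polygon η ζ))) (z₁ z₂ w : PowerSeries 𝕜) :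
    MvPolynomial.aeval (fun v : LatticePoint (polygon η ζ) × ℕ =>
      PowerSeries.coeff v.2 (z₁ ^ v.1.1.1.toNat * z₂ ^ v.1.1.2.toNat * w)) f = 0 := by
  have h := aeval_arc_eq_zero _ (torusArc η ζ z₁ z₂ w) hf
  simpa only [torusArc_toricGen] using h

/-! ### Divisibility by differences of variables -/

section Differences

variable {𝕜 : Type*} [Field 𝕜] {L : ℕ}

/-- The homomorphism that replaces the variable `s_c` by `s_d`. -/
noncomputable def identify (𝕜 : Type*) [Field 𝕜] {L : ℕ} (c d : Fin L) :
    MvPolynomial (Fin L) 𝕜 →ₐ[𝕜] MvPolynomial (Fin L) 𝕜 :=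
  MvPolynomial.aeval fun i => if i = c then MvPolynomial.X d else MvPolynomial.X i

theorem identify_X (c d i : Fin L) : identify 𝕜 c d (MvPolynomial.X i) =
    if i = c then MvPolynomial.X d else MvPolynomial.X i := by
  rw [identify, MvPolynomial.aeval_X]

theorem identify_sub (c d : Fin L) :
    identify 𝕜 c d (MvPolynomial.X c - MvPolynomial.X d) = 0 := by
  rw [map_sub, identify_X, identify_X, if_pos rfl]
  split_ifs <;> simp

theorem sub_dvd_sub_identify (c d : Fin L) (a : MvPolynomial (Fin L) 𝕜) :
    (MvPolynomial.X c - MvPolynomial.X d) ∣ a - identify 𝕜 c d a := by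
  induction a using MvPolynomial.induction_on with
  | C a =>
    have : identify 𝕜 c d (MvPolynomial.C a) = MvPolynomial.C a := by
      rw [identify, MvPolynomial.aeval_C]; rfl
    simp [this]
  | add p q hp hq =>
    rw [map_add, add_sub_add_comm]
    exact dvd_add hp hq
  | mul_X p i hp =>
    have h : (MvPolynomial.X c - MvPolynomial.X d : MvPolynomial (Fin L) 𝕜) ∣
        MvPolynomial.X i - identify 𝕜 c d (MvPolynomial.X i) := by
      rw [identify_X]
      split_ifs with h
      · rw [h]
      · simp
    have e : p * MvPolynomial.X i - identify 𝕜 c d (p * MvPolynomial.X i) =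
        (p - identify 𝕜 c d p) * MvPolynomial.X i +
          identify 𝕜 c d p * (MvPolynomial.X i - identify 𝕜 c d (MvPolynomial.X i)) := by
      rw [map_mul]; ring
    rw [e]
    exact dvd_add (hp.mul_right _) (h.mul_left _)

theorem sub_dvd_iff (c d : Fin L) (a : MvPolynomial (Fin L) 𝕜) :
    (MvPolynomial.X c - MvPolynomial.X d) ∣ a ↔ identify 𝕜 c d a = 0 := by
  constructor
  · rintro ⟨b, rfl⟩
    rw [map_mul, identify_sub, zero_mul]
  · intro h
    have := sub_dvd_sub_identify c d a
    rwa [h, sub_zero] at this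

theorem X_sub_X_ne_zero {c d : Fin L} (h : c ≠ d) :
    (MvPolynomial.X c - MvPolynomial.X d : MvPolynomial (Fin L) 𝕜) ≠ 0 :=
  sub_ne_zero.2 fun h' => h (MvPolynomial.X_injective h')

theorem prime_X_sub_X {c d : Fin L} (h : c ≠ d) :
    Prime (MvPolynomial.X c - MvPolynomial.X d : MvPolynomial (Fin L) 𝕜) := by
  refine ⟨X_sub_X_ne_zero h, fun hu => ?_, fun a b hab => ?_⟩
  · have := hu.map (identify 𝕜 c d)
    rw [identify_sub] at this
    exact not_isUnit_zero this
  · rw [sub_dvd_iff, map_mul] at hab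
    rw [sub_dvd_iff, sub_dvd_iff]
    exact mul_eq_zero.1 hab

/-- The pairs `(c, d)` with `c < d`. -/
def orderedPairs (L : ℕ) : Finset (Fin L × Fin L) := Finset.univ.filter fun p => p.1 < p.2

theorem mem_orderedPairs {p : Fin L × Fin L} : p ∈ orderedPairs L ↔ p.1 < p.2 := by
  simp [orderedPairs]

theorem isRelPrime_X_sub_X {p q : Fin L × Fin L} (hp : p.1 < p.2) (hq : q.1 < q.2) (h : p ≠ q) :
    IsRelPrime (MvPolynomial.X p.1 - MvPolynomial.X p.2 : MvPolynomial (Fin L) 𝕜)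
      (MvPolynomial.X q.1 - MvPolynomial.X q.2) := by
  rw [(prime_X_sub_X hp.ne).irreducible.isRelPrime_iff_not_dvd, sub_dvd_iff, map_sub, identify_X,
    identify_X, sub_eq_zero]
  obtain ⟨a, b⟩ := p
  obtain ⟨c, d⟩ := q
  simp only at hp hq ⊢
  split_ifs with h1 h2 h2
  · omega
  · intro h3
    exact h (Prod.ext h1.symm (MvPolynomial.X_injective h3))
  · intro h3
    have := MvPolynomial.X_injective h3
    omega
  · intro h3
    have := MvPolynomial.X_injective h3
    omega

/-- Powers of differences of different pairs of variables may be combined. -/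
theorem prod_X_sub_X_pow_dvd (k : Fin L × Fin L → ℕ) (q : MvPolynomial (Fin L) 𝕜)
    (h : ∀ p : Fin L × Fin L, p.1 < p.2 →
      (MvPolynomial.X p.1 - MvPolynomial.X p.2) ^ k p ∣ q) :
    ∏ p ∈ orderedPairs L, (MvPolynomial.X p.1 - MvPolynomial.X p.2) ^ k p ∣ q := by
  refine Finset.prod_dvd_of_isRelPrime ?_ fun p hp => h p (mem_orderedPairs.1 hp)
  intro p hp q hq hpq
  exact (isRelPrime_X_sub_X (mem_orderedPairs.1 hp) (mem_orderedPairs.1 hq) hpq).pow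

theorem identify_iterate_pderiv (c d : Fin L) (h : c ≠ d) (k : ℕ) :
    ∀ g : MvPolynomial (Fin L) 𝕜, identify 𝕜 c d ((MvPolynomial.pderiv c)^[k]
      ((MvPolynomial.X c - MvPolynomial.X d) ^ k * g)) = (k.factorial : 𝕜) • identify 𝕜 c d g := by
  induction k with
  | zero => intro g; simp
  | succ k ih =>
    intro g
    rw [Function.iterate_succ_apply]
    have e : MvPolynomial.pderiv c
          ((MvPolynomial.X c - MvPolynomial.X d : MvPolynomial (Fin L) 𝕜) ^ (k + 1) * g) =
        (MvPolynomial.X c - MvPolynomial.X d) ^ k *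
          (((k + 1 : ℕ) : MvPolynomial (Fin L) 𝕜) * g +
            (MvPolynomial.X c - MvPolynomial.X d) * MvPolynomial.pderiv c g) := by
      rw [Derivation.leibniz, Derivation.leibniz_pow, map_sub, MvPolynomial.pderiv_X_self,
        MvPolynomial.pderiv_X_of_ne h.symm]
      simp only [Nat.add_sub_cancel, smul_eq_mul, nsmul_eq_mul, sub_zero, mul_one]
      ring
    rw [e, ih, map_add, map_mul, map_mul, identify_sub, zero_mul, add_zero, map_natCast,
      Nat.factorial_succ]
    simp only [MvPolynomial.smul_eq_C_mul, Nat.cast_mul, map_mul, map_natCast]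
    ring

/-- In characteristic zero the vanishing of all derivatives of order less than `k` on the
hyperplane `s_c = s_d` implies divisibility by `(s_c - s_d)^k`. -/
theorem X_sub_X_pow_dvd_of_pderiv [CharZero 𝕜] {c d : Fin L} (h : c ≠ d) (k : ℕ)
    (q : MvPolynomial (Fin L) 𝕜)
    (hq : ∀ m < k, identify 𝕜 c d ((MvPolynomial.pderiv c)^[m] q) = 0) :
    (MvPolynomial.X c - MvPolynomial.X d) ^ k ∣ q := by
  induction k with
  | zero => simp
  | succ k ih =>
    obtain ⟨g, rfl⟩ := ih fun m hm => hq m (by omega)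
    have h1 := hq k (by omega)
    rw [identify_iterate_pderiv c d h, smul_eq_zero] at h1
    have h2 := h1.resolve_left (by exact_mod_cast k.factorial_ne_zero)
    rw [pow_succ]
    exact mul_dvd_mul_left _ ((sub_dvd_iff c d g).2 h2)

/-- The Vandermonde product. -/
noncomputable def vandermondeProd (𝕜 : Type*) [Field 𝕜] (L : ℕ) : MvPolynomial (Fin L) 𝕜 :=
  ∏ p ∈ orderedPairs L, (MvPolynomial.X p.1 - MvPolynomial.X p.2)

theorem vandermondeProd_ne_zero : vandermondeProd 𝕜 L ≠ 0 :=
  Finset.prod_ne_zero_iff.2 fun _ hp => X_sub_X_ne_zero (mem_orderedPairs.1 hp).ne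

theorem vandermondeProd_eq_det : ∃ ε : 𝕜, vandermondeProd 𝕜 L =
    ε • (Matrix.vandermonde (MvPolynomial.X : Fin L → MvPolynomial (Fin L) 𝕜)).det := by
  refine ⟨∏ p ∈ orderedPairs L, (-1), ?_⟩
  rw [Matrix.det_vandermonde, MvPolynomial.smul_eq_C_mul, map_prod]
  have : ∏ i : Fin L, ∏ j ∈ Finset.Ioi i,
      (MvPolynomial.X j - MvPolynomial.X i : MvPolynomial (Fin L) 𝕜) =
      ∏ p ∈ orderedPairs L, (MvPolynomial.X p.2 - MvPolynomial.X p.1) := by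
    rw [orderedPairs, Finset.prod_filter, ← Finset.univ_product_univ, Finset.prod_product]
    refine Finset.prod_congr rfl fun i _ => ?_
    rw [← Finset.prod_filter]
    refine Finset.prod_congr ?_ fun _ _ => rfl
    ext j; simp
  rw [this, ← Finset.prod_mul_distrib]
  refine Finset.prod_congr rfl fun p _ => ?_
  simp

theorem rename_vandermondeProd (w : Equiv.Perm (Fin L)) :
    MvPolynomial.rename w (vandermondeProd 𝕜 L) =
      (Equiv.Perm.sign w : ℤ) • vandermondeProd 𝕜 L := by
  obtain ⟨ε, hε⟩ := vandermondeProd_eq_det (𝕜 := 𝕜) (L := L)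
  rw [hε, map_smul]
  have h1 : MvPolynomial.rename w
      (Matrix.vandermonde (MvPolynomial.X : Fin L → MvPolynomial (Fin L) 𝕜)).det =
      ((Matrix.vandermonde (MvPolynomial.X : Fin L → MvPolynomial (Fin L) 𝕜)).submatrix w id).det := by
    rw [AlgHom.map_det]
    congr 1
    ext i j : 2
    simp [Matrix.vandermonde]
  rw [h1, Matrix.det_permute, smul_comm, zsmul_eq_mul]

/-- The antisymmetrization of a monomial is divisible by the Vandermonde product. -/
theorem vandermondeProd_dvd_alternating (n : Fin L →₀ ℕ) :
    vandermondeProd 𝕜 L ∣ ∑ w : Equiv.Perm (Fin L), (Equiv.Perm.sign w : ℤ) •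
      MvPolynomial.rename w (MvPolynomial.monomial n (1 : 𝕜)) := by
  set M : Matrix (Fin L) (Fin L) (MvPolynomial (Fin L) 𝕜) :=
    Matrix.of fun i c => MvPolynomial.X i ^ n c with hM
  have hdet : ∑ w : Equiv.Perm (Fin L), (Equiv.Perm.sign w : ℤ) •
      MvPolynomial.rename w (MvPolynomial.monomial n (1 : 𝕜)) = M.det := by
    rw [Matrix.det_apply]
    refine Finset.sum_congr rfl fun w _ => ?_
    rw [MvPolynomial.monomial_eq, Finsupp.prod_fintype _ _ (by simp)]
    simp [hM, Units.smul_def]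
  rw [hdet]
  have := prod_X_sub_X_pow_dvd (𝕜 := 𝕜) (fun _ => 1) M.det (fun p hp => by
    rw [pow_one, sub_dvd_iff, AlgHom.map_det]
    refine Matrix.det_zero_of_row_eq hp.ne ?_
    funext c
    simp [hM, identify_X])
  simpa [vandermondeProd] using this

end Differences

/-! ### Polarization -/

section Pairing

variable {𝕜 : Type*} [Field 𝕜] {L : ℕ}

theorem coeff_prod_aeval_X (ψ : Fin L → Polynomial 𝕜) (m : Fin L →₀ ℕ) :
    MvPolynomial.coeff m (∏ i, Polynomial.aeval (MvPolynomial.X i : MvPolynomial (Fin L) 𝕜) (ψ i)) =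
      ∏ i, (ψ i).coeff (m i) := by
  classical
  have h1 : ∀ i, Polynomial.aeval (MvPolynomial.X i : MvPolynomial (Fin L) 𝕜) (ψ i) =
      ∑ j ∈ (ψ i).support, MvPolynomial.monomial (Finsupp.single i j) ((ψ i).coeff j) := by
    intro i
    rw [Polynomial.aeval_def, Polynomial.eval₂_eq_sum, Polynomial.sum]
    refine Finset.sum_congr rfl fun j _ => ?_
    rw [MvPolynomial.X_pow_eq_monomial, MvPolynomial.algebraMap_eq, MvPolynomial.C_mul_monomial,
      mul_one]
  have h2 : ∀ g : Fin L → ℕ, ∏ i, MvPolynomial.monomial (Finsupp.single i (g i)) ((ψ i).coeff (g i))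
      = MvPolynomial.monomial (Finsupp.equivFunOnFinite.symm g) (∏ i, (ψ i).coeff (g i)) := by
    intro g
    rw [MvPolynomial.monomial_eq, Finsupp.prod_fintype _ _ (by simp), map_prod,
      ← Finset.prod_mul_distrib]
    refine Finset.prod_congr rfl fun i _ => ?_
    rw [MvPolynomial.monomial_eq]
    simp
  simp_rw [h1]
  rw [Finset.prod_univ_sum, MvPolynomial.coeff_sum]
  simp_rw [h2, MvPolynomial.coeff_monomial]
  rw [Finset.sum_eq_single (m : Fin L → ℕ)]
  · rw [if_pos (by ext; simp)]
  · intro g _ hg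
    rw [if_neg]
    rintro rfl
    exact hg (by ext; simp)
  · intro hm
    rw [if_pos (by ext; simp)]
    simp only [Fintype.mem_piFinset, not_forall, Polynomial.mem_support_iff, not_not] at hm
    obtain ⟨i, hi⟩ := hm
    exact Finset.prod_eq_zero (Finset.mem_univ i) hi

/-- The multidegree of the monomial `∏ X_{v j}`. -/
noncomputable def content {V : Type*} (v : Fin L → V) : V →₀ ℕ := ∑ j, Finsupp.single (v j) 1

theorem content_comp_perm {V : Type*} (v : Fin L → V) (w : Equiv.Perm (Fin L)) :
    content (v ∘ w) = content v :=
  Equiv.sum_comp w fun j => Finsupp.single (v j) 1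

theorem degree_content {V : Type*} (v : Fin L → V) : (content v).degree = L := by
  rw [content, map_sum]
  simp

theorem exists_content_eq {V : Type*} {L : ℕ} (e : V →₀ ℕ) (h : e.degree = L) :
    ∃ v : Fin L → V, content v = e := by
  classical
  induction L generalizing e with
  | zero =>
    rw [Finsupp.degree_eq_zero_iff] at h
    exact ⟨Fin.elim0, by simp [content, h]⟩
  | succ L ih =>
    obtain ⟨a, ha⟩ : ∃ a, e a ≠ 0 := by
      by_contra! h0
      rw [show e = 0 from Finsupp.ext h0] at h
      simp at h
    have he : Finsupp.single a 1 + (e - Finsupp.single a 1) = e :=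
      add_tsub_cancel_of_le (Finsupp.single_le_iff.2 (Nat.one_le_iff_ne_zero.2 ha))
    obtain ⟨v, hv⟩ := ih (e - Finsupp.single a 1) (by
      have := congrArg Finsupp.degree he
      rw [map_add, Finsupp.degree_single, h] at this
      omega)
    refine ⟨Fin.cons a v, ?_⟩
    rw [content, Fin.sum_univ_succ]
    simp only [Fin.cons_zero, Fin.cons_succ]
    rw [← he, ← hv, content]

theorem content_apply {V : Type*} [DecidableEq V] (v : Fin L → V) (a : V) :
    content v a = (Finset.univ.filter fun j => v j = a).card := by
  rw [content, Finsupp.finsetSum_apply, Finset.card_filter]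
  refine Finset.sum_congr rfl fun j _ => ?_
  rw [Finsupp.single_apply]

theorem exists_perm_of_content_eq {V : Type*} {v v' : Fin L → V} (h : content v = content v') :
    ∃ w : Equiv.Perm (Fin L), v ∘ w = v' := by
  classical
  have h1 : ∀ a, Nonempty ({j // v' j = a} ≃ {j // v j = a}) := by
    intro a
    have h2 := DFunLike.congr_fun h a
    rw [content_apply, content_apply] at h2
    exact ⟨Fintype.equivOfCardEq (by rw [Fintype.card_subtype, Fintype.card_subtype, h2])⟩
  refine ⟨((Equiv.sigmaFiberEquiv v').symm.trans
    (Equiv.sigmaCongrRight fun a => (h1 a).some)).trans (Equiv.sigmaFiberEquiv v), ?_⟩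
  funext j
  exact ((h1 (v' j)).some ⟨j, rfl⟩).2

theorem coeff_one_prod_linear (a : Fin L → Fin L → 𝕜) :
    MvPolynomial.coeff (content (id : Fin L → Fin L))
      (∏ j, ∑ i, MvPolynomial.C (a i j) * MvPolynomial.X i : MvPolynomial (Fin L) 𝕜) =
      ∑ w : Equiv.Perm (Fin L), ∏ i, a i (w i) := by
  classical
  have h2 : ∀ g : Fin L → Fin L, ∏ j, (MvPolynomial.C (a (g j) j) * MvPolynomial.X (g j) :
      MvPolynomial (Fin L) 𝕜) = MvPolynomial.monomial (content g) (∏ j, a (g j) j) := by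
    intro g
    rw [Finset.prod_mul_distrib, ← map_prod, content, ← mul_one (∏ j, a (g j) j),
      ← MvPolynomial.C_mul_monomial, MvPolynomial.monomial_sum_one]
    simp [MvPolynomial.X]
  rw [Finset.prod_univ_sum, MvPolynomial.coeff_sum]
  simp_rw [h2, MvPolynomial.coeff_monomial]
  rw [← Finset.sum_filter]
  symm
  refine Finset.sum_bij (fun w _ => (w⁻¹ : Equiv.Perm (Fin L))) ?_ ?_ ?_ ?_
  · intro w _
    simp only [Fintype.piFinset_univ, Finset.mem_filter, Finset.mem_univ, true_and]
    exact content_comp_perm id _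
  · intro w _ w' _ h
    exact inv_injective (DFunLike.coe_injective h)
  · intro g hg
    simp only [Finset.mem_filter] at hg
    obtain ⟨w, hw⟩ := exists_perm_of_content_eq hg.2.symm
    exact ⟨w⁻¹, Finset.mem_univ _, by rw [inv_inv, ← hw]; rfl⟩
  · intro w _
    rw [← Equiv.prod_comp w⁻¹ fun i => a i (w i)]
    simp

variable {ι : Type*}

/-- The linear functional on families of polynomials that sums, over all orderings of the factors
of the monomial `∏_j X_{α_j}^{(n_j)}`, the coefficient of `∏ s_j^{n_j}` in the member of the family
with label `(α_j)_j`. -/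
noncomputable def monomialPairing (𝕜 : Type*) [Field 𝕜] (v : Fin L → ι × ℕ) :
    ((Fin L → ι) → MvPolynomial (Fin L) 𝕜) →ₗ[𝕜] 𝕜 :=
  ∑ w : Equiv.Perm (Fin L),
    (MvPolynomial.lcoeff 𝕜 (Finsupp.equivFunOnFinite.symm fun i => (v (w i)).2)) ∘ₗ
      LinearMap.proj fun i => (v (w i)).1

theorem monomialPairing_apply (v : Fin L → ι × ℕ) (b : (Fin L → ι) → MvPolynomial (Fin L) 𝕜) :
    monomialPairing 𝕜 v b = ∑ w : Equiv.Perm (Fin L), MvPolynomial.coeff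
      (Finsupp.equivFunOnFinite.symm fun i => (v (w i)).2) (b fun i => (v (w i)).1) := by
  simp [monomialPairing, LinearMap.sum_apply]

open Classical in
/-- The pairing of a polynomial `f` with families of polynomials in `s_1, …, s_L`; it expresses
the multilinear part of `f(∑_i t_i y_i)` through the polarization of the component of `f` of
degree `L`. -/
noncomputable def pairing (L : ℕ) (f : MvPolynomial (ι × ℕ) 𝕜) :
    ((Fin L → ι) → MvPolynomial (Fin L) 𝕜) →ₗ[𝕜] 𝕜 :=
  ∑ e ∈ f.support, if h : ∃ v : Fin L → ι × ℕ, content v = e then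
    MvPolynomial.coeff e f • monomialPairing 𝕜 h.choose else 0

theorem pairing_congr {f : MvPolynomial (ι × ℕ) 𝕜} {b b' : (Fin L → ι) → MvPolynomial (Fin L) 𝕜}
    (h : ∀ v : Fin L → ι × ℕ, content v ∈ f.support →
      b (fun i => (v i).1) = b' fun i => (v i).1) :
    pairing L f b = pairing L f b' := by
  rw [pairing, LinearMap.sum_apply, LinearMap.sum_apply]
  refine Finset.sum_congr rfl fun e he => ?_
  split_ifs with hv
  · rw [LinearMap.smul_apply, LinearMap.smul_apply, monomialPairing_apply, monomialPairing_apply]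
    congr 1
    refine Finset.sum_congr rfl fun w _ => ?_
    have := h (hv.choose ∘ w) (by rw [content_comp_perm, hv.choose_spec]; exact he)
    simp only [Function.comp_apply] at this
    rw [this]
  · rfl

/-- The multilinear part of `f(∑_i t_i y_i)`, for `y_i` the coefficients of `ψ_i`. -/
theorem coeff_aeval_linear (f : MvPolynomial (ι × ℕ) 𝕜) (ψ : Fin L → ι → Polynomial 𝕜) :
    MvPolynomial.coeff (content (id : Fin L → Fin L))
      (MvPolynomial.aeval (fun v : ι × ℕ => (∑ i, MvPolynomial.C ((ψ i v.1).coeff v.2) *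
        MvPolynomial.X i : MvPolynomial (Fin L) 𝕜)) f) =
    pairing L f fun σ => ∏ i, Polynomial.aeval (MvPolynomial.X i : MvPolynomial (Fin L) 𝕜)
      (ψ i (σ i)) := by
  classical
  set lin : ι × ℕ → MvPolynomial (Fin L) 𝕜 := fun v =>
    ∑ i, MvPolynomial.C ((ψ i v.1).coeff v.2) * MvPolynomial.X i with hlin
  have hhom : ∀ v, (lin v).IsHomogeneous 1 := fun v =>
    MvPolynomial.IsHomogeneous.sum _ _ _ fun i _ => by
      simpa using (MvPolynomial.isHomogeneous_C (Fin L) _).mul (MvPolynomial.isHomogeneous_X 𝕜 i)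
  conv_lhs => rw [MvPolynomial.as_sum f, map_sum, MvPolynomial.coeff_sum]
  rw [pairing, LinearMap.sum_apply]
  refine Finset.sum_congr rfl fun e _ => ?_
  rw [MvPolynomial.aeval_monomial, MvPolynomial.algebraMap_eq, MvPolynomial.coeff_C_mul]
  split_ifs with h
  · rw [LinearMap.smul_apply, smul_eq_mul]
    congr 1
    have h1 : (e.prod fun i k => lin i ^ k) = ∏ j, lin (h.choose j) := by
      conv_lhs => rw [← h.choose_spec, content]
      rw [← Finsupp.prod_finsetSum_index (by simp) (by intro _ _ _; rw [pow_add])]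
      simp
    rw [h1, hlin, coeff_one_prod_linear, monomialPairing_apply]
    refine Finset.sum_congr rfl fun w _ => ?_
    rw [coeff_prod_aeval_X]
    simp
  · rw [LinearMap.zero_apply]
    refine mul_eq_zero_of_right _ ?_
    have h1 : (e.prod fun i k => lin i ^ k).IsHomogeneous (e.sum fun i k => k) := by
      refine MvPolynomial.IsHomogeneous.prod _ _ _ fun i _ => ?_
      simpa using (hhom i).pow (e i)
    by_contra hne
    have h2 := h1 hne
    apply h
    apply exists_content_eq
    have h3 : (content (id : Fin L → Fin L)).degree = e.sum fun i k => k := by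
      rw [← h2, Finsupp.degree_eq_weight_one]; rfl
    rw [degree_content] at h3
    rw [h3]; rfl

/-- If `f` vanishes at all arcs `Y_α = φ_α w`, then it pairs to zero with the families
`p ∏_i φ_{σ_i}(s_i)`. -/
theorem pairing_eq_zero_of_arcs [Infinite 𝕜] {f : MvPolynomial (ι × ℕ) 𝕜} (φ : ι → Polynomial 𝕜)
    (hf : ∀ w : Polynomial 𝕜,
      MvPolynomial.aeval (fun v : ι × ℕ => (φ v.1 * w).coeff v.2) f = 0)
    (p : MvPolynomial (Fin L) 𝕜) :
    pairing L f (fun σ => p * ∏ i, Polynomial.aeval (MvPolynomial.X i : MvPolynomial (Fin L) 𝕜)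
      (φ (σ i))) = 0 := by
  induction p using MvPolynomial.induction_on' with
  | monomial n c =>
    have h1 : (fun σ : Fin L → ι => MvPolynomial.monomial n c *
        ∏ i, Polynomial.aeval (MvPolynomial.X i : MvPolynomial (Fin L) 𝕜) (φ (σ i))) =
        c • fun σ => ∏ i, Polynomial.aeval (MvPolynomial.X i : MvPolynomial (Fin L) 𝕜)
          (φ (σ i) * Polynomial.X ^ n i) := by
      funext σ
      simp only [Pi.smul_apply, map_mul, map_pow, Polynomial.aeval_X]
      rw [Finset.prod_mul_distrib, MvPolynomial.monomial_eq, Finsupp.prod_fintype _ _ (by simp),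
        MvPolynomial.smul_eq_C_mul]
      ring
    rw [h1, map_smul, ← coeff_aeval_linear f fun i α => φ α * Polynomial.X ^ n i]
    have h2 : MvPolynomial.aeval (fun v : ι × ℕ => (∑ i, MvPolynomial.C
        ((φ v.1 * Polynomial.X ^ n i).coeff v.2) * MvPolynomial.X i : MvPolynomial (Fin L) 𝕜)) f
        = 0 := by
      refine MvPolynomial.funext fun t => ?_
      rw [map_zero, ← hf (∑ i, Polynomial.C (t i) * Polynomial.X ^ n i)]
      rw [← MvPolynomial.coe_aeval_eq_eval, RingHom.coe_coe, MvPolynomial.comp_aeval_apply]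
      congr 2
      funext v
      simp only [map_sum, map_mul, MvPolynomial.aeval_X, MvPolynomial.aeval_C, Finset.mul_sum,
        Polynomial.finsetSum_coeff]
      refine Finset.sum_congr rfl fun i _ => ?_
      rw [mul_left_comm, Polynomial.coeff_C_mul, mul_comm]
      rfl
    rw [h2]
    simp
  | add p q hp hq =>
    simp_rw [add_mul]
    have := congrArg₂ (· + ·) hp hq
    simp only [add_zero] at this
    rw [← map_add] at this
    exact this

end Pairing

/-! ### Polynomials with coefficients in an algebra of functions -/

section PolyAlg

variable {X R : Type*} [CommRing R]

/-- The families of polynomials in an auxiliary variable all of whose coefficients, as functions of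
the parameter, belong to the given algebra of functions. -/
def polyAlg (𝒜 : Subalgebra R (X → R)) : Subring (X → Polynomial R) where
  carrier := {P | ∀ n, (fun q => (P q).coeff n) ∈ 𝒜}
  mul_mem' := by
    intro P Q hP hQ n
    have : (fun q => ((P * Q) q).coeff n) = ∑ ij ∈ Finset.HasAntidiagonal.antidiagonal n,
        (fun q => (P q).coeff ij.1) * fun q => (Q q).coeff ij.2 := by
      funext q
      rw [Pi.mul_apply, Polynomial.coeff_mul, Finset.sum_apply]
      rfl
    rw [this]
    exact 𝒜.sum_mem fun ij _ => 𝒜.mul_mem (hP _) (hQ _)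
  one_mem' := fun n => 𝒜.algebraMap_mem (Polynomial.coeff (1 : Polynomial R) n)
  add_mem' := by
    intro P Q hP hQ n
    have : (fun q => ((P + Q) q).coeff n) =
        (fun q => (P q).coeff n) + fun q => (Q q).coeff n := by
      funext q; simp
    rw [this]
    exact 𝒜.add_mem (hP n) (hQ n)
  zero_mem' := fun n => by
    have : (fun q : X => ((0 : X → Polynomial R) q).coeff n) = 0 := by funext q; simp
    rw [this]
    exact 𝒜.zero_mem
  neg_mem' := by
    intro P hP n
    have : (fun q => ((-P) q).coeff n) = -fun q => (P q).coeff n := by funext q; simp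
    rw [this]
    exact 𝒜.neg_mem (hP n)

variable {𝒜 : Subalgebra R (X → R)}

theorem const_mem_polyAlg (p : Polynomial R) : (fun _ => p) ∈ polyAlg 𝒜 := fun n =>
  𝒜.algebraMap_mem (p.coeff n)

theorem C_mem_polyAlg {b : X → R} (hb : b ∈ 𝒜) : (fun q => Polynomial.C (b q)) ∈ polyAlg 𝒜 := by
  intro n
  simp only [Polynomial.coeff_C]
  split_ifs
  · exact hb
  · exact 𝒜.zero_mem

theorem exists_forall_natDegree_lt [Finite X] (P : X → Polynomial R) :
    ∃ N, ∀ q, (P q).natDegree < N := by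
  obtain ⟨N, hN⟩ := (Set.finite_range fun q => (P q).natDegree).bddAbove
  exact ⟨N + 1, fun q => Nat.lt_succ_of_le (hN ⟨q, rfl⟩)⟩

theorem linear_mem_of_mem_polyAlg [Finite X] {P : X → Polynomial R} (hP : P ∈ polyAlg 𝒜)
    (g : Polynomial R →ₗ[R] R) : (fun q => g (P q)) ∈ 𝒜 := by
  obtain ⟨N, hN⟩ := exists_forall_natDegree_lt P
  have : (fun q => g (P q)) =
      ∑ n ∈ Finset.range N, g (Polynomial.X ^ n) • fun q => (P q).coeff n := by
    funext q
    conv_lhs => rw [Polynomial.as_sum_range_C_mul_X_pow' (P q) (hN q)]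
    rw [map_sum, Finset.sum_apply]
    refine Finset.sum_congr rfl fun n _ => ?_
    rw [← Polynomial.smul_eq_C_mul, map_smul, Pi.smul_apply, smul_eq_mul, smul_eq_mul, mul_comm]
  rw [this]
  exact 𝒜.sum_mem fun n _ => 𝒜.smul_mem (hP n) _

theorem eval_mem_of_mem_polyAlg [Finite X] {P : X → Polynomial R} (hP : P ∈ polyAlg 𝒜) {b : X → R}
    (hb : b ∈ 𝒜) : (fun q => (P q).eval (b q)) ∈ 𝒜 := by
  obtain ⟨N, hN⟩ := exists_forall_natDegree_lt P
  have : (fun q => (P q).eval (b q)) =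
      ∑ n ∈ Finset.range N, (fun q => (P q).coeff n) * b ^ n := by
    funext q
    rw [Polynomial.eval_eq_sum_range' (hN q), Finset.sum_apply]
    rfl
  rw [this]
  exact 𝒜.sum_mem fun n _ => 𝒜.mul_mem (hP n) (𝒜.pow_mem hb n)

/-- The coefficients of the quotient by a monic polynomial depend linearly on the dividend. -/
theorem mem_polyAlg_of_mul_monic [Finite X] {P : X → Polynomial R} {m : Polynomial R}
    (hm : m.Monic) (hP : (fun q => P q * m) ∈ polyAlg 𝒜) : P ∈ polyAlg 𝒜 := by
  nontriviality R
  have hadd : ∀ f g : Polynomial R, (f + g) /ₘ m = f /ₘ m + g /ₘ m := fun f g =>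
    (Polynomial.div_modByMonic_unique (f /ₘ m + g /ₘ m) (f %ₘ m + g %ₘ m) hm
      ⟨by linear_combination Polynomial.modByMonic_add_div f m +
            Polynomial.modByMonic_add_div g m,
        (Polynomial.degree_add_le _ _).trans_lt (max_lt (Polynomial.degree_modByMonic_lt f hm)
          (Polynomial.degree_modByMonic_lt g hm))⟩).1
  have hsmul : ∀ (c : R) (f : Polynomial R), (c • f) /ₘ m = c • (f /ₘ m) := fun c f =>
    (Polynomial.div_modByMonic_unique (c • (f /ₘ m)) (c • (f %ₘ m)) hm
      ⟨by
        rw [mul_smul_comm, ← smul_add, Polynomial.modByMonic_add_div],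
        (Polynomial.degree_smul_le _ _).trans_lt (Polynomial.degree_modByMonic_lt f hm)⟩).1
  intro n
  have := linear_mem_of_mem_polyAlg hP
    { toFun := fun f => (f /ₘ m).coeff n
      map_add' := fun f g => by rw [hadd, Polynomial.coeff_add]
      map_smul' := fun c f => by rw [hsmul, Polynomial.coeff_smul]; rfl }
  simpa [mul_comm (P _), Polynomial.mul_divByMonic_cancel_left _ hm] using this

/-- The coefficients of a polynomial are combinations of its values at the points of an infinite
field. -/
theorem mem_polyAlg_of_forall_eval {𝕜 : Type*} [Field 𝕜] [Infinite 𝕜] [Algebra 𝕜 R] [Finite X]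
    {P : X → Polynomial R} (h : ∀ a : 𝕜, (fun q => (P q).eval (algebraMap 𝕜 R a)) ∈ 𝒜) :
    P ∈ polyAlg 𝒜 := by
  intro n
  by_contra hn
  obtain ⟨N, hN⟩ := exists_forall_natDegree_lt P
  obtain ⟨l, hl, hl0⟩ := ((Subalgebra.toSubmodule 𝒜).restrictScalars 𝕜).exists_dual_map_eq_bot_of_notMem
    (x := fun q => (P q).coeff n) hn inferInstance
  have hker : ∀ b ∈ 𝒜, l b = 0 := fun b hb => by
    have : l b ∈ ((Subalgebra.toSubmodule 𝒜).restrictScalars 𝕜).map l := ⟨b, hb, rfl⟩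
    rwa [hl0, Submodule.mem_bot] at this
  set Q : Polynomial 𝕜 := ∑ j ∈ Finset.range N,
    Polynomial.C (l fun q => (P q).coeff j) * Polynomial.X ^ j with hQ
  have hQ0 : Q = 0 := by
    refine Polynomial.funext fun a => ?_
    rw [Polynomial.eval_zero, ← hker _ (h a)]
    have : (fun q => (P q).eval (algebraMap 𝕜 R a)) =
        ∑ j ∈ Finset.range N, a ^ j • fun q => (P q).coeff j := by
      funext q
      rw [Polynomial.eval_eq_sum_range' (hN q), Finset.sum_apply]
      refine Finset.sum_congr rfl fun j _ => ?_
      rw [Pi.smul_apply, Algebra.smul_def, map_pow, mul_comm]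
    rw [this, map_sum, hQ, Polynomial.eval_finsetSum]
    refine Finset.sum_congr rfl fun j _ => ?_
    rw [map_smul, smul_eq_mul, Polynomial.eval_mul, Polynomial.eval_C, Polynomial.eval_pow,
      Polynomial.eval_X, mul_comm]
  have hcoeff : Q.coeff n = l fun q => (P q).coeff n := by
    rw [hQ, Polynomial.finsetSum_coeff]
    simp only [Polynomial.coeff_C_mul, Polynomial.coeff_X_pow, mul_ite, mul_one, mul_zero,
      Finset.sum_ite_eq, Finset.mem_range]
    split_ifs with hnN
    · rfl
    · have : (fun q => (P q).coeff n) = 0 := by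
        funext q
        exact Polynomial.coeff_eq_zero_of_natDegree_lt (by have := hN q; omega)
      rw [this, map_zero]
  rw [hQ0, Polynomial.coeff_zero] at hcoeff
  exact hl hcoeff.symm

end PolyAlg

/-! ### The algebra of arc functions -/

section ArcAlg

variable {𝕜 : Type*} [Field 𝕜] {L : ℕ} {ι : Type*}

/-- The functions of a labelling `σ ∈ S` of the variables and of a permutation `w` that are products
of `∏_i z₁(s_i)^{x(σ_i)} z₂(s_i)^{y(σ_i)}` and of a monomial in the variables `s_{w(c)}`. -/
noncomputable def arcMonoid (𝕜 : Type*) [Field 𝕜] (x y : ι → ℕ) (S : Set (Fin L → ι)) :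
    Submonoid (S × Equiv.Perm (Fin L) → MvPolynomial (Fin L) 𝕜) where
  carrier := {b | ∃ (z₁ z₂ : Polynomial 𝕜) (n : Fin L →₀ ℕ), b = fun q =>
    (∏ i, Polynomial.aeval (MvPolynomial.X i : MvPolynomial (Fin L) 𝕜)
      (z₁ ^ x (q.1.1 i) * z₂ ^ y (q.1.1 i))) * MvPolynomial.rename q.2 (MvPolynomial.monomial n 1)}
  one_mem' := ⟨1, 1, 0, by funext q; simp⟩
  mul_mem' := by
    rintro _ _ ⟨z₁, z₂, n, rfl⟩ ⟨z₁', z₂', n', rfl⟩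
    refine ⟨z₁ * z₁', z₂ * z₂', n + n', ?_⟩
    funext q
    have e : MvPolynomial.monomial (n + n') (1 : 𝕜) =
        MvPolynomial.monomial n 1 * MvPolynomial.monomial n' 1 := by
      rw [MvPolynomial.monomial_mul, one_mul]
    rw [Pi.mul_apply, e, map_mul]
    simp only [mul_pow, map_mul, map_pow, Finset.prod_mul_distrib]
    ring

/-- The algebra generated by the functions of `arcMonoid`. -/
noncomputable def arcAlg (𝕜 : Type*) [Field 𝕜] (x y : ι → ℕ) (S : Set (Fin L → ι)) :
    Subalgebra (MvPolynomial (Fin L) 𝕜) (S × Equiv.Perm (Fin L) → MvPolynomial (Fin L) 𝕜) :=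
  Algebra.adjoin _ (arcMonoid 𝕜 x y S : Set _)

variable {x y : ι → ℕ} {S : Set (Fin L → ι)}

theorem X_perm_mem_arcAlg (c : Fin L) :
    (fun q : S × Equiv.Perm (Fin L) => (MvPolynomial.X (q.2 c) : MvPolynomial (Fin L) 𝕜)) ∈
      arcAlg 𝕜 x y S := by
  refine Algebra.subset_adjoin ⟨1, 1, Finsupp.single c 1, ?_⟩
  funext q
  simp [MvPolynomial.rename_monomial, MvPolynomial.X]

theorem prod_fst_mem_arcAlg (a : 𝕜) :
    (fun q : S × Equiv.Perm (Fin L) => ∏ i, (algebraMap 𝕜 (MvPolynomial (Fin L) 𝕜) a -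
      MvPolynomial.X i) ^ x (q.1.1 i)) ∈ arcAlg 𝕜 x y S := by
  refine Algebra.subset_adjoin ⟨Polynomial.C a - Polynomial.X, 1, 0, ?_⟩
  funext q
  simp [MvPolynomial.algebraMap_eq]

theorem prod_snd_mem_arcAlg (a : 𝕜) :
    (fun q : S × Equiv.Perm (Fin L) => ∏ i, (algebraMap 𝕜 (MvPolynomial (Fin L) 𝕜) a -
      MvPolynomial.X i) ^ y (q.1.1 i)) ∈ arcAlg 𝕜 x y S := by
  refine Algebra.subset_adjoin ⟨1, Polynomial.C a - Polynomial.X, 0, ?_⟩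
  funext q
  simp [MvPolynomial.algebraMap_eq]

/-- If `f` vanishes on arcs, the antisymmetrization over `w` of a function in the algebra,
divided by the Vandermonde product, pairs to zero with `f`. -/
theorem exists_antisymmetrization [Infinite 𝕜] {f : MvPolynomial (ι × ℕ) 𝕜}
    (hf : ∀ z₁ z₂ w : Polynomial 𝕜, MvPolynomial.aeval (fun v : ι × ℕ =>
      (z₁ ^ x v.1 * z₂ ^ y v.1 * w).coeff v.2) f = 0)
    {b : S × Equiv.Perm (Fin L) → MvPolynomial (Fin L) 𝕜} (hb : b ∈ arcAlg 𝕜 x y S) :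
    ∃ b' : (Fin L → ι) → MvPolynomial (Fin L) 𝕜,
      (∀ σ : S, ∑ w : Equiv.Perm (Fin L), (Equiv.Perm.sign w : ℤ) • b (σ, w) =
        vandermondeProd 𝕜 L * b' σ.1) ∧
      ∀ p : MvPolynomial (Fin L) 𝕜, pairing L f (fun σ => p * b' σ) = 0 := by
  have hspan : ∀ b ∈ Submodule.span (MvPolynomial (Fin L) 𝕜) (arcMonoid 𝕜 x y S : Set
      (S × Equiv.Perm (Fin L) → MvPolynomial (Fin L) 𝕜)), b ∈ arcAlg 𝕜 x y S := fun b hb => by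
    rwa [arcAlg, ← Subalgebra.mem_toSubmodule, Algebra.adjoin_eq_span, Submonoid.closure_eq]
  have hb' : b ∈ Submodule.span (MvPolynomial (Fin L) 𝕜) (arcMonoid 𝕜 x y S : Set
      (S × Equiv.Perm (Fin L) → MvPolynomial (Fin L) 𝕜)) := by
    have : b ∈ Subalgebra.toSubmodule (arcAlg 𝕜 x y S) := hb
    rwa [arcAlg, Algebra.adjoin_eq_span, Submonoid.closure_eq] at this
  induction hb' using Submodule.span_induction with
  | mem b h =>
    obtain ⟨z₁, z₂, n, rfl⟩ := h
    obtain ⟨τ, hτ⟩ := vandermondeProd_dvd_alternating (𝕜 := 𝕜) n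
    refine ⟨fun σ => τ * ∏ i, Polynomial.aeval (MvPolynomial.X i : MvPolynomial (Fin L) 𝕜)
      (z₁ ^ x (σ i) * z₂ ^ y (σ i)), fun σ => ?_, fun p => ?_⟩
    · simp only [← mul_smul_comm]
      rw [← Finset.mul_sum, hτ]
      ring
    · simp only [← mul_assoc p]
      exact pairing_eq_zero_of_arcs (fun α => z₁ ^ x α * z₂ ^ y α) (hf z₁ z₂) (p * τ)
  | zero => exact ⟨0, by simp, fun p => by
      have : (fun σ : Fin L → ι => p * (0 : (Fin L → ι) → MvPolynomial (Fin L) 𝕜) σ) = 0 := by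
        funext σ; simp
      rw [this, map_zero]⟩
  | add b₁ b₂ _ _ h₁ h₂ =>
    obtain ⟨b₁', h₁, h₁'⟩ := h₁ (hspan _ ‹_›)
    obtain ⟨b₂', h₂, h₂'⟩ := h₂ (hspan _ ‹_›)
    refine ⟨b₁' + b₂', fun σ => ?_, fun p => ?_⟩
    · simp only [Pi.add_apply, smul_add, Finset.sum_add_distrib, h₁ σ, h₂ σ, mul_add]
    · have : (fun σ => p * (b₁' + b₂') σ) = (fun σ => p * b₁' σ) + fun σ => p * b₂' σ := by
        funext σ; simp [mul_add]
      rw [this, map_add, h₁', h₂', add_zero]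
  | smul c b _ h =>
    obtain ⟨b', h, h'⟩ := h (hspan _ ‹_›)
    refine ⟨fun σ => c * b' σ, fun σ => ?_, fun p => ?_⟩
    · simp only [Pi.smul_apply, smul_eq_mul, ← mul_smul_comm]
      rw [← Finset.mul_sum, h σ]
      ring
    · simp only [← mul_assoc p]
      exact h' (p * c)

/-- A function `β` in the algebra may be multiplied by the product of
`(s_{w(c)} - s_{w(d)})^{t(σ_{w(d)}) - m_d}` over all `d`, provided that the exponents are nonnegative
on the support of `β`. This product is the quotient of `∏_i (v - s_i)^{t(σ_i)}` by a product
of powers of `v - s_{w(d)}`, evaluated at `v = s_{w(c)}`. -/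
theorem mul_prod_mem_arcAlg [Infinite 𝕜] [Finite ι] {t : ι → ℕ}
    (ht : ∀ a : 𝕜, (fun q : S × Equiv.Perm (Fin L) => ∏ i,
      (algebraMap 𝕜 (MvPolynomial (Fin L) 𝕜) a - MvPolynomial.X i) ^ t (q.1.1 i)) ∈ arcAlg 𝕜 x y S)
    {β : S × Equiv.Perm (Fin L) → MvPolynomial (Fin L) 𝕜} (hβ : β ∈ arcAlg 𝕜 x y S)
    (m : Fin L → ℕ) (c : Fin L) (hm : ∀ q, β q ≠ 0 → ∀ d, m d ≤ t (q.1.1 (q.2 d))) :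
    (fun q => β q * ∏ d, (MvPolynomial.X (q.2 c) - MvPolynomial.X (q.2 d)) ^
      (t (q.1.1 (q.2 d)) - m d)) ∈ arcAlg 𝕜 x y S := by
  set H := ∑ d, m d
  have hH : ∀ d, m d ≤ H := fun d => Finset.single_le_sum (fun _ _ => Nat.zero_le _)
    (Finset.mem_univ d)
  set P : S × Equiv.Perm (Fin L) → Polynomial (MvPolynomial (Fin L) 𝕜) := fun q =>
    Polynomial.C (β q) * ∏ d, (Polynomial.X - Polynomial.C (MvPolynomial.X (q.2 d))) ^
      (t (q.1.1 (q.2 d)) - m d) with hP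
  set M : Polynomial (MvPolynomial (Fin L) 𝕜) :=
    ∏ i, (Polynomial.X - Polynomial.C (MvPolynomial.X i)) ^ H with hM
  have hmonic : M.Monic := Polynomial.monic_prod_of_monic _ _ fun i _ =>
    (Polynomial.monic_X_sub_C _).pow _
  have h1 : (fun q : S × Equiv.Perm (Fin L) => ∏ i, (Polynomial.X -
      Polynomial.C (MvPolynomial.X i : MvPolynomial (Fin L) 𝕜)) ^ t (q.1.1 i)) ∈
      polyAlg (arcAlg 𝕜 x y S) := by
    refine mem_polyAlg_of_forall_eval (𝕜 := 𝕜) fun a => ?_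
    simpa only [Polynomial.eval_prod, Polynomial.eval_pow, Polynomial.eval_sub, Polynomial.eval_X,
      Polynomial.eval_C] using ht a
  have h2 : (∏ d, (fun q : S × Equiv.Perm (Fin L) => Polynomial.X -
      Polynomial.C (MvPolynomial.X (q.2 d) : MvPolynomial (Fin L) 𝕜)) ^ (H - m d)) ∈
      polyAlg (arcAlg 𝕜 x y S) := by
    refine Subring.prod_mem _ fun d _ => Subring.pow_mem _ ?_ _
    exact Subring.sub_mem _ (const_mem_polyAlg _) (C_mem_polyAlg (X_perm_mem_arcAlg d))
  have h3 : (fun q => P q * M) ∈ polyAlg (arcAlg 𝕜 x y S) := by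
    have e : (fun q => P q * M) = (fun q => Polynomial.C (β q)) *
        (fun q : S × Equiv.Perm (Fin L) => ∏ i, (Polynomial.X -
          Polynomial.C (MvPolynomial.X i : MvPolynomial (Fin L) 𝕜)) ^ t (q.1.1 i)) *
        ∏ d, (fun q : S × Equiv.Perm (Fin L) => Polynomial.X -
          Polynomial.C (MvPolynomial.X (q.2 d) : MvPolynomial (Fin L) 𝕜)) ^ (H - m d) := by
      funext q
      rw [Pi.mul_apply, Pi.mul_apply, Finset.prod_apply]
      simp only [Pi.pow_apply]
      by_cases h0 : β q = 0
      · simp [hP, h0]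
      · rw [hP, hM, mul_assoc, mul_assoc]
        congr 1
        rw [← Equiv.prod_comp q.2 fun i => (Polynomial.X -
            Polynomial.C (MvPolynomial.X i : MvPolynomial (Fin L) 𝕜)) ^ H,
          ← Equiv.prod_comp q.2 fun i => (Polynomial.X -
            Polynomial.C (MvPolynomial.X i : MvPolynomial (Fin L) 𝕜)) ^ t (q.1.1 i),
          ← Finset.prod_mul_distrib, ← Finset.prod_mul_distrib]
        refine Finset.prod_congr rfl fun d _ => ?_
        rw [← pow_add, ← pow_add]
        congr 1
        have := hm q h0 d
        have := hH d
        omega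
    rw [e]
    exact Subring.mul_mem _ (Subring.mul_mem _ (C_mem_polyAlg hβ) h1) h2
  have h4 := eval_mem_of_mem_polyAlg (mem_polyAlg_of_mul_monic hmonic h3) (X_perm_mem_arcAlg c)
  simpa only [hP, Polynomial.eval_mul, Polynomial.eval_prod, Polynomial.eval_pow,
    Polynomial.eval_sub, Polynomial.eval_X, Polynomial.eval_C] using h4

end ArcAlg

/-! ### Selecting a labelling -/

/-- Let the multiset of values of `a` not exceed that of `a₀` lexicographically. If `a ≤ a₀` wherever
`a₀` takes values in a lower set `U`, then `a = a₀` there, and the other values of `a` lie outside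
`U`. -/
theorem eq_of_le_of_not_lex_lt {L : ℕ} {Λ : Type*} [LinearOrder Λ] (a₀ a : Fin L → Λ)
    (h : ¬ ∃ b, content a₀ b < content a b ∧ ∀ b' < b, content a₀ b' = content a b')
    {U : Set Λ} (hU : IsLowerSet U) (hle : ∀ d, a₀ d ∈ U → a d ≤ a₀ d) (d : Fin L) :
    (a₀ d ∈ U → a d = a₀ d) ∧ (a₀ d ∉ U → a d ∉ U) := by
  classical
  by_contra hd
  set V : Finset (Fin L) := Finset.univ.filter fun d =>
    (a₀ d ∈ U ∧ a d < a₀ d) ∨ (a₀ d ∉ U ∧ a d ∈ U) with hV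
  have hVne : V.Nonempty := by
    refine ⟨d, ?_⟩
    rw [hV, Finset.mem_filter]
    refine ⟨Finset.mem_univ _, ?_⟩
    by_cases h0 : a₀ d ∈ U
    · left
      exact ⟨h0, lt_of_le_of_ne (hle d h0) fun h1 => hd ⟨fun _ => h1, fun h2 => absurd h0 h2⟩⟩
    · right
      refine ⟨h0, ?_⟩
      by_contra h1
      exact hd ⟨fun h2 => absurd h2 h0, fun _ => h1⟩
  obtain ⟨d₀, hd₀, hmin⟩ := V.exists_min_image a hVne
  have hbU : a d₀ ∈ U := by
    rcases (Finset.mem_filter.1 hd₀).2 with h1 | h1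
    · exact hU h1.2.le h1.1
    · exact h1.2
  have small : ∀ d', a d' < a d₀ → d' ∉ V := fun d' h1 h2 => absurd (hmin d' h2) (not_le.2 h1)
  have fwd : ∀ d', a₀ d' ≤ a d₀ → a d' = a₀ d' := by
    intro d' h1
    have h2 : a₀ d' ∈ U := hU h1 hbU
    by_contra h3
    have h4 : a d' < a₀ d' := lt_of_le_of_ne (hle d' h2) h3
    exact small d' (h4.trans_le h1)
      (Finset.mem_filter.2 ⟨Finset.mem_univ _, Or.inl ⟨h2, h4⟩⟩)
  have bwd : ∀ d', a d' < a d₀ → a₀ d' = a d' := by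
    intro d' h1
    by_contra h2
    have h3 := small d' h1
    rw [hV, Finset.mem_filter, not_and] at h3
    have h4 := h3 (Finset.mem_univ _)
    push Not at h4
    have h5 : a₀ d' ∈ U := by
      by_contra h5
      exact h4.2 h5 (hU h1.le hbU)
    exact h2 (le_antisymm (h4.1 h5) (hle d' h5))
  refine h ⟨a d₀, ?_, fun b' hb' => ?_⟩
  · rw [content_apply, content_apply]
    refine Finset.card_lt_card ⟨fun d' hd' => ?_, fun hsub => ?_⟩
    · rw [Finset.mem_filter] at hd' ⊢
      exact ⟨hd'.1, (fwd d' hd'.2.le).trans hd'.2⟩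
    · have h1 := hsub (Finset.mem_filter.2 ⟨Finset.mem_univ d₀, rfl⟩)
      rw [Finset.mem_filter] at h1
      rcases (Finset.mem_filter.1 hd₀).2 with h2 | h2
      · exact h2.2.ne h1.2.symm
      · exact h2.1 (h1.2 ▸ hbU)
  · rw [content_apply, content_apply]
    congr 1
    ext d'
    simp only [Finset.mem_filter, Finset.mem_univ, true_and]
    constructor
    · rintro rfl
      exact fwd d' hb'.le
    · rintro rfl
      exact bwd d' hb'

section Selection

variable {𝕜 : Type*} [Field 𝕜] {L : ℕ} {ι : Type*} {x y : ι → ℕ} {S : Set (Fin L → ι)}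

theorem rename_perm_mem_arcAlg (p : MvPolynomial (Fin L) 𝕜) :
    (fun q : S × Equiv.Perm (Fin L) => MvPolynomial.rename q.2 p) ∈ arcAlg 𝕜 x y S := by
  induction p using MvPolynomial.induction_on with
  | C a =>
    simp only [MvPolynomial.rename_C]
    exact (arcAlg 𝕜 x y S).algebraMap_mem (MvPolynomial.C a)
  | add p q hp hq =>
    simp only [map_add]
    exact (arcAlg 𝕜 x y S).add_mem hp hq
  | mul_X p i hp =>
    simp only [map_mul, MvPolynomial.rename_X]
    exact (arcAlg 𝕜 x y S).mul_mem hp (X_perm_mem_arcAlg i)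

/-- Repeated multiplication as in `mul_prod_mem_arcAlg`, for all positions `c` in the order of their
keys: nonvanishing of the factors of the earlier positions `c` bounds `t` there by `m_{c,c}`, and
these bounds have to imply that the next exponents are nonnegative. -/
theorem mul_prod_prod_mem_arcAlg [Infinite 𝕜] [Finite ι] {t : ι → ℕ}
    (ht : ∀ a : 𝕜, (fun q : S × Equiv.Perm (Fin L) => ∏ i,
      (algebraMap 𝕜 (MvPolynomial (Fin L) 𝕜) a - MvPolynomial.X i) ^ t (q.1.1 i)) ∈ arcAlg 𝕜 x y S)
    {β : S × Equiv.Perm (Fin L) → MvPolynomial (Fin L) 𝕜} (hβ : β ∈ arcAlg 𝕜 x y S)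
    {Λ : Type*} [LinearOrder Λ] (κ : Fin L → Λ) (m : Fin L → Fin L → ℕ)
    (hm : ∀ q, β q ≠ 0 → ∀ a, (∀ c, κ c < κ a → t (q.1.1 (q.2 c)) ≤ m c c) →
      ∀ d, m a d ≤ t (q.1.1 (q.2 d))) :
    (fun q => β q * ∏ c, ∏ d, (MvPolynomial.X (q.2 c) - MvPolynomial.X (q.2 d)) ^
      (t (q.1.1 (q.2 d)) - m c d)) ∈ arcAlg 𝕜 x y S := by
  classical
  have key : ∀ C : Finset (Fin L), (∀ c ∈ C, ∀ d, κ d < κ c → d ∈ C) →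
      (fun q => β q * ∏ c ∈ C, ∏ d, (MvPolynomial.X (q.2 c) - MvPolynomial.X (q.2 d)) ^
        (t (q.1.1 (q.2 d)) - m c d)) ∈ arcAlg 𝕜 x y S := by
    intro C
    induction C using Finset.induction_on_max_value κ with
    | empty => intro _; simpa using hβ
    | insert a s has hmax ih =>
      intro hclosed
      have hs := ih fun c hc d hd => by
        rcases Finset.mem_insert.1 (hclosed c (Finset.mem_insert_of_mem hc) d hd) with rfl | h
        · exact absurd (hmax c hc) (not_le.2 hd)
        · exact h
      have := mul_prod_mem_arcAlg ht hs (m a) a fun q hq d => by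
        refine hm q (left_ne_zero_of_mul hq) a (fun c hc => ?_) d
        have hcs : c ∈ s := by
          rcases Finset.mem_insert.1 (hclosed a (Finset.mem_insert_self _ _) c hc) with rfl | h
          · exact absurd hc (lt_irrefl _)
          · exact h
        have h1 := Finset.prod_ne_zero_iff.1 (Finset.prod_ne_zero_iff.1
          (right_ne_zero_of_mul hq) c hcs) c (Finset.mem_univ _)
        rw [sub_self] at h1
        by_contra h2
        exact h1 (zero_pow (by omega))
      refine (congrArg (· ∈ arcAlg 𝕜 x y S) ?_).mp this
      funext q
      rw [Finset.prod_insert has]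
      ring
  exact key Finset.univ fun _ _ _ _ => Finset.mem_univ _

/-- The order of the points by rows, and from left to right within a row. -/
def rowKey (x y : ι → ℕ) (α : ι) : ℕ ×ₗ ℕ := toLex (y α, x α)

/-- The labellings that do not exceed `σ₀`: first the numbers of labels in the columns are
compared, and then, if these are equal, the numbers of occurrences of the labels in the row
order. -/
def lowerLabellings (x y : ι → ℕ) (σ₀ : Fin L → ι) : Set (Fin L → ι) :=
  {σ | (¬ ∃ b, content (x ∘ σ₀) b < content (x ∘ σ) b ∧
        ∀ b' < b, content (x ∘ σ₀) b' = content (x ∘ σ) b') ∧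
      (content (x ∘ σ) = content (x ∘ σ₀) →
        ¬ ∃ b, content (rowKey x y ∘ σ₀) b < content (rowKey x y ∘ σ) b ∧
          ∀ b' < b, content (rowKey x y ∘ σ₀) b' = content (rowKey x y ∘ σ) b')}

theorem comp_perm_mem_lowerLabellings {σ₀ σ : Fin L → ι} (w : Equiv.Perm (Fin L))
    (h : σ ∈ lowerLabellings x y σ₀) : σ ∘ w ∈ lowerLabellings x y σ₀ := by
  unfold lowerLabellings at h ⊢
  simp only [Set.mem_ofPred_eq, ← Function.comp_assoc, content_comp_perm] at h ⊢
  exact h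

/-- The height below which no label of column `b` that follows `γ` in the row order lies. -/
def rowFloor (x y : ι → ℕ) (g : ℕ → ℕ) (γ : ι) (b : ℕ) : ℕ :=
  max (y γ + if b < x γ then 1 else 0) (g b)

open Classical in
/-- The exponent subtracted from `y(τ_d)` in the factor of the pair of positions `(c, d)`. -/
noncomputable def rowShift (x y : ι → ℕ) (g : ℕ → ℕ) (σ₀ : Fin L → ι) (c d : Fin L) : ℕ :=
  if rowKey x y (σ₀ d) < rowKey x y (σ₀ c) then y (σ₀ d) else rowFloor x y g (σ₀ c) (x (σ₀ d))

/-- The exponent with which `s_c - s_d` occurs in the selected function. -/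
noncomputable def pairExponent (x y : ι → ℕ) (g : ℕ → ℕ) (σ₀ : Fin L → ι) (c d : Fin L) : ℕ :=
  (x (σ₀ d) - min (x (σ₀ d)) (x (σ₀ c))) + (y (σ₀ d) - rowShift x y g σ₀ c d)

theorem rowShift_self {g : ℕ → ℕ} (hg : ∀ α, g (x α) ≤ y α) (σ₀ : Fin L → ι) (c : Fin L) :
    rowShift x y g σ₀ c c = y (σ₀ c) := by
  rw [rowShift, if_neg (lt_irrefl _), rowFloor, if_neg (lt_irrefl _), add_zero,
    max_eq_left (hg _)]

theorem pairExponent_self {g : ℕ → ℕ} (hg : ∀ α, g (x α) ≤ y α) (σ₀ : Fin L → ι) (c : Fin L) :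
    pairExponent x y g σ₀ c c = 0 := by
  rw [pairExponent, rowShift_self hg]
  simp

open Classical in
/-- The algebra of arc functions on the labellings that do not exceed `σ₀` contains a
permutation-equivariant function supported on the rearrangements of `σ₀`. Its value at `σ₀` is the
product of all `(s_c - s_d)^{pairExponent c d}`. -/
theorem selection_mem_arcAlg [Infinite 𝕜] [Finite ι] (hxy : Function.Injective (rowKey x y))
    {g : ℕ → ℕ} (hg : ∀ α, g (x α) ≤ y α) (σ₀ : Fin L → ι) (p : MvPolynomial (Fin L) 𝕜) :
    (fun q : lowerLabellings x y σ₀ × Equiv.Perm (Fin L) => if q.1.1 ∘ q.2 = σ₀ then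
      MvPolynomial.rename q.2 ((∏ c, ∏ d, (MvPolynomial.X c - MvPolynomial.X d) ^
        pairExponent x y g σ₀ c d) * p) else 0) ∈ arcAlg 𝕜 x y (lowerLabellings x y σ₀) := by
  -- the labels are separated by their columns first
  have h1 := mul_prod_prod_mem_arcAlg (S := lowerLabellings x y σ₀) (y := y)
    (prod_fst_mem_arcAlg (𝕜 := 𝕜)) (rename_perm_mem_arcAlg p)
    (fun c => x (σ₀ c)) (fun c d => min (x (σ₀ d)) (x (σ₀ c))) (by
      intro q _ a ha d
      have h := eq_of_le_of_not_lex_lt (x ∘ σ₀) (x ∘ q.1.1 ∘ q.2)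
        (comp_perm_mem_lowerLabellings q.2 q.1.2).1 (isLowerSet_Iio (x (σ₀ a)))
        (fun c hc => (ha c hc).trans (min_le_left _ _)) d
      by_cases hd : x (σ₀ d) < x (σ₀ a)
      · exact (min_le_left _ _).trans (h.1 hd).ge
      · exact (min_le_right _ _).trans (not_lt.1 (h.2 hd)))
  set β := fun q : lowerLabellings x y σ₀ × Equiv.Perm (Fin L) => MvPolynomial.rename q.2 p *
    ∏ c, ∏ d, (MvPolynomial.X (q.2 c) - MvPolynomial.X (q.2 d) : MvPolynomial (Fin L) 𝕜) ^
      (x (q.1.1 (q.2 d)) - min (x (σ₀ d)) (x (σ₀ c))) with hβ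
  have hx : ∀ q, β q ≠ 0 → ∀ d, x (q.1.1 (q.2 d)) = x (σ₀ d) := by
    intro q hq d
    refine (eq_of_le_of_not_lex_lt (x ∘ σ₀) (x ∘ q.1.1 ∘ q.2)
        (comp_perm_mem_lowerLabellings q.2 q.1.2).1 isLowerSet_univ (fun c _ => ?_) d).1 trivial
    have h2 := Finset.prod_ne_zero_iff.1 (Finset.prod_ne_zero_iff.1
      (right_ne_zero_of_mul hq) c (Finset.mem_univ _)) c (Finset.mem_univ _)
    rw [sub_self, min_self] at h2
    by_contra h3
    simp only [Function.comp_apply] at h3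
    exact h2 (zero_pow (by omega))
  have hrow : ∀ q, β q ≠ 0 → ¬ ∃ b, content (rowKey x y ∘ σ₀) b <
      content (rowKey x y ∘ q.1.1 ∘ q.2) b ∧
      ∀ b' < b, content (rowKey x y ∘ σ₀) b' = content (rowKey x y ∘ q.1.1 ∘ q.2) b' := by
    intro q hq
    refine (comp_perm_mem_lowerLabellings q.2 q.1.2).2 ?_
    congr 1
    funext d
    exact hx q hq d
  have hrowle : ∀ q, β q ≠ 0 → ∀ d, y (q.1.1 (q.2 d)) ≤ y (σ₀ d) →
      rowKey x y (q.1.1 (q.2 d)) ≤ rowKey x y (σ₀ d) := by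
    intro q hq d hd
    rw [rowKey, rowKey, hx q hq d, Prod.Lex.toLex_le_toLex]
    rcases hd.lt_or_eq with h | h
    · exact Or.inl h
    · exact Or.inr ⟨h, le_rfl⟩
  have h2 := mul_prod_prod_mem_arcAlg (S := lowerLabellings x y σ₀) (x := x)
    (prod_snd_mem_arcAlg (𝕜 := 𝕜)) h1 (fun c => rowKey x y (σ₀ c)) (rowShift x y g σ₀) (by
      intro q hq a ha d
      have h := eq_of_le_of_not_lex_lt (rowKey x y ∘ σ₀) (rowKey x y ∘ q.1.1 ∘ q.2)
        (hrow q hq) (isLowerSet_Iio (rowKey x y (σ₀ a)))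
        (fun c hc => hrowle q hq c ((ha c hc).trans (rowShift_self hg σ₀ c).le)) d
      rw [rowShift]
      split_ifs with hd
      · have h3 := hxy (h.1 hd)
        simp only [Function.comp_apply] at h3
        rw [h3]
      · have h3 : rowKey x y (σ₀ a) ≤ rowKey x y (q.1.1 (q.2 d)) := not_lt.1 fun h6 => h.2 hd h6
        have h4 := hx q hq d
        have h5 := hg (q.1.1 (q.2 d))
        rw [h4] at h5
        simp only [rowKey, Prod.Lex.toLex_le_toLex, h4] at h3
        rw [rowFloor]
        refine max_le ?_ h5
        split_ifs <;> omega)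
  refine (congrArg (· ∈ arcAlg 𝕜 x y (lowerLabellings x y σ₀)) ?_).mp h2
  funext q
  by_cases hq : q.1.1 ∘ q.2 = σ₀
  · rw [if_pos hq]
    have hq' : ∀ d, q.1.1 (q.2 d) = σ₀ d := fun d => congrFun hq d
    simp only [hq', map_mul, map_prod, map_pow, map_sub, MvPolynomial.rename_X, pairExponent,
      pow_add, Finset.prod_mul_distrib, hβ]
    ring
  · rw [if_neg hq]
    by_contra h3
    refine hq (funext fun d => hxy ?_)
    have h4 := left_ne_zero_of_mul h3
    refine (eq_of_le_of_not_lex_lt (rowKey x y ∘ σ₀) (rowKey x y ∘ q.1.1 ∘ q.2)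
        (hrow q h4) isLowerSet_univ (fun c _ => hrowle q h4 c ?_) d).1 trivial
    have h5 := Finset.prod_ne_zero_iff.1 (Finset.prod_ne_zero_iff.1
      (right_ne_zero_of_mul h3) c (Finset.mem_univ _)) c (Finset.mem_univ _)
    rw [sub_self, rowShift_self hg] at h5
    by_contra h6
    exact h5 (zero_pow (by omega))

/-- Summing the translates of `q` over the rearrangements of a labelling and pairing amounts to
pairing with `q` at this labelling. -/
theorem monomialPairing_sum_rename [DecidableEq ι] (v : Fin L → ι × ℕ) (σ₀ : Fin L → ι)
    (q : MvPolynomial (Fin L) 𝕜) :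
    monomialPairing 𝕜 v (fun σ => ∑ w : Equiv.Perm (Fin L),
      if σ ∘ w = σ₀ then MvPolynomial.rename w q else 0) =
    (L.factorial : 𝕜) * monomialPairing 𝕜 v (Pi.single σ₀ q) := by
  have hcoeff : ∀ (n : Fin L → ℕ) (w : Equiv.Perm (Fin L)),
      MvPolynomial.coeff (Finsupp.equivFunOnFinite.symm n) (MvPolynomial.rename w q) =
        MvPolynomial.coeff (Finsupp.equivFunOnFinite.symm (n ∘ w)) q := by
    intro n w
    rw [← MvPolynomial.coeff_rename_mapDomain w w.injective q
      (Finsupp.equivFunOnFinite.symm (n ∘ w))]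
    congr 1
    ext i
    obtain ⟨j, rfl⟩ := w.surjective i
    rw [Finsupp.mapDomain_apply w.injective]
    rfl
  rw [monomialPairing_apply, monomialPairing_apply]
  simp only [MvPolynomial.coeff_sum]
  rw [Finset.sum_comm]
  have hterm : ∀ w' : Equiv.Perm (Fin L), ∑ w : Equiv.Perm (Fin L), MvPolynomial.coeff
      (Finsupp.equivFunOnFinite.symm fun i => (v (w i)).2)
      (if (fun i => (v (w i)).1) ∘ w' = σ₀ then MvPolynomial.rename w' q else 0) =
      ∑ w : Equiv.Perm (Fin L), MvPolynomial.coeff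
        (Finsupp.equivFunOnFinite.symm fun i => (v (w i)).2)
        (Pi.single (M := fun _ => MvPolynomial (Fin L) 𝕜) σ₀ q fun i => (v (w i)).1) := by
    intro w'
    refine Eq.trans ?_ (Equiv.sum_comp (Equiv.mulRight w') fun w => MvPolynomial.coeff
        (Finsupp.equivFunOnFinite.symm fun i => (v (w i)).2)
        (Pi.single (M := fun _ => MvPolynomial (Fin L) 𝕜) σ₀ q fun i => (v (w i)).1))
    refine Finset.sum_congr rfl fun w _ => ?_
    rw [Pi.single_apply]
    have e : (fun i => (v ((Equiv.mulRight w' w) i)).1) = (fun i => (v (w i)).1) ∘ w' := rfl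
    rw [e]
    split_ifs
    · rw [hcoeff]; rfl
    · simp
  rw [Finset.sum_congr rfl fun w' _ => hterm w', Finset.sum_const, Finset.card_univ,
    Fintype.card_perm, Fintype.card_fin, nsmul_eq_mul]

/-- A product over ordered pairs of positions, written over pairs `c < d`. -/
theorem prod_prod_eq_prod_orderedPairs (e : Fin L → Fin L → ℕ) (he : ∀ c, e c c = 0) :
    ∏ c, ∏ d, (MvPolynomial.X c - MvPolynomial.X d : MvPolynomial (Fin L) 𝕜) ^ e c d =
      ∏ p ∈ orderedPairs L, ((-1) ^ e p.2 p.1 *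
        (MvPolynomial.X p.1 - MvPolynomial.X p.2) ^ (e p.1 p.2 + e p.2 p.1)) := by
  have h3 : ∀ p : Fin L × Fin L, (-1) ^ e p.2 p.1 *
      (MvPolynomial.X p.1 - MvPolynomial.X p.2 : MvPolynomial (Fin L) 𝕜) ^
        (e p.1 p.2 + e p.2 p.1) = (MvPolynomial.X p.1 - MvPolynomial.X p.2) ^ e p.1 p.2 *
        (MvPolynomial.X p.2 - MvPolynomial.X p.1) ^ e p.2 p.1 := by
    intro p
    rw [pow_add, mul_left_comm, ← mul_pow]
    congr 2
    ring
  simp_rw [h3]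
  rw [← Finset.prod_product', Finset.univ_product_univ, Finset.prod_mul_distrib,
    ← Finset.prod_filter_mul_prod_filter_not Finset.univ (fun p : Fin L × Fin L => p.1 < p.2)]
  congr 1
  rw [← Finset.prod_filter_mul_prod_filter_not
    (Finset.univ.filter fun p : Fin L × Fin L => ¬ p.1 < p.2)
    (fun p : Fin L × Fin L => p.1 = p.2)]
  have h2 : ∏ p ∈ (Finset.univ.filter fun p : Fin L × Fin L => ¬ p.1 < p.2).filter
      (fun p => p.1 = p.2), (MvPolynomial.X p.1 - MvPolynomial.X p.2 :
        MvPolynomial (Fin L) 𝕜) ^ e p.1 p.2 = 1 := by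
    refine Finset.prod_eq_one fun p hp => ?_
    rw [(Finset.mem_filter.1 hp).2, he, pow_zero]
  rw [h2, one_mul]
  refine Finset.prod_nbij' Prod.swap Prod.swap ?_ ?_ ?_ ?_ ?_
  · intro p hp
    simp only [Finset.mem_filter, Finset.mem_univ, true_and, mem_orderedPairs, Prod.fst_swap,
      Prod.snd_swap] at hp ⊢
    omega
  · intro p hp
    simp only [Finset.mem_filter, Finset.mem_univ, true_and, mem_orderedPairs, Prod.fst_swap,
      Prod.snd_swap] at hp ⊢
    omega
  · intro p _; rfl
  · intro p _; rfl
  · intro p _; rfl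

/-- If `f` vanishes on arcs and only involves labellings that do not exceed `σ₀`, then it pairs to
zero at `σ₀` with the multiples of `∏_{c<d} (s_c - s_d)^{k(σ₀ c, σ₀ d)}`. -/
theorem pairing_single_eq_zero [CharZero 𝕜] [Finite ι] [DecidableEq ι]
    (hxy : Function.Injective (rowKey x y))
    {g : ℕ → ℕ} (hg : ∀ α, g (x α) ≤ y α) (σ₀ : Fin L → ι) (k : ι → ι → ℕ)
    (hk : ∀ c d, σ₀ c ≠ σ₀ d →
      pairExponent x y g σ₀ c d + pairExponent x y g σ₀ d c = k (σ₀ c) (σ₀ d) + 1)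
    (hk₀ : ∀ c d, σ₀ c = σ₀ d →
      pairExponent x y g σ₀ c d + pairExponent x y g σ₀ d c = k (σ₀ c) (σ₀ d))
    {f : MvPolynomial (ι × ℕ) 𝕜}
    (hf : ∀ z₁ z₂ w : Polynomial 𝕜, MvPolynomial.aeval (fun v : ι × ℕ =>
      (z₁ ^ x v.1 * z₂ ^ y v.1 * w).coeff v.2) f = 0)
    (hS : ∀ v : Fin L → ι × ℕ, content v ∈ f.support →
      (fun i => (v i).1) ∈ lowerLabellings x y σ₀)
    {q : MvPolynomial (Fin L) 𝕜}
    (hq : ∏ p ∈ orderedPairs L, (MvPolynomial.X p.1 - MvPolynomial.X p.2) ^ k (σ₀ p.1) (σ₀ p.2) ∣ q) :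
    pairing L f (Pi.single σ₀ q) = 0 := by
  obtain ⟨q, rfl⟩ := hq
  set K : MvPolynomial (Fin L) 𝕜 :=
    ∏ p ∈ orderedPairs L, (MvPolynomial.X p.1 - MvPolynomial.X p.2) ^ k (σ₀ p.1) (σ₀ p.2) with hK
  -- the sign and the factors for equal labels that turn the selected product into `Δ K`
  set ε : MvPolynomial (Fin L) 𝕜 := ∏ p ∈ orderedPairs L,
    ((-1) ^ pairExponent x y g σ₀ p.2 p.1 *
      if σ₀ p.1 = σ₀ p.2 then MvPolynomial.X p.1 - MvPolynomial.X p.2 else 1) with hε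
  have hE : (∏ c, ∏ d, (MvPolynomial.X c - MvPolynomial.X d : MvPolynomial (Fin L) 𝕜) ^
        pairExponent x y g σ₀ c d) * (ε * q) = vandermondeProd 𝕜 L * (K * q) := by
    have h1 : (∏ c, ∏ d, (MvPolynomial.X c - MvPolynomial.X d : MvPolynomial (Fin L) 𝕜) ^
        pairExponent x y g σ₀ c d) * ε = vandermondeProd 𝕜 L * K := by
      rw [prod_prod_eq_prod_orderedPairs _ (pairExponent_self hg σ₀), hε, hK, vandermondeProd,
        ← Finset.prod_mul_distrib, ← Finset.prod_mul_distrib]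
      refine Finset.prod_congr rfl fun p _ => ?_
      have h2 : ((-1) ^ pairExponent x y g σ₀ p.2 p.1 : MvPolynomial (Fin L) 𝕜) *
          (-1) ^ pairExponent x y g σ₀ p.2 p.1 = 1 := by
        rw [← mul_pow]; simp
      rw [mul_mul_mul_comm, h2, one_mul]
      split_ifs with h4
      · rw [hk₀ _ _ h4, mul_comm]
      · rw [hk _ _ h4, pow_succ', mul_one]
    rw [← mul_assoc, h1, mul_assoc]
  obtain ⟨b', hb', hpair⟩ := exists_antisymmetrization hf
    (selection_mem_arcAlg (𝕜 := 𝕜) hxy hg σ₀ (ε * q))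
  have hval : ∀ σ ∈ lowerLabellings x y σ₀, b' σ = ∑ w : Equiv.Perm (Fin L),
      if σ ∘ w = σ₀ then MvPolynomial.rename w (K * q) else 0 := by
    intro σ hσ
    refine mul_left_cancel₀ (vandermondeProd_ne_zero (𝕜 := 𝕜) (L := L)) ?_
    rw [← hb' ⟨σ, hσ⟩, Finset.mul_sum]
    refine Finset.sum_congr rfl fun w _ => ?_
    simp only [hE]
    split_ifs
    · rw [map_mul, rename_vandermondeProd, smul_mul_assoc, smul_smul, ← Units.val_mul,
        Int.units_mul_self, Units.val_one, one_smul]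
    · simp
  have h1 := hpair 1
  rw [pairing_congr (b' := fun σ => ∑ w : Equiv.Perm (Fin L),
      if σ ∘ w = σ₀ then MvPolynomial.rename w (K * q) else 0)
    fun v hv => by rw [one_mul]; exact hval _ (hS v hv)] at h1
  have h2 : pairing L f (fun σ => ∑ w : Equiv.Perm (Fin L),
      if σ ∘ w = σ₀ then MvPolynomial.rename w (K * q) else 0) =
      (L.factorial : 𝕜) * pairing L f (Pi.single σ₀ (K * q)) := by
    rw [pairing, LinearMap.sum_apply, LinearMap.sum_apply, Finset.mul_sum]
    refine Finset.sum_congr rfl fun e _ => ?_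
    split_ifs with h
    · rw [LinearMap.smul_apply, LinearMap.smul_apply, monomialPairing_sum_rename, smul_eq_mul,
        smul_eq_mul]
      ring
    · simp
  rw [h2, mul_eq_zero] at h1
  exact h1.resolve_left (by exact_mod_cast L.factorial_ne_zero)

end Selection

/-! ### Duality -/

section Duality

variable {𝕜 : Type*} [Field 𝕜] {L : ℕ} {ι : Type*}

theorem coeff_X_pow_mul_iterDeriv {A : Type*} [CommRing A] (f : PowerSeries A) (m a : ℕ) :
    PowerSeries.coeff a (PowerSeries.X ^ m * iterDeriv m f) =
      (a.descFactorial m : A) * PowerSeries.coeff a f := by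
  rw [PowerSeries.coeff_X_pow_mul']
  split_ifs with h
  · obtain ⟨b, rfl⟩ := Nat.exists_eq_add_of_le' h
    rw [Nat.add_sub_cancel, iterDeriv, PowerSeries.coeff_iterate_derivative,
      Nat.add_descFactorial_eq_ascFactorial]
  · rw [Nat.descFactorial_eq_zero_iff_lt.2 (not_le.1 h)]
    simp

/-- The coefficients of `s^m ∂^m X_α · X_β` belong to every ideal that contains those of
`∂^m X_α · X_β`. -/
theorem sum_descFactorial_mem {J : Ideal (MvPolynomial (ι × ℕ) 𝕜)} {α β : ι} {m : ℕ}
    (h : ∀ n, PowerSeries.coeff n (iterDeriv m (current 𝕜 α) * current 𝕜 β) ∈ J) (N : ℕ) :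
    ∑ ab ∈ Finset.HasAntidiagonal.antidiagonal N, (ab.1.descFactorial m : MvPolynomial (ι × ℕ) 𝕜) *
      (MvPolynomial.X (α, ab.1) * MvPolynomial.X (β, ab.2)) ∈ J := by
  have h1 : PowerSeries.coeff N (PowerSeries.X ^ m * iterDeriv m (current 𝕜 α) * current 𝕜 β) ∈
      J := by
    rw [mul_assoc, PowerSeries.coeff_X_pow_mul']
    split_ifs
    · exact h _
    · exact J.zero_mem
  rw [PowerSeries.coeff_mul] at h1
  refine (congrArg (· ∈ J) (Finset.sum_congr rfl fun ab _ => ?_)).mp h1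
  rw [coeff_X_pow_mul_iterDeriv, current, current, PowerSeries.coeff_mk, PowerSeries.coeff_mk,
    mul_assoc]

theorem iterate_pderiv_X_pow_mul (c : Fin L) (m a : ℕ) (r : MvPolynomial (Fin L) 𝕜)
    (hr : MvPolynomial.pderiv c r = 0) :
    (MvPolynomial.pderiv c)^[m] (MvPolynomial.X c ^ a * r) =
      (a.descFactorial m : MvPolynomial (Fin L) 𝕜) * (MvPolynomial.X c ^ (a - m) * r) := by
  induction m with
  | zero => simp
  | succ m ih =>
    rw [Function.iterate_succ_apply', ih, Derivation.leibniz, Derivation.leibniz,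
      Derivation.leibniz_pow, hr, MvPolynomial.pderiv_X_self, Derivation.map_natCast,
      Nat.descFactorial_succ, Nat.sub_sub]
    simp only [smul_eq_mul, nsmul_eq_mul, mul_zero, mul_one, zero_add, add_zero, Nat.cast_mul]
    ring

/-- The exponent vectors of total degree less than `N`. -/
def boundedExponents (L N : ℕ) : Finset (Fin L → ℕ) :=
  (Fintype.piFinset fun _ => Finset.range N).filter fun n => ∑ i, n i < N

theorem mem_boundedExponents {N : ℕ} {n : Fin L → ℕ} :
    n ∈ boundedExponents L N ↔ ∑ i, n i < N := by
  rw [boundedExponents, Finset.mem_filter, Fintype.mem_piFinset, and_iff_right_iff_imp]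
  intro h i
  exact Finset.mem_range.2 ((Finset.single_le_sum (fun _ _ => Nat.zero_le _)
    (Finset.mem_univ i)).trans_lt h)

/-- The generating polynomial of the values of a linear functional at the monomials with labels
`σ₀`, up to total degree `N`. -/
noncomputable def generatingPoly (l : MvPolynomial (ι × ℕ) 𝕜 →ₗ[𝕜] 𝕜) (σ₀ : Fin L → ι) (N : ℕ) :
    MvPolynomial (Fin L) 𝕜 :=
  ∑ n ∈ boundedExponents L N, MvPolynomial.C (l (∏ i, MvPolynomial.X (σ₀ i, n i))) *
    ∏ i, MvPolynomial.X i ^ n i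

theorem coeff_generatingPoly (l : MvPolynomial (ι × ℕ) 𝕜 →ₗ[𝕜] 𝕜) (σ₀ : Fin L → ι) {N : ℕ}
    {n : Fin L → ℕ} (hn : ∑ i, n i < N) :
    MvPolynomial.coeff (Finsupp.equivFunOnFinite.symm n) (generatingPoly l σ₀ N) =
      l (∏ i, MvPolynomial.X (σ₀ i, n i)) := by
  classical
  have h : ∀ n' : Fin L → ℕ, MvPolynomial.coeff (Finsupp.equivFunOnFinite.symm n)
      (∏ i, MvPolynomial.X i ^ n' i : MvPolynomial (Fin L) 𝕜) = if n' = n then 1 else 0 := by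
    intro n'
    have : (∏ i, MvPolynomial.X i ^ n' i : MvPolynomial (Fin L) 𝕜) =
        MvPolynomial.monomial (Finsupp.equivFunOnFinite.symm n') 1 := by
      rw [MvPolynomial.monomial_eq, Finsupp.prod_fintype _ _ (by simp)]
      simp
    rw [this, MvPolynomial.coeff_monomial]
    simp
  rw [generatingPoly, MvPolynomial.coeff_sum]
  simp only [MvPolynomial.coeff_C_mul, h, mul_ite, mul_one, mul_zero]
  rw [Finset.sum_ite_eq', if_pos (mem_boundedExponents.2 hn)]

theorem prod_eq_mul_mul_prod {A : Type*} [CommMonoid A] {c d : Fin L} (h : c ≠ d) (f : Fin L → A) :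
    ∏ i, f i = f c * (f d * ∏ i ∈ (Finset.univ.erase c).erase d, f i) := by
  rw [Finset.mul_prod_erase _ f (Finset.mem_erase.2 ⟨h.symm, Finset.mem_univ d⟩),
    Finset.mul_prod_erase _ f (Finset.mem_univ c)]

/-- If a functional kills the coefficients of `∂^m X_α · X_β` for `m < k`, then its generating
polynomial is divisible by `(s_c - s_d)^k` for positions `c`, `d` with the labels `α`, `β`. -/
theorem X_sub_X_pow_dvd_generatingPoly [CharZero 𝕜] {J : Ideal (MvPolynomial (ι × ℕ) 𝕜)}
    {l : MvPolynomial (ι × ℕ) 𝕜 →ₗ[𝕜] 𝕜} (hl : ∀ a ∈ J, l a = 0) (σ₀ : Fin L → ι) (N k : ℕ)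
    {c d : Fin L} (hcd : c ≠ d)
    (hJ : ∀ m < k, ∀ n, PowerSeries.coeff n
      (iterDeriv m (current 𝕜 (σ₀ c)) * current 𝕜 (σ₀ d)) ∈ J) :
    (MvPolynomial.X c - MvPolynomial.X d) ^ k ∣ generatingPoly l σ₀ N := by
  classical
  refine X_sub_X_pow_dvd_of_pderiv hcd k _ fun m hm => ?_
  set U := (Finset.univ.erase c).erase d with hU
  have hUc : ∀ i ∈ U, i ≠ c := fun i hi => (Finset.mem_erase.1 (Finset.mem_erase.1 hi).2).1
  have hUd : ∀ i ∈ U, i ≠ d := fun i hi => (Finset.mem_erase.1 hi).1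
  -- the exponent vector of the monomial after the identification of the two variables
  set κ : (Fin L → ℕ) → Fin L → ℕ := fun n =>
    Function.update (Function.update n c 0) d (n c + n d) with hκ
  have κd : ∀ n, κ n d = n c + n d := fun n => by simp [hκ]
  have κU : ∀ n, ∀ i ∈ U, κ n i = n i := fun n i hi => by
    simp [hκ, Function.update_of_ne (hUd i hi), Function.update_of_ne (hUc i hi)]
  set M : (Fin L → ℕ) → MvPolynomial (Fin L) 𝕜 := fun n =>
    MvPolynomial.X d ^ (n d - m) * ∏ i ∈ U, MvPolynomial.X i ^ n i with hM
  have hterm : ∀ n : Fin L → ℕ, identify 𝕜 c d ((MvPolynomial.pderiv c)^[m]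
      (MvPolynomial.C (l (∏ i, MvPolynomial.X (σ₀ i, n i))) * ∏ i, MvPolynomial.X i ^ n i)) =
      MvPolynomial.C (((n c).descFactorial m : 𝕜) * l (∏ i, MvPolynomial.X (σ₀ i, n i))) *
        M (κ n) := by
    intro n
    have h1 : MvPolynomial.pderiv c (MvPolynomial.C (l (∏ i, MvPolynomial.X (σ₀ i, n i))) *
        (MvPolynomial.X d ^ n d * ∏ i ∈ U, MvPolynomial.X i ^ n i) : MvPolynomial (Fin L) 𝕜) = 0 := by
      have hX : ∀ i : Fin L, i ≠ c → ∀ j,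
          MvPolynomial.pderiv c (MvPolynomial.X i ^ j : MvPolynomial (Fin L) 𝕜) = 0 :=
        fun i hi j => by
          rw [Derivation.leibniz_pow, MvPolynomial.pderiv_X_of_ne hi]
          simp
      have hU0 : MvPolynomial.pderiv c (∏ i ∈ U, MvPolynomial.X i ^ n i :
          MvPolynomial (Fin L) 𝕜) = 0 :=
        Finset.prod_induction _ (fun r => MvPolynomial.pderiv c r = 0)
          (fun a b ha hb => by rw [Derivation.leibniz, ha, hb]; simp)
          (Derivation.map_one_eq_zero _) fun i hi => hX i (hUc i hi) _
      rw [MvPolynomial.pderiv_C_mul, Derivation.leibniz, hX d hcd.symm, hU0]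
      simp
    rw [prod_eq_mul_mul_prod hcd (fun i => (MvPolynomial.X i ^ n i : MvPolynomial (Fin L) 𝕜)),
      ← hU, mul_left_comm, iterate_pderiv_X_pow_mul c m _ _ h1]
    by_cases ham : n c < m
    · rw [Nat.descFactorial_eq_zero_iff_lt.2 ham]
      simp
    · have h2 : identify 𝕜 c d (∏ i ∈ U, MvPolynomial.X i ^ n i) =
          ∏ i ∈ U, MvPolynomial.X i ^ κ n i := by
        rw [map_prod]
        refine Finset.prod_congr rfl fun i hi => ?_
        rw [map_pow, identify_X, if_neg (hUc i hi), κU n i hi]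
      have h3 : κ n d - m = (n c - m) + n d := by rw [κd]; omega
      have h4 : ∀ a : 𝕜, identify 𝕜 c d (MvPolynomial.C a) = MvPolynomial.C a := fun a => by
        rw [identify, MvPolynomial.aeval_C]; rfl
      simp only [map_mul, map_pow, map_natCast, h2, h4, identify_X, if_pos, if_neg hcd.symm, hM, h3,
        pow_add]
      ring
  have hiter : ∀ (j : ℕ) (s : Finset (Fin L → ℕ)) (F : (Fin L → ℕ) → MvPolynomial (Fin L) 𝕜),
      (MvPolynomial.pderiv c)^[j] (∑ n ∈ s, F n) = ∑ n ∈ s, (MvPolynomial.pderiv c)^[j] (F n) := by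
    intro j s F
    induction j with
    | zero => rfl
    | succ j ih => simp only [Function.iterate_succ_apply', ih, map_sum]
  rw [generatingPoly, hiter, map_sum, Finset.sum_congr rfl fun n _ => hterm n,
    ← Finset.sum_fiberwise_of_maps_to (g := κ) (t := (boundedExponents L N).image κ)
      fun n hn => Finset.mem_image_of_mem _ hn]
  refine Finset.sum_eq_zero fun e he => ?_
  have h1 : ∑ n ∈ (boundedExponents L N).filter (fun n => κ n = e),
      MvPolynomial.C (((n c).descFactorial m : 𝕜) * l (∏ i, MvPolynomial.X (σ₀ i, n i))) *
        M (κ n) =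
      MvPolynomial.C (∑ n ∈ (boundedExponents L N).filter (fun n => κ n = e),
        ((n c).descFactorial m : 𝕜) * l (∏ i, MvPolynomial.X (σ₀ i, n i))) * M e := by
    rw [map_sum, Finset.sum_mul]
    refine Finset.sum_congr rfl fun n hn => ?_
    rw [(Finset.mem_filter.1 hn).2]
  have hsum : ∀ n : Fin L → ℕ, ∑ i, n i = n c + (n d + ∑ i ∈ U, n i) := fun n =>
    prod_eq_mul_mul_prod (A := Multiplicative ℕ) hcd n
  obtain ⟨n₀, hn₀, rfl⟩ := Finset.mem_image.1 he
  -- the fibre consists of the vectors with prescribed sum of the entries at `c` and `d`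
  have h2 : ∑ n ∈ (boundedExponents L N).filter (fun n => κ n = κ n₀),
        ((n c).descFactorial m : 𝕜) * l (∏ i, MvPolynomial.X (σ₀ i, n i)) =
      l ((∏ i ∈ U, MvPolynomial.X (σ₀ i, n₀ i)) *
        ∑ ab ∈ Finset.HasAntidiagonal.antidiagonal (n₀ c + n₀ d),
          (ab.1.descFactorial m : MvPolynomial (ι × ℕ) 𝕜) *
          (MvPolynomial.X (σ₀ c, ab.1) * MvPolynomial.X (σ₀ d, ab.2))) := by
    rw [Finset.mul_sum, map_sum]
    refine Finset.sum_bij' (fun n _ => (n c, n d))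
      (fun ab _ => Function.update (Function.update n₀ c ab.1) d ab.2) ?_ ?_ ?_ ?_ ?_
    · intro n hn
      have h3 := congrFun (Finset.mem_filter.1 hn).2 d
      rw [κd, κd] at h3
      rw [Finset.HasAntidiagonal.mem_antidiagonal]
      exact h3
    · intro ab hab
      rw [Finset.HasAntidiagonal.mem_antidiagonal] at hab
      rw [Finset.mem_filter, mem_boundedExponents]
      have hlt : n₀ c + (n₀ d + ∑ i ∈ U, n₀ i) < N := by
        rw [← hsum]; exact mem_boundedExponents.1 hn₀
      constructor
      · have hU' : ∑ i ∈ U, Function.update (Function.update n₀ c ab.1) d ab.2 i =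
            ∑ i ∈ U, n₀ i := Finset.sum_congr rfl fun i hi => by
          rw [Function.update_of_ne (hUd i hi), Function.update_of_ne (hUc i hi)]
        rw [hsum, hU', Function.update_self, Function.update_of_ne hcd, Function.update_self]
        omega
      · funext i
        by_cases hid : i = d
        · subst hid
          rw [κd, κd]
          simp [Function.update_of_ne hcd, hab]
        · by_cases hic : i = c
          · subst hic
            simp [hκ, Function.update_of_ne hid]
          · simp [hκ, Function.update_of_ne hid, Function.update_of_ne hic]
    · intro n hn
      funext i
      by_cases hid : i = d
      · subst hid; simp
      · by_cases hic : i = c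
        · subst hic; simp [Function.update_of_ne hid]
        · have h3 := congrFun (Finset.mem_filter.1 hn).2 i
          simp only [hκ, Function.update_of_ne hid, Function.update_of_ne hic] at h3
          simp [Function.update_of_ne hid, Function.update_of_ne hic, h3]
    · intro ab _
      simp [Function.update_of_ne hcd]
    · intro n hn
      have h4 : ∀ i ∈ U, n₀ i = n i := fun i hi => by
        rw [← κU n₀ i hi, ← κU n i hi, (Finset.mem_filter.1 hn).2]
      have h5 : ((∏ i ∈ U, MvPolynomial.X (σ₀ i, n₀ i)) *
          (((n c).descFactorial m : MvPolynomial (ι × ℕ) 𝕜) *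
          (MvPolynomial.X (σ₀ c, n c) * MvPolynomial.X (σ₀ d, n d)))) =
          ((n c).descFactorial m : 𝕜) • ∏ i, MvPolynomial.X (σ₀ i, n i) := by
        rw [prod_eq_mul_mul_prod hcd (fun i => (MvPolynomial.X (σ₀ i, n i) :
          MvPolynomial (ι × ℕ) 𝕜)), ← hU, Finset.prod_congr rfl fun i hi => by rw [h4 i hi],
          MvPolynomial.smul_eq_C_mul, map_natCast]
        ring
      rw [h5, map_smul, smul_eq_mul]
  rw [h1, h2, hl _ (J.mul_mem_left _ (sum_descFactorial_mem (hJ m hm) _))]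
  simp

theorem prod_X_eq_monomial (v : Fin L → ι × ℕ) :
    ∏ i, MvPolynomial.X (v i) = MvPolynomial.monomial (content v) (1 : 𝕜) := by
  rw [content, MvPolynomial.monomial_sum_one]
  rfl

theorem weight_content (v : Fin L → ι × ℕ) :
    Finsupp.weight (fun v : ι × ℕ => (Finsupp.single v.1 1 : ι →₀ ℕ)) (content v) =
      content fun i => (v i).1 := by
  rw [content, map_sum]
  simp [content, Finsupp.weight_single]

/-- If `f` pairs to zero at `σ₀` with all multiples of `∏_{c<d} (s_c - s_d)^{k(σ₀ c, σ₀ d)}`, then its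
component of multidegree `content σ₀` belongs to the ideal of the coefficients of the series
`∂^m X_α · X_β`, `m < k(α, β)`. Indeed every functional that kills this ideal has a generating
polynomial which is such a multiple. -/
theorem component_mem_of_pairing_eq_zero [CharZero 𝕜] [DecidableEq ι]
    {J : Ideal (MvPolynomial (ι × ℕ) 𝕜)} (σ₀ : Fin L → ι) (k : ι → ι → ℕ)
    (hJ : ∀ α β, (∀ m < k α β, ∀ n, PowerSeries.coeff n
        (iterDeriv m (current 𝕜 α) * current 𝕜 β) ∈ J) ∨
      (∀ m < k α β, ∀ n, PowerSeries.coeff n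
        (iterDeriv m (current 𝕜 β) * current 𝕜 α) ∈ J))
    {f : MvPolynomial (ι × ℕ) 𝕜}
    (hf : ∀ q : MvPolynomial (Fin L) 𝕜,
      ∏ p ∈ orderedPairs L, (MvPolynomial.X p.1 - MvPolynomial.X p.2) ^ k (σ₀ p.1) (σ₀ p.2) ∣ q →
        pairing L f (Pi.single σ₀ q) = 0) :
    component (content σ₀) f ∈ J := by
  classical
  by_contra hnot
  obtain ⟨l, hl, hl0⟩ := (Submodule.restrictScalars 𝕜 J).exists_dual_map_eq_bot_of_notMem
    (x := component (content σ₀) f) hnot inferInstance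
  have hker : ∀ a ∈ J, l a = 0 := fun a ha => by
    have : l a ∈ (Submodule.restrictScalars 𝕜 J).map l := ⟨a, ha, rfl⟩
    rwa [hl0, Submodule.mem_bot] at this
  obtain ⟨N, hN⟩ : ∃ N : ℕ, ∀ v : Fin L → ι × ℕ, content v ∈ f.support → ∑ i, (v i).2 < N := by
    refine ⟨(∑ e ∈ f.support, Finsupp.weight (fun v : ι × ℕ => v.2) e) + 1, fun v hv => ?_⟩
    have h1 : Finsupp.weight (fun v : ι × ℕ => v.2) (content v) = ∑ i, (v i).2 := by
      rw [content, map_sum]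
      simp [Finsupp.weight_single]
    rw [← h1]
    exact Nat.lt_succ_of_le (Finset.single_le_sum (fun _ _ => Nat.zero_le _) hv)
  have hdvd : ∏ p ∈ orderedPairs L, (MvPolynomial.X p.1 - MvPolynomial.X p.2) ^
      k (σ₀ p.1) (σ₀ p.2) ∣ generatingPoly l σ₀ N := by
    refine prod_X_sub_X_pow_dvd (fun p => k (σ₀ p.1) (σ₀ p.2)) _ fun p hp => ?_
    rcases hJ (σ₀ p.1) (σ₀ p.2) with h | h
    · exact X_sub_X_pow_dvd_generatingPoly hker σ₀ N _ hp.ne h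
    · have := X_sub_X_pow_dvd_generatingPoly hker σ₀ N _ hp.ne' h
      refine (pow_dvd_pow_of_dvd ?_ _).trans this
      rw [← neg_sub]
      exact neg_dvd.2 dvd_rfl
  have h0 := hf _ hdvd
  -- the number of permutations that preserve the labelling
  set s : ℕ := (Finset.univ.filter fun w : Equiv.Perm (Fin L) => σ₀ ∘ w = σ₀).card with hs
  have hs0 : s ≠ 0 := Finset.card_ne_zero.2 ⟨1, by simp⟩
  have hcomp : component (content σ₀) f = ∑ e ∈ f.support,
      if Finsupp.weight (fun v : ι × ℕ => (Finsupp.single v.1 1 : ι →₀ ℕ)) e = content σ₀ then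
        MvPolynomial.coeff e f • MvPolynomial.monomial e (1 : 𝕜) else 0 := by
    rw [component, MvPolynomial.weightedHomogeneousComponent_apply, Finset.sum_filter]
    refine Finset.sum_congr rfl fun e _ => ?_
    rw [MvPolynomial.smul_monomial, smul_eq_mul, mul_one]
  have hpair : pairing L f (Pi.single σ₀ (generatingPoly l σ₀ N)) =
      (s : 𝕜) * l (component (content σ₀) f) := by
    rw [hcomp, map_sum, Finset.mul_sum, pairing, LinearMap.sum_apply]
    refine Finset.sum_congr rfl fun e he => ?_
    split_ifs with hv hwt hwt
    · rw [LinearMap.smul_apply, map_smul, smul_eq_mul, smul_eq_mul, mul_left_comm]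
      congr 1
      rw [monomialPairing_apply]
      set v := hv.choose with hvdef
      have hve : content v = e := hv.choose_spec
      have hterm : ∀ w : Equiv.Perm (Fin L), MvPolynomial.coeff
          (Finsupp.equivFunOnFinite.symm fun i => (v (w i)).2)
          (Pi.single (M := fun _ => MvPolynomial (Fin L) 𝕜) σ₀ (generatingPoly l σ₀ N)
            fun i => (v (w i)).1) =
          if (fun i => (v i).1) ∘ w = σ₀ then l (MvPolynomial.monomial e 1) else 0 := by
        intro w
        rw [Pi.single_apply]
        have e1 : (fun i => (v (w i)).1) = (fun i => (v i).1) ∘ w := rfl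
        have e2 : content (v ∘ w) = e := by rw [content_comp_perm, hve]
        rw [e1]
        split_ifs with h
        · refine (coeff_generatingPoly l σ₀ (n := fun i => (v (w i)).2)
            (hN (v ∘ w) (by rw [e2]; exact he))).trans ?_
          rw [← e2, ← prod_X_eq_monomial]
          congr 1
          refine Finset.prod_congr rfl fun i _ => ?_
          rw [← congrFun h i]
          rfl
        · simp
      rw [Finset.sum_congr rfl fun w _ => hterm w, ← Finset.sum_filter, Finset.sum_const,
        nsmul_eq_mul]
      congr 2
      rw [← hve, weight_content] at hwt
      obtain ⟨w₁, hw₁⟩ := exists_perm_of_content_eq hwt.symm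
      refine Finset.card_bij (fun w _ => w₁ * w) ?_ ?_ ?_
      · intro w hw
        simp only [Finset.mem_filter, Finset.mem_univ, true_and] at hw ⊢
        rw [← hw₁] at hw
        exact hw
      · intro w _ w' _ h
        exact mul_left_cancel h
      · intro w hw
        refine ⟨w₁⁻¹ * w, ?_, by simp⟩
        simp only [Finset.mem_filter, Finset.mem_univ, true_and] at hw ⊢
        rw [← hw₁, Function.comp_assoc, ← Equiv.Perm.coe_mul, mul_inv_cancel_left]
        exact hw
    · rw [LinearMap.smul_apply, monomialPairing_apply, Finset.sum_eq_zero]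
      · simp
      · intro w _
        rw [Pi.single_apply, if_neg, MvPolynomial.coeff_zero]
        intro h
        apply hwt
        rw [← hv.choose_spec, weight_content, ← content_comp_perm _ w, ← h]
        rfl
    · exfalso
      apply hv
      apply exists_content_eq
      have h1 := congrArg Finsupp.degree hwt
      rw [degree_content] at h1
      rw [← h1, Finsupp.degree_eq_weight_one, Finsupp.weight_apply, Finsupp.weight_apply, Finsupp.sum,
        Finsupp.sum, map_sum]
      refine Finset.sum_congr rfl fun v _ => ?_
      simp
    · simp
  rw [h0, eq_comm, mul_eq_zero] at hpair
  exact hl (hpair.resolve_left (by exact_mod_cast hs0))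

end Duality

/-! ### The monomial order is a well-order compatible with addition -/

section MonomialOrder

variable {P : Set (ℝ × ℝ)}

/-- The data compared lexicographically by `MonomialLT`. -/
noncomputable def orderKey (r : LatticePoint P →₀ ℕ) :
    ℕ ×ₗ (Lex (ℤ →₀ ℕ) ×ₗ Lex ((ℤ ×ₗ ℤ) →₀ ℕ)) :=
  toLex (r.degree, toLex (toLex (r.mapDomain fun α => α.1.1),
    toLex (r.mapDomain fun α => toLex (α.1.2, α.1.1))))

theorem rowOrder_injective :
    Function.Injective fun α : LatticePoint P => toLex (α.1.2, α.1.1) := by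
  intro α β h
  have h' := Prod.ext_iff.1 (toLex.injective h)
  exact Subtype.ext (Prod.ext h'.2 h'.1)

theorem orderKey_injective : Function.Injective (orderKey (P := P)) := by
  intro r r' h
  have h1 := congrArg Prod.snd (toLex.injective h)
  have h2 := congrArg Prod.snd (toLex.injective h1)
  exact Finsupp.mapDomain_injective rowOrder_injective (toLex.injective h2)

theorem monomialLT_iff_orderKey_lt {r r' : LatticePoint P →₀ ℕ} :
    MonomialLT r r' ↔ orderKey r < orderKey r' := by
  have hrow : (∃ α : LatticePoint P, r α < r' α ∧
      ∀ β : LatticePoint P, RowLT β.1 α.1 → r β = r' β) ↔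
      toLex (r.mapDomain fun α => toLex (α.1.2, α.1.1)) <
        toLex (r'.mapDomain fun α => toLex (α.1.2, α.1.1)) := by
    rw [Finsupp.Lex.lt_iff]
    have happ : ∀ (s : LatticePoint P →₀ ℕ) (α : LatticePoint P),
        s.mapDomain (fun α => toLex (α.1.2, α.1.1)) (toLex (α.1.2, α.1.1)) = s α :=
      fun s α => Finsupp.mapDomain_apply rowOrder_injective s α
    constructor
    · rintro ⟨α, h1, h2⟩
      refine ⟨toLex (α.1.2, α.1.1), fun j hj => ?_, ?_⟩
      · by_cases hj' : j ∈ Set.range fun α : LatticePoint P => toLex (α.1.2, α.1.1)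
        · obtain ⟨β, rfl⟩ := hj'
          have h3 := h2 β (by
            rcases Prod.Lex.toLex_lt_toLex.1 hj with h | h
            · exact Or.inl h
            · exact Or.inr h)
          exact (happ r β).trans (h3.trans (happ r' β).symm)
        · exact (Finsupp.mapDomain_of_notMem_range r j hj').trans
            (Finsupp.mapDomain_of_notMem_range r' j hj').symm
      · exact (happ r α).trans_lt (h1.trans_eq (happ r' α).symm)
    · rintro ⟨j, h1, h2⟩
      by_cases hj' : j ∈ Set.range fun α : LatticePoint P => toLex (α.1.2, α.1.1)
      · obtain ⟨α, rfl⟩ := hj'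
        refine ⟨α, (happ r α).symm.trans_lt (lt_of_lt_of_eq h2 (happ r' α)), fun β hβ => ?_⟩
        refine (happ r β).symm.trans ((h1 _ ?_).trans (happ r' β))
        rw [Prod.Lex.toLex_lt_toLex]
        exact hβ
      · have h3 := Finsupp.mapDomain_of_notMem_range r' j hj'
        exact absurd (h2.trans_eq h3) (Nat.not_lt_zero _)
  have hcol : (∃ i : ℤ, columnSum r i < columnSum r' i ∧
      ∀ i' < i, columnSum r i' = columnSum r' i') ↔
      toLex (r.mapDomain fun α : LatticePoint P => α.1.1) < toLex (r'.mapDomain fun α => α.1.1) := by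
    rw [Finsupp.Lex.lt_iff]
    exact exists_congr fun i => and_comm
  have hcol' : (∀ i : ℤ, columnSum r i = columnSum r' i) ↔
      toLex (r.mapDomain fun α : LatticePoint P => α.1.1) = toLex (r'.mapDomain fun α => α.1.1) := by
    rw [toLex.injective.eq_iff]
    exact Finsupp.ext_iff.symm
  rw [MonomialLT, hcol, hcol', hrow, orderKey, orderKey, Prod.Lex.toLex_lt_toLex,
    Prod.Lex.toLex_lt_toLex]

theorem monomialLT_irrefl (r : LatticePoint P →₀ ℕ) : ¬ MonomialLT r r := by
  rw [monomialLT_iff_orderKey_lt]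
  exact lt_irrefl _

theorem MonomialLT.trans {r r' r'' : LatticePoint P →₀ ℕ} (h : MonomialLT r r')
    (h' : MonomialLT r' r'') : MonomialLT r r'' := by
  rw [monomialLT_iff_orderKey_lt] at *
  exact h.trans h'

theorem MonomialLT.add_right {r r' : LatticePoint P →₀ ℕ} (h : MonomialLT r r')
    (s : LatticePoint P →₀ ℕ) : MonomialLT (r + s) (r' + s) := by
  simpa only [MonomialLT, map_add, columnSum, Finsupp.mapDomain_add, Finsupp.add_apply,
    add_lt_add_iff_right, add_left_inj] using h

/-- Only finitely many vectors are smaller than a given one, since the degree is compared first. -/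
theorem wellFounded_monomialLT [Finite (LatticePoint P)] :
    WellFounded (MonomialLT (P := P)) := by
  have hfin : ∀ r : LatticePoint P →₀ ℕ, {r' | MonomialLT r' r}.Finite := fun r =>
    (Finsupp.finite_of_degree_le r.degree).subset fun r' h => by
      rcases h with h | h
      · exact h.le
      · exact h.1.le
  refine Subrelation.wf (r := InvImage (· < ·) fun r => {r' | MonomialLT r' r}.ncard)
    (fun {r r'} h => ?_) (InvImage.wf _ wellFounded_lt)
  exact Set.ncard_lt_ncard ⟨fun r'' h' => MonomialLT.trans h' h,
    fun hsub => monomialLT_irrefl r (hsub h)⟩ (hfin r')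

instance [Finite (LatticePoint P)] : IsWellOrder (LatticePoint P →₀ ℕ) MonomialLT where
  wf := wellFounded_monomialLT
  trichotomous r r' h h' := by
    rw [monomialLT_iff_orderKey_lt] at h h'
    exact orderKey_injective (le_antisymm (not_lt.1 h') (not_lt.1 h))

end MonomialOrder

/-! ### Initial parts and generators -/

section Initial

variable {𝕜 : Type*} [Field 𝕜] {σ : Type*}

theorem component_add (r : σ →₀ ℕ) (f g : MvPolynomial (σ × ℕ) 𝕜) :
    component r (f + g) = component r f + component r g :=
  map_add _ _ _

theorem component_monomial_mul (r : σ →₀ ℕ) (e : σ × ℕ →₀ ℕ) (c : 𝕜)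
    (h : MvPolynomial (σ × ℕ) 𝕜) {s : σ →₀ ℕ}
    (hs : Finsupp.weight (fun v : σ × ℕ => (Finsupp.single v.1 1 : σ →₀ ℕ)) e = s) :
    component (r + s) (MvPolynomial.monomial e c * h) =
      MvPolynomial.monomial e c * component r h := by
  classical
  ext d
  rw [component, component, MvPolynomial.coeff_weightedHomogeneousComponent,
    MvPolynomial.coeff_monomial_mul', MvPolynomial.coeff_monomial_mul']
  by_cases hed : e ≤ d
  · obtain ⟨d, rfl⟩ := exists_add_of_le hed
    rw [if_pos hed, if_pos hed, add_tsub_cancel_left, MvPolynomial.coeff_weightedHomogeneousComponent,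
      map_add, hs, add_comm s]
    simp only [add_left_inj, mul_ite, mul_zero]
  · rw [if_neg hed, if_neg hed, ite_self]

theorem component_monomial_mul_eq_zero (r : σ →₀ ℕ) (e : σ × ℕ →₀ ℕ) (c : 𝕜)
    (h : MvPolynomial (σ × ℕ) 𝕜)
    (hr : ¬ Finsupp.weight (fun v : σ × ℕ => (Finsupp.single v.1 1 : σ →₀ ℕ)) e ≤ r) :
    component r (MvPolynomial.monomial e c * h) = 0 := by
  classical
  ext d
  rw [component, MvPolynomial.coeff_weightedHomogeneousComponent,
    MvPolynomial.coeff_monomial_mul', MvPolynomial.coeff_zero, ite_eq_right_iff]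
  rintro rfl
  refine if_neg fun hed => hr ?_
  obtain ⟨d, rfl⟩ := exists_add_of_le hed
  rw [map_add]
  exact le_self_add

theorem component_component_self (r : σ →₀ ℕ) (f : MvPolynomial (σ × ℕ) 𝕜) :
    component r (component r f) = component r f :=
  MvPolynomial.IsWeightedHomogeneous.weightedHomogeneousComponent_same
    (MvPolynomial.weightedHomogeneousComponent_isWeightedHomogeneous r f)

theorem component_component_of_ne {r r' : σ →₀ ℕ} (h : r ≠ r') (f : MvPolynomial (σ × ℕ) 𝕜) :
    component r (component r' f) = 0 :=
  MvPolynomial.IsWeightedHomogeneous.weightedHomogeneousComponent_ne r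
    (MvPolynomial.weightedHomogeneousComponent_isWeightedHomogeneous r' f) h

variable {lt : (σ →₀ ℕ) → (σ →₀ ℕ) → Prop}

/-- An element of the ideal of the initial parts has the same component of any given multidegree
as a combination of the generators without larger components. -/
theorem exists_mem_span_component_eq (hadd : ∀ r r' s, lt r r' → lt (r + s) (r' + s))
    {G : Set (MvPolynomial (σ × ℕ) 𝕜 × MvPolynomial (σ × ℕ) 𝕜)}
    (hG : ∀ p ∈ G, IsInitialPart lt p.1 p.2) {h : MvPolynomial (σ × ℕ) 𝕜}
    (hh : h ∈ Ideal.span (Prod.snd '' G)) (r : σ →₀ ℕ) :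
    ∃ g ∈ Ideal.span (Prod.fst '' G), component r g = component r h ∧
      ∀ r', component r' g ≠ 0 → r' = r ∨ lt r' r := by
  have hzero : ∀ r r' : σ →₀ ℕ, component r' (0 : MvPolynomial (σ × ℕ) 𝕜) ≠ 0 →
      r' = r ∨ lt r' r := fun r r' h' => absurd (map_zero _) h'
  have hsum : ∀ (r : σ →₀ ℕ) (h h' : MvPolynomial (σ × ℕ) 𝕜),
      (∃ g ∈ Ideal.span (Prod.fst '' G), component r g = component r h ∧
        ∀ r', component r' g ≠ 0 → r' = r ∨ lt r' r) →
      (∃ g ∈ Ideal.span (Prod.fst '' G), component r g = component r h' ∧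
        ∀ r', component r' g ≠ 0 → r' = r ∨ lt r' r) →
      ∃ g ∈ Ideal.span (Prod.fst '' G), component r g = component r (h + h') ∧
        ∀ r', component r' g ≠ 0 → r' = r ∨ lt r' r := by
    rintro r h h' ⟨g, hg, h1, h2⟩ ⟨g', hg', h1', h2'⟩
    refine ⟨g + g', add_mem hg hg', by rw [component_add, component_add, h1, h1'], fun r' h3 => ?_⟩
    by_cases h4 : component r' g = 0
    · exact h2' r' fun h5 => h3 (by rw [component_add, h4, h5, add_zero])
    · exact h2 r' h4
  induction hh using Submodule.span_induction generalizing r with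
  | mem h hh =>
    obtain ⟨⟨W, h⟩, hp, rfl⟩ := hh
    obtain ⟨d, hd, hd', hmax⟩ := hG _ hp
    simp only at hd hd' hmax ⊢
    by_cases hrd : r = d
    · subst hrd
      exact ⟨W, Ideal.subset_span ⟨_, hp, rfl⟩, by rw [hd', component_component_self], hmax⟩
    · refine ⟨0, zero_mem _, ?_, hzero r⟩
      rw [hd', component_component_of_ne hrd]
      exact map_zero _
  | zero => exact ⟨0, zero_mem _, rfl, hzero r⟩
  | add h h' _ _ ih ih' => exact hsum r h h' (ih r) (ih' r)
  | smul a h _ ih =>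
    rw [smul_eq_mul]
    induction a using MvPolynomial.induction_on' with
    | monomial e c =>
      by_cases hr : Finsupp.weight (fun v : σ × ℕ => (Finsupp.single v.1 1 : σ →₀ ℕ)) e ≤ r
      · obtain ⟨s, rfl⟩ : ∃ s, r = s + _ := ⟨_, (tsub_add_cancel_of_le hr).symm⟩
        obtain ⟨g, hg, h1, h2⟩ := ih s
        refine ⟨MvPolynomial.monomial e c * g, Ideal.mul_mem_left _ _ hg, ?_, fun r' h3 => ?_⟩
        · rw [component_monomial_mul _ _ _ _ rfl, component_monomial_mul _ _ _ _ rfl, h1]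
        · by_cases hr' : Finsupp.weight (fun v : σ × ℕ => (Finsupp.single v.1 1 : σ →₀ ℕ)) e ≤ r'
          · obtain ⟨s', rfl⟩ : ∃ s', r' = s' + _ := ⟨_, (tsub_add_cancel_of_le hr').symm⟩
            rw [component_monomial_mul _ _ _ _ rfl] at h3
            rcases h2 s' (right_ne_zero_of_mul h3) with rfl | h4
            · exact Or.inl rfl
            · exact Or.inr (hadd _ _ _ h4)
          · exact absurd (component_monomial_mul_eq_zero _ _ _ _ hr') h3
      · refine ⟨0, zero_mem _, ?_, hzero r⟩
        rw [component_monomial_mul_eq_zero _ _ _ _ hr]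
        exact map_zero _
    | add a b iha ihb =>
      rw [add_mul]
      exact hsum r _ _ iha ihb

variable [IsWellOrder (σ →₀ ℕ) lt]

theorem exists_isInitialPart {f : MvPolynomial (σ × ℕ) 𝕜} (hf : f ≠ 0) :
    ∃ h, IsInitialPart lt f h := by
  classical
  let : LinearOrder (σ →₀ ℕ) := linearOrderOfSTO lt
  set T := f.support.image
    (Finsupp.weight (fun v : σ × ℕ => (Finsupp.single v.1 1 : σ →₀ ℕ))) with hT
  have hcomp : ∀ r, component r f ≠ 0 ↔ r ∈ T := by
    intro r
    rw [component, ← MvPolynomial.support_nonempty, MvPolynomial.support_weightedHomogeneousComponent,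
      hT, Finset.mem_image, Finset.filter_nonempty_iff]
  obtain ⟨r, hr, hmax⟩ := T.exists_max_image id
    (Finset.image_nonempty.2 (MvPolynomial.support_nonempty.2 hf))
  exact ⟨_, r, (hcomp r).2 hr, rfl, fun r' hr' => hmax r' ((hcomp r').1 hr')⟩

/-- Elements of an ideal whose initial parts generate the initial ideal generate the ideal. -/
theorem span_eq_of_isInitialPart (hadd : ∀ r r' s, lt r r' → lt (r + s) (r' + s))
    {G : Set (MvPolynomial (σ × ℕ) 𝕜 × MvPolynomial (σ × ℕ) 𝕜)}
    (hG : ∀ p ∈ G, IsInitialPart lt p.1 p.2) {I : Ideal (MvPolynomial (σ × ℕ) 𝕜)}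
    (hGI : ∀ p ∈ G, p.1 ∈ I)
    (hI : ∀ f ∈ I, ∀ h, IsInitialPart lt f h → h ∈ Ideal.span (Prod.snd '' G)) :
    Ideal.span (Prod.fst '' G) = I := by
  have hle : Ideal.span (Prod.fst '' G) ≤ I := by
    rw [Ideal.span_le]
    rintro _ ⟨p, hp, rfl⟩
    exact hGI p hp
  refine le_antisymm hle fun f hf => ?_
  have key : ∀ r : σ →₀ ℕ, ∀ f ∈ I, (∀ r', component r' f ≠ 0 → r' = r ∨ lt r' r) →
      f ∈ Ideal.span (Prod.fst '' G) := by
    intro r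
    induction r using (IsWellFounded.wf (r := lt)).induction with
    | _ r ih =>
      intro f hf hr
      have low : ∀ f ∈ I, (∀ r', component r' f ≠ 0 → lt r' r) →
          f ∈ Ideal.span (Prod.fst '' G) := by
        intro f hf hr
        by_cases h0 : f = 0
        · rw [h0]; exact zero_mem _
        · obtain ⟨_, d, hd, -, hmax⟩ := exists_isInitialPart (lt := lt) h0
          exact ih d (hr d hd) f hf hmax
      by_cases h0 : component r f = 0
      · refine low f hf fun r' hr' => (hr r' hr').resolve_left ?_
        rintro rfl
        exact hr' h0
      · obtain ⟨g, hg, h1, h2⟩ := exists_mem_span_component_eq hadd hG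
          (hI f hf _ ⟨r, h0, rfl, hr⟩) r
        rw [component_component_self] at h1
        have h3 := low (f - g) (sub_mem hf (hle hg)) fun r' hr' => by
          have e : component r' (f - g) = component r' f - component r' g := map_sub _ _ _
          rw [e] at hr'
          have hne : r' ≠ r := by
            rintro rfl
            rw [h1, sub_self] at hr'
            exact hr' rfl
          by_cases h4 : component r' f = 0
          · exact (h2 r' fun h5 => hr' (by rw [h4, h5, sub_zero])).resolve_left hne
          · exact (hr r' h4).resolve_left hne
        rw [← sub_add_cancel f g]
        exact add_mem h3 hg
  by_cases h0 : f = 0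
  · rw [h0]; exact zero_mem _
  · obtain ⟨_, d, -, -, hmax⟩ := exists_isInitialPart (lt := lt) h0
    exact key d f hf hmax

end Initial

/-! ### Leading components of relations -/

section Polygon

variable {η : ℕ} {ζ : ℕ → ℕ}

/-- The column of a point of the polygon; the first coordinate is nonnegative. -/
def pointColumn (α : LatticePoint (polygon η ζ)) : ℕ := α.1.1.toNat

/-- The row of a point of the polygon; the second coordinate is nonnegative. -/
def pointRow (α : LatticePoint (polygon η ζ)) : ℕ := α.1.2.toNat

/-- The lowest height of points of the polygon in a column. -/
def columnBottom (η : ℕ) (ζ : ℕ → ℕ) (b : ℕ) : ℕ := (low η ζ b).toNat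

/-- `k(α, β)`, made independent of the order of `α` and `β`. It is `0` if `α = β`. -/
noncomputable def pairK (α β : LatticePoint (polygon η ζ)) : ℕ :=
  open Classical in if Precedes α.1 β.1 then pathK η ζ α.1 β.1 else pathK η ζ β.1 α.1

theorem low_nonneg {x : ℤ} (h0 : 0 ≤ x) (h1 : x ≤ η) : 0 ≤ low η ζ x := by
  have : ζ x.toNat ≤ zetaMax η ζ := Finset.le_sup (f := ζ) (Finset.mem_range.2 (by omega))
  unfold low
  omega

theorem precedes_or_precedes {α β : LatticePoint (polygon η ζ)} (h : α ≠ β) :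
    (Precedes α.1 β.1 ∧ ¬ Precedes β.1 α.1) ∨ (Precedes β.1 α.1 ∧ ¬ Precedes α.1 β.1) := by
  have : ¬ (α.1.1 = β.1.1 ∧ α.1.2 = β.1.2) := fun h' => h (Subtype.ext (Prod.ext h'.1 h'.2))
  simp only [Precedes]
  omega

variable (hη : 0 < η)
  (hζ : ∀ i : ℕ, i + 2 ≤ η → (ζ i : ℤ) - ζ (i + 1) ≤ (ζ (i + 1) : ℤ) - ζ (i + 2))
include hη hζ

theorem point_bounds (α : LatticePoint (polygon η ζ)) :
    0 ≤ α.1.1 ∧ α.1.1 ≤ η ∧ 0 ≤ low η ζ α.1.1 ∧ low η ζ α.1.1 ≤ α.1.2 ∧ α.1.2 ≤ zetaMax η ζ := by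
  obtain ⟨h1, h2, h3, h4⟩ := (mem_polygon_iff hη hζ α.1).1 α.2
  exact ⟨h1, h2, low_nonneg h1 h2, h3, h4⟩

theorem finite_latticePoint : Finite (LatticePoint (polygon η ζ)) := by
  refine Finite.of_injective (fun α => (⟨α.1, ?_⟩ :
    ((Finset.Icc (0 : ℤ) η ×ˢ Finset.Icc (0 : ℤ) (zetaMax η ζ) : Finset (ℤ × ℤ))))) ?_
  · obtain ⟨h1, h2, h3, h4, h5⟩ := point_bounds hη hζ α
    simp only [Finset.mem_product, Finset.mem_Icc]
    omega
  · intro α β h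
    exact Subtype.ext (Subtype.ext_iff.1 h :)

theorem rowKey_point_injective :
    Function.Injective (rowKey (pointColumn (η := η) (ζ := ζ)) pointRow) := by
  intro α β h
  obtain ⟨h1, h2⟩ := Prod.ext_iff.1 (toLex.injective h)
  obtain ⟨h3, h4, h5, h6, h7⟩ := point_bounds hη hζ α
  obtain ⟨h8, h9, h10, h11, h12⟩ := point_bounds hη hζ β
  simp only [pointColumn, pointRow] at h1 h2
  exact Subtype.ext (Prod.ext (by omega) (by omega))

theorem columnBottom_pointColumn (α : LatticePoint (polygon η ζ)) :
    columnBottom η ζ (pointColumn α) = (low η ζ α.1.1).toNat := by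
  have h := (point_bounds hη hζ α).1
  rw [columnBottom, pointColumn, Int.toNat_of_nonneg h]

theorem columnBottom_le_pointRow (α : LatticePoint (polygon η ζ)) :
    columnBottom η ζ (pointColumn α) ≤ pointRow α := by
  have h := point_bounds hη hζ α
  rw [columnBottom_pointColumn hη hζ, pointRow]
  omega

theorem pathK_self (α : LatticePoint (polygon η ζ)) : pathK η ζ α.1 α.1 = 0 := by
  have h := point_bounds hη hζ α
  simp only [pathK, pathWidth, pathVert, pathHeight, le_refl, if_true]
  omega

theorem pairExponent_add_eq_of_precedes {L : ℕ} (σ : Fin L → LatticePoint (polygon η ζ))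
    {c d : Fin L} (h : Precedes (σ c).1 (σ d).1) :
    pairExponent pointColumn pointRow (columnBottom η ζ) σ c d +
      pairExponent pointColumn pointRow (columnBottom η ζ) σ d c =
      pathK η ζ (σ c).1 (σ d).1 + 1 := by
  obtain ⟨h3, h4, h5, h6, h7⟩ := point_bounds hη hζ (σ c)
  obtain ⟨h8, h9, h10, h11, h12⟩ := point_bounds hη hζ (σ d)
  have hlow : (σ c).1.1 = (σ d).1.1 → low η ζ (σ c).1.1 = low η ζ (σ d).1.1 :=
    congrArg (low η ζ)
  simp only [Precedes] at h
  by_cases hc : (σ c).1.2 ≤ (σ d).1.2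
  · have hlt : rowKey pointColumn pointRow (σ c) < rowKey pointColumn pointRow (σ d) := by
      simp only [rowKey, Prod.Lex.toLex_lt_toLex, pointColumn, pointRow]
      omega
    rw [pairExponent, pairExponent, rowShift, rowShift, if_pos hlt, if_neg hlt.not_gt, rowFloor,
      columnBottom_pointColumn hη hζ,
      if_neg (show ¬ pointColumn (σ d) < pointColumn (σ c) by unfold pointColumn; omega)]
    simp only [pathK, pathWidth, pathVert, pathHeight, pointColumn, pointRow, hc, if_true]
    omega
  · have hlt : rowKey pointColumn pointRow (σ d) < rowKey pointColumn pointRow (σ c) := by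
      simp only [rowKey, Prod.Lex.toLex_lt_toLex, pointColumn, pointRow]
      omega
    rw [pairExponent, pairExponent, rowShift, rowShift, if_pos hlt, if_neg hlt.not_gt, rowFloor,
      columnBottom_pointColumn hη hζ,
      if_pos (show pointColumn (σ c) < pointColumn (σ d) by unfold pointColumn; omega)]
    simp only [pathK, pathWidth, pathVert, pathHeight, pointColumn, pointRow, hc, if_false,
      if_true]
    omega

/-- The factor of a pair of positions with labels `α ≠ β` has exponent `k(α, β) + 1`. -/
theorem pairExponent_add_eq {L : ℕ} (σ : Fin L → LatticePoint (polygon η ζ)) {c d : Fin L}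
    (h : σ c ≠ σ d) :
    pairExponent pointColumn pointRow (columnBottom η ζ) σ c d +
      pairExponent pointColumn pointRow (columnBottom η ζ) σ d c = pairK (σ c) (σ d) + 1 := by
  rcases precedes_or_precedes h with h | h
  · rw [pairK, if_pos h.1]
    exact pairExponent_add_eq_of_precedes hη hζ σ h.1
  · rw [pairK, if_neg h.2, add_comm]
    exact pairExponent_add_eq_of_precedes hη hζ σ h.1

theorem pairExponent_add_eq_of_eq {L : ℕ} (σ : Fin L → LatticePoint (polygon η ζ)) {c d : Fin L}
    (h : σ c = σ d) :
    pairExponent pointColumn pointRow (columnBottom η ζ) σ c d +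
      pairExponent pointColumn pointRow (columnBottom η ζ) σ d c = pairK (σ c) (σ d) := by
  have hk : pairK (σ c) (σ d) = 0 := by
    rw [pairK, h, ite_self, pathK_self hη hζ]
  have hb := columnBottom_le_pointRow hη hζ (σ d)
  rw [hk, pairExponent, pairExponent, rowShift, rowShift, rowFloor, rowFloor, h]
  simp only [lt_irrefl, if_false, add_zero, max_eq_left hb]
  omega

theorem mem_lowerLabellings_of_not_lt {L : ℕ} {σ σ₀ : Fin L → LatticePoint (polygon η ζ)}
    (h : ¬ MonomialLT (content σ₀) (content σ)) : σ ∈ lowerLabellings pointColumn pointRow σ₀ := by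
  classical
  have hdeg : (content σ₀).degree = (content σ).degree := by rw [degree_content, degree_content]
  have hcol : ∀ (τ : Fin L → LatticePoint (polygon η ζ)) (i : ℤ), 0 ≤ i →
      columnSum (content τ) i = content (pointColumn ∘ τ) i.toNat := by
    intro τ i hi
    rw [columnSum, content, Finsupp.mapDomain_finsetSum, content_apply]
    simp only [Finsupp.mapDomain_single]
    have := content_apply (fun j => (τ j).1.1) i
    rw [content] at this
    rw [this]
    congr 1
    refine Finset.filter_congr fun j _ => ?_
    have := point_bounds hη hζ (τ j)
    simp only [Function.comp_apply, pointColumn]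
    omega
  have hcolneg : ∀ (τ : Fin L → LatticePoint (polygon η ζ)) (i : ℤ), i < 0 →
      columnSum (content τ) i = 0 := by
    intro τ i hi
    refine Finsupp.mapDomain_of_notMem_range _ _ ?_
    rintro ⟨α, rfl⟩
    exact absurd (point_bounds hη hζ α).1 (not_le.2 hi)
  have hrow : ∀ (τ : Fin L → LatticePoint (polygon η ζ)) (α : LatticePoint (polygon η ζ)),
      content (rowKey pointColumn pointRow ∘ τ) (rowKey pointColumn pointRow α) = content τ α := by
    intro τ α
    rw [content_apply, content_apply]
    simp only [Function.comp_apply, (rowKey_point_injective hη hζ).eq_iff]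
  constructor
  · rintro ⟨b, h1, h2⟩
    refine h (Or.inr ⟨hdeg, Or.inl ⟨b, ?_, fun i hi => ?_⟩⟩)
    · rwa [hcol _ _ (Int.natCast_nonneg b), hcol _ _ (Int.natCast_nonneg b), Int.toNat_natCast]
    · rcases lt_or_ge i 0 with h3 | h3
      · rw [hcolneg _ _ h3, hcolneg _ _ h3]
      · rw [hcol _ _ h3, hcol _ _ h3]
        exact h2 _ (by omega)
  · rintro h0 ⟨b, h1, h2⟩
    refine h (Or.inr ⟨hdeg, Or.inr ⟨fun i => ?_, ?_⟩⟩)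
    · rcases lt_or_ge i 0 with h3 | h3
      · rw [hcolneg _ _ h3, hcolneg _ _ h3]
      · rw [hcol _ _ h3, hcol _ _ h3, h0]
    · obtain ⟨j, hj⟩ : ∃ j, (rowKey pointColumn pointRow ∘ σ) j = b := by
        have h3 := (Nat.zero_le _).trans_lt h1
        rw [content_apply, Finset.card_pos] at h3
        obtain ⟨j, hj⟩ := h3
        exact ⟨j, (Finset.mem_filter.1 hj).2⟩
      subst hj
      simp only [Function.comp_apply, hrow] at h1
      refine ⟨σ j, h1, fun β hβ => ?_⟩
      have h3 := h2 (rowKey pointColumn pointRow β) (by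
        have h4 := point_bounds hη hζ β
        have h5 := point_bounds hη hζ (σ j)
        simp only [Function.comp_apply, rowKey, Prod.Lex.toLex_lt_toLex, pointColumn, pointRow]
        simp only [RowLT] at hβ
        omega)
      rwa [hrow, hrow] at h3

/-- The largest component of a relation belongs to the ideal of the coefficients of the products
`∂^m X_α X_β`. -/
theorem initialPart_mem_span {𝕜 : Type*} [Field 𝕜] [CharZero 𝕜]
    {f h : MvPolynomial (LatticePoint (polygon η ζ) × ℕ) 𝕜}
    (hf : f ∈ relationIdeal 𝕜 (toricGen 𝕜 (polygon η ζ))) (hh : IsInitialPart MonomialLT f h) :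
    h ∈ Ideal.span {p | ∃ α β : LatticePoint (polygon η ζ), Precedes α.1 β.1 ∧
        ∃ m < pathK η ζ α.1 β.1, ∃ n : ℕ, p = PowerSeries.coeff n (seriesIn 𝕜 α β m)} := by
  classical
  have := finite_latticePoint hη hζ
  obtain ⟨r, -, rfl, hmax⟩ := hh
  obtain ⟨L, hL⟩ : ∃ L, r.degree = L := ⟨_, rfl⟩
  obtain ⟨σ₀, rfl⟩ := exists_content_eq r hL
  refine component_mem_of_pairing_eq_zero σ₀ pairK (fun α β => ?_) fun q hq =>
    pairing_single_eq_zero (rowKey_point_injective hη hζ) (columnBottom_le_pointRow hη hζ) σ₀ pairK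
      (fun c d => pairExponent_add_eq hη hζ σ₀) (fun c d => pairExponent_add_eq_of_eq hη hζ σ₀)
      (fun z₁ z₂ w => ?_) (fun v hv => ?_) hq
  · by_cases hαβ : α = β
    · left
      intro m hm
      rw [pairK, hαβ, ite_self, pathK_self hη hζ] at hm
      exact absurd hm (Nat.not_lt_zero m)
    · rcases precedes_or_precedes hαβ with h | h
      · left
        intro m hm n
        rw [pairK, if_pos h.1] at hm
        exact Ideal.subset_span ⟨α, β, h.1, m, hm, n, rfl⟩
      · right
        intro m hm n
        rw [pairK, if_neg h.2] at hm
        exact Ideal.subset_span ⟨β, α, h.1, m, hm, n, rfl⟩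
  · have h := aeval_torusArc_eq_zero hf (z₁ : PowerSeries 𝕜) (z₂ : PowerSeries 𝕜)
      (w : PowerSeries 𝕜)
    simp only [← Polynomial.coe_pow, ← Polynomial.coe_mul, Polynomial.coeff_coe] at h
    exact h
  · refine mem_lowerLabellings_of_not_lt hη hζ fun hlt => ?_
    have hne : component (content fun i => (v i).1) f ≠ 0 := by
      intro h0
      have h1 := congrArg (MvPolynomial.coeff (content v)) h0
      rw [component, MvPolynomial.coeff_weightedHomogeneousComponent, if_pos (weight_content v),
        MvPolynomial.coeff_zero] at h1
      exact MvPolynomial.mem_support_iff.1 hv h1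
    rcases hmax _ hne with h | h
    · rw [h] at hlt
      exact monomialLT_irrefl _ hlt
    · exact monomialLT_irrefl _ (hlt.trans h)

end Polygon

/-! ### The initial parts of the series `W'` -/

section InitialPart

variable {η : ℕ} {ζ : ℕ → ℕ}

/-- The points `α + e_I` and `β - e_I` either lie in columns strictly between those of `α` and `β`,
or they lie in the columns of `α` and `β` and follow, in the row order, the first of `α` and `β`. -/
theorem pathSum_between (hη : 0 < η)
    (hζ : ∀ i : ℕ, i + 2 ≤ η → (ζ i : ℤ) - ζ (i + 1) ≤ (ζ (i + 1) : ℤ) - ζ (i + 2))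
    (α β : LatticePoint (polygon η ζ)) (hαβ : Precedes α.1 β.1) {I : Finset ℕ}
    (hI : I ⊆ Finset.range (pathK η ζ α.1 β.1)) (hne : I.Nonempty) {s : ℤ × ℤ}
    (hs : pathSum η ζ α.1 β.1 I = s) :
    (0 < s.1 ∧ s.1 < β.1.1 - α.1.1) ∨ ((s.1 = 0 ∨ s.1 = β.1.1 - α.1.1) ∧
      ((RowLT α.1 β.1 ∧ RowLT α.1 (α.1 + s) ∧ RowLT α.1 (β.1 - s)) ∨
        (RowLT β.1 α.1 ∧ RowLT β.1 (α.1 + s) ∧ RowLT β.1 (β.1 - s)))) := by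
  have hcard : 0 < I.card := hne.card_pos
  obtain ⟨-, -, -, ha, -⟩ := point_bounds hη hζ α
  obtain ⟨-, -, -, hb, -⟩ := point_bounds hη hζ β
  obtain ⟨⟨a1, a2⟩, _⟩ := α
  obtain ⟨⟨b1, b2⟩, _⟩ := β
  simp only [Precedes, RowLT, Prod.fst_add, Prod.snd_add, Prod.fst_sub, Prod.snd_sub] at *
  obtain ⟨w, hw⟩ : ∃ w : ℕ, b1 = a1 + w := ⟨(b1 - a1).toNat, by omega⟩
  subst hw
  have hW : pathWidth (a1, a2) (a1 + w, b2) = w := by simp [pathWidth]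
  by_cases hc : a2 ≤ b2
  · -- the vertical edges come last, and `B` is the height at which they begin
    set B : ℤ := max a2 (low η ζ (a1 + w)) with hB
    have hV : (pathVert η ζ (a1, a2) (a1 + w, b2) : ℤ) = b2 - B := by
      simp only [pathVert, pathHeight, hc, if_true]
      omega
    set V := pathVert η ζ (a1, a2) (a1 + w, b2) with hVdef
    rw [pathK, hW, ← hVdef] at hI
    have hsum : s.1 = (I.filter (· < w)).card ∧
        (I.filter (· < w) = ∅ → s.2 = (I.filter (fun l => ¬ l < w)).card) ∧
        (I.filter (· < w) = Finset.range w →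
          s.2 = B - a2 + (I.filter (fun l => ¬ l < w)).card) := by
      simp only [pathSum, pathEdge, hc, if_true, hW] at hs
      rw [Finset.sum_ite] at hs
      subst hs
      refine ⟨by simp [Prod.fst_sum], fun h => ?_, fun h => ?_⟩
      · rw [h]
        simp
      · have := Finset.sum_range_sub (fun l : ℕ => pathHeight η ζ (a1, a2) (a1 + w, b2) (a1 + l)) w
        simp only [Nat.cast_add, Nat.cast_one, ← add_assoc, Nat.cast_zero, add_zero] at this
        rw [h]
        simp only [Prod.snd_add, Prod.snd_sum, this, Finset.sum_const, nsmul_eq_mul,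
          Prod.snd_mul, Prod.snd_natCast, mul_one]
        simp only [pathHeight, hc, if_true, ← hB, max_eq_left ha]
    obtain ⟨h1, h2, h3⟩ := hsum
    have hJw : I.filter (· < w) ⊆ Finset.range w := fun l hl =>
      Finset.mem_range.2 (Finset.mem_filter.1 hl).2
    have hJ := Finset.card_le_card hJw
    have hN : (I.filter (fun l => ¬ l < w)).card ≤ w + V - 1 - w := by
      rw [← Nat.card_Ico]
      refine Finset.card_le_card fun l hl => ?_
      have h4 := Finset.mem_range.1 (hI (Finset.mem_filter.1 hl).1)
      have h5 := (Finset.mem_filter.1 hl).2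
      exact Finset.mem_Ico.2 ⟨not_lt.1 h5, h4⟩
    have htot := Finset.card_filter_add_card_filter_not (s := I) (· < w)
    rw [Finset.card_range] at hJ
    by_cases h0 : (I.filter (· < w)).card = 0
    · have := h2 (Finset.card_eq_zero.1 h0)
      omega
    · by_cases h4 : (I.filter (· < w)).card = w
      · have h5 : I.filter (· < w) = Finset.range w :=
          Finset.eq_of_subset_of_card_le hJw (by rw [h4, Finset.card_range])
        have h6 := h3 h5
        -- the last edge is omitted, so there is a vertical one
        have h7 : w - 1 < w + V - 1 := Finset.mem_range.1 (hI (Finset.mem_filter.1 (h5.symm ▸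
          Finset.mem_range.2 (by omega : w - 1 < w))).1)
        omega
      · omega
  · -- the vertical edges come first and end at the height `B`; the last edge is not vertical
    set B : ℤ := max (b2 + 1) (low η ζ a1) with hB
    have hV : (pathVert η ζ (a1, a2) (a1 + w, b2) : ℤ) = a2 - B := by
      simp only [pathVert, pathHeight, hc, if_false, if_true]
      omega
    set V := pathVert η ζ (a1, a2) (a1 + w, b2) with hVdef
    rw [pathK, hW, ← hVdef] at hI
    have hsum : s.1 = (I.filter (fun l => ¬ l < V)).card ∧
        (I.filter (fun l => ¬ l < V) = ∅ → s.2 = - ((I.filter (· < V)).card : ℤ)) := by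
      simp only [pathSum, pathEdge, hc, if_false, ← hVdef] at hs
      rw [Finset.sum_ite] at hs
      subst hs
      refine ⟨by simp [Prod.fst_sum], fun h => ?_⟩
      rw [h]
      simp
    obtain ⟨h1, h2⟩ := hsum
    have hN : (I.filter (fun l => ¬ l < V)).card ≤ w + V - 1 - V := by
      rw [← Nat.card_Ico]
      refine Finset.card_le_card fun l hl => ?_
      have h4 := Finset.mem_range.1 (hI (Finset.mem_filter.1 hl).1)
      have h5 := (Finset.mem_filter.1 hl).2
      exact Finset.mem_Ico.2 ⟨not_lt.1 h5, h4⟩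
    have hJ : (I.filter (· < V)).card ≤ V := by
      refine (Finset.card_le_card fun l hl => ?_).trans_eq (Finset.card_range V)
      exact Finset.mem_range.2 (Finset.mem_filter.1 hl).2
    have htot := Finset.card_filter_add_card_filter_not (s := I) (· < V)
    by_cases h0 : (I.filter (fun l => ¬ l < V)).card = 0
    · have := h2 (Finset.card_eq_zero.1 h0)
      omega
    · omega

/-- In the first case the count of the column of `α` decides, in the second case the columns agree
and the exponent of the first of `α` and `β` in the row order decides. -/
theorem monomialLT_of_between {P : Set (ℝ × ℝ)} {α β p q : LatticePoint P} {s : ℤ × ℤ}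
    (hp : p.1 = α.1 + s) (hq : q.1 = β.1 - s)
    (h : (0 < s.1 ∧ s.1 < β.1.1 - α.1.1) ∨ ((s.1 = 0 ∨ s.1 = β.1.1 - α.1.1) ∧
      ((RowLT α.1 β.1 ∧ RowLT α.1 (α.1 + s) ∧ RowLT α.1 (β.1 - s)) ∨
        (RowLT β.1 α.1 ∧ RowLT β.1 (α.1 + s) ∧ RowLT β.1 (β.1 - s))))) :
    MonomialLT (Finsupp.single p 1 + Finsupp.single q 1)
      (Finsupp.single α 1 + Finsupp.single β 1) := by
  classical
  have hp1 : p.1.1 = α.1.1 + s.1 := congrArg Prod.fst hp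
  have hq1 : q.1.1 = β.1.1 - s.1 := congrArg Prod.fst hq
  have hcol : ∀ (p q : LatticePoint P) (i : ℤ), columnSum (Finsupp.single p 1 + Finsupp.single q 1) i
      = (if p.1.1 = i then 1 else 0) + if q.1.1 = i then 1 else 0 := by
    intro p q i
    rw [columnSum, Finsupp.mapDomain_add, Finsupp.mapDomain_single, Finsupp.mapDomain_single,
      Finsupp.add_apply, Finsupp.single_apply, Finsupp.single_apply]
  have hrow : ∀ γ p q α β : LatticePoint P, γ = α ∨ γ = β → (RowLT γ.1 α.1 ∨ γ = α) →
      (RowLT γ.1 β.1 ∨ γ = β) → RowLT γ.1 p.1 → RowLT γ.1 q.1 →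
      ∃ γ : LatticePoint P, (Finsupp.single p 1 + Finsupp.single q 1 : LatticePoint P →₀ ℕ) γ <
        (Finsupp.single α 1 + Finsupp.single β 1 : LatticePoint P →₀ ℕ) γ ∧
        ∀ δ : LatticePoint P, RowLT δ.1 γ.1 →
          (Finsupp.single p 1 + Finsupp.single q 1 : LatticePoint P →₀ ℕ) δ =
          (Finsupp.single α 1 + Finsupp.single β 1 : LatticePoint P →₀ ℕ) δ := by
    intro γ p q α β h1 h2 h3 h4 h5
    have irr : ∀ {x y z : LatticePoint P}, RowLT x.1 y.1 → RowLT y.1 z.1 ∨ y = z → z ≠ x := by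
      rintro x y z hx (hy | rfl) rfl
      · simp only [RowLT] at hx hy
        omega
      · simp only [RowLT] at hx
        omega
    have irr' : ∀ {x y : LatticePoint P}, RowLT x.1 y.1 → y ≠ x := by
      rintro x y hx rfl
      simp only [RowLT] at hx
      omega
    refine ⟨γ, ?_, fun δ hδ => ?_⟩
    · simp only [Finsupp.add_apply, Finsupp.single_apply, irr' h4, irr' h5, if_false]
      rcases h1 with rfl | rfl
      · simp
      · simp
    · simp only [Finsupp.add_apply, Finsupp.single_apply, irr hδ h2, irr hδ h3, irr hδ (Or.inl h4),
        irr hδ (Or.inl h5), if_false]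
  refine Or.inr ⟨by simp, ?_⟩
  simp only [hcol]
  rcases h with h | ⟨h1, h2⟩
  · refine Or.inl ⟨α.1.1, ?_, fun i hi => ?_⟩
    · rw [if_neg (by omega), if_neg (by omega), if_pos rfl]
      omega
    · rw [if_neg (by omega), if_neg (by omega), if_neg (by omega), if_neg (by omega)]
  · refine Or.inr ⟨fun i => ?_, ?_⟩
    · rcases h1 with h1 | h1
      · rw [hp1, hq1, h1, add_zero, sub_zero]
      · rw [hp1, hq1, h1, add_sub_cancel, sub_sub_cancel, add_comm]
    · rw [← hp, ← hq] at h2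
      rcases h2 with h2 | h2
      · exact hrow α p q α β (Or.inl rfl) (Or.inr rfl) (Or.inl h2.1) h2.2.1 h2.2.2
      · exact hrow β p q α β (Or.inr rfl) (Or.inl h2.1) (Or.inr rfl) h2.2.1 h2.2.2

variable {𝕜 : Type*} [Field 𝕜] {σ : Type*}

theorem isWeightedHomogeneous_coeff_mul (p q : σ) (m n : ℕ) :
    MvPolynomial.IsWeightedHomogeneous (fun v : σ × ℕ => (Finsupp.single v.1 1 : σ →₀ ℕ))
      (PowerSeries.coeff n (iterDeriv m (current 𝕜 p) * current 𝕜 q))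
      (Finsupp.single p 1 + Finsupp.single q 1) := by
  rw [PowerSeries.coeff_mul]
  refine MvPolynomial.IsWeightedHomogeneous.sum _ _ _ fun ij _ => ?_
  rw [iterDeriv, PowerSeries.coeff_iterate_derivative, current, current, PowerSeries.coeff_mk, PowerSeries.coeff_mk]
  refine MvPolynomial.IsWeightedHomogeneous.mul ?_ (MvPolynomial.isWeightedHomogeneous_X 𝕜 _ _)
  rw [← map_natCast (MvPolynomial.C (R := 𝕜) (σ := σ × ℕ))]
  exact (MvPolynomial.isWeightedHomogeneous_X 𝕜 _ _).C_mul _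

theorem coeff_iterDeriv_current_mul_ne_zero [CharZero 𝕜] (p q : σ) (m n : ℕ) :
    PowerSeries.coeff n (iterDeriv m (current 𝕜 p) * current 𝕜 q) ≠ 0 := by
  intro h
  -- at the point with all coordinates `1` the value is a sum of positive integers
  have h1 := congrArg (MvPolynomial.aeval (fun _ => (1 : 𝕜))) h
  rw [PowerSeries.coeff_mul, map_sum, map_zero] at h1
  simp only [iterDeriv, PowerSeries.coeff_iterate_derivative, current, PowerSeries.coeff_mk, map_mul, map_natCast,
    MvPolynomial.aeval_X, mul_one] at h1
  rw [← Nat.cast_sum, Nat.cast_eq_zero, Finset.sum_eq_zero_iff] at h1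
  have h2 := h1 (0, n) (by simp)
  exact (Nat.ascFactorial_pos 0 m).ne' h2

/-- The term of the empty set dominates all other terms of `W'`. -/
theorem isInitialPart_coeff_seriesW [CharZero 𝕜] (hη : 0 < η)
    (hζ : ∀ i : ℕ, i + 2 ≤ η → (ζ i : ℤ) - ζ (i + 1) ≤ (ζ (i + 1) : ℤ) - ζ (i + 2))
    (α β : LatticePoint (polygon η ζ)) (hαβ : Precedes α.1 β.1) (m n : ℕ) :
    IsInitialPart MonomialLT (PowerSeries.coeff n (seriesW 𝕜 η ζ α.1 β.1 m))
      (PowerSeries.coeff n (seriesIn 𝕜 α β m)) := by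
  classical
  set k := pathK η ζ α.1 β.1 with hk
  set T : Finset ℕ → MvPolynomial (LatticePoint (polygon η ζ) × ℕ) 𝕜 := fun I =>
    PowerSeries.coeff n (iterDeriv m (currentAt 𝕜 (polygon η ζ) (α.1 + pathSum η ζ α.1 β.1 I)) *
        currentAt 𝕜 (polygon η ζ) (β.1 - pathSum η ζ α.1 β.1 I)) with hT
  have hW : PowerSeries.coeff n (seriesW 𝕜 η ζ α.1 β.1 m) =
      ∑ I ∈ (Finset.range k).powerset, MvPolynomial.C ((-1) ^ I.card) * T I := by
    rw [seriesW, map_sum]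
    refine Finset.sum_congr rfl fun I _ => ?_
    rw [show ((-1) ^ I.card : PowerSeries (MvPolynomial (LatticePoint (polygon η ζ) × ℕ) 𝕜)) =
      PowerSeries.C (MvPolynomial.C ((-1) ^ I.card)) by simp, PowerSeries.coeff_C_mul]
  have hT0 : T ∅ = PowerSeries.coeff n (seriesIn 𝕜 α β m) := by
    simp only [hT, pathSum, Finset.sum_empty, add_zero, sub_zero]
    rw [currentAt, dif_pos α.2, currentAt, dif_pos β.2, seriesIn]
  have hT0hom := isWeightedHomogeneous_coeff_mul (𝕜 := 𝕜) α β m n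
  rw [← seriesIn, ← hT0] at hT0hom
  have hlt : ∀ I ⊆ Finset.range k, I ≠ ∅ → ∃ d : LatticePoint (polygon η ζ) →₀ ℕ,
      MonomialLT d (Finsupp.single α 1 + Finsupp.single β 1) ∧
      MvPolynomial.IsWeightedHomogeneous (fun v : LatticePoint (polygon η ζ) × ℕ =>
        (Finsupp.single v.1 1 : LatticePoint (polygon η ζ) →₀ ℕ))
        (MvPolynomial.C ((-1) ^ I.card) * T I) d := by
    intro I hI hne
    have hI' : I ⊆ Finset.range (k + 1) := hI.trans (Finset.range_subset_range.2 (Nat.le_succ k))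
    have hp := path_mem_polygon hη hζ α β hαβ I hI'
    have hq := sub_path_mem_polygon hη hζ α β hαβ I hI'
    refine ⟨Finsupp.single ⟨_, hp⟩ 1 + Finsupp.single ⟨_, hq⟩ 1, monomialLT_of_between rfl rfl
      (pathSum_between hη hζ α β hαβ hI (Finset.nonempty_iff_ne_empty.2 hne) rfl), ?_⟩
    refine MvPolynomial.IsWeightedHomogeneous.C_mul ?_ _
    rw [hT]
    simp only
    rw [currentAt, dif_pos hp, currentAt, dif_pos hq]
    exact isWeightedHomogeneous_coeff_mul _ _ m n
  have hempty : MvPolynomial.C ((-1) ^ (∅ : Finset ℕ).card) * T ∅ = T ∅ := by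
    rw [Finset.card_empty, pow_zero, map_one, one_mul]
  have hcomp : component (Finsupp.single α 1 + Finsupp.single β 1)
      (PowerSeries.coeff n (seriesW 𝕜 η ζ α.1 β.1 m)) = PowerSeries.coeff n (seriesIn 𝕜 α β m) := by
    rw [hW, component, map_sum, Finset.sum_eq_single ∅, hempty,
      hT0hom.weightedHomogeneousComponent_same, hT0]
    · intro I hI hne
      obtain ⟨d, hd, hhom⟩ := hlt I (Finset.mem_powerset.1 hI) hne
      refine hhom.weightedHomogeneousComponent_ne _ ?_
      rintro rfl
      exact monomialLT_irrefl _ hd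
    · intro h
      exact absurd (Finset.empty_mem_powerset _) h
  refine ⟨Finsupp.single α 1 + Finsupp.single β 1, ?_, hcomp.symm, fun r' hr' => ?_⟩
  · rw [hcomp]
    exact coeff_iterDeriv_current_mul_ne_zero α β m n
  · by_contra h
    rw [not_or] at h
    refine hr' ?_
    rw [hW, component, map_sum]
    refine Finset.sum_eq_zero fun I hI => ?_
    by_cases hne : I = ∅
    · rw [hne, hempty]
      exact hT0hom.weightedHomogeneousComponent_ne _ h.1
    · obtain ⟨d, hd, hhom⟩ := hlt I (Finset.mem_powerset.1 hI) hne
      refine hhom.weightedHomogeneousComponent_ne _ ?_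
      rintro rfl
      exact h.2 hd

end InitialPart

end ToricArc

theorem mainTheorem2 {𝕜 : Type*} [Field 𝕜] [IsAlgClosed 𝕜] [CharZero 𝕜]
    (η : ℕ) (hη : 0 < η) (ζ : ℕ → ℕ)
    (hζ : ∀ i : ℕ, i + 2 ≤ η → (ζ i : ℤ) - ζ (i + 1) ≤ (ζ (i + 1) : ℤ) - ζ (i + 2)) :
    Ideal.span {p | ∃ α β : LatticePoint (polygon η ζ), Precedes α.1 β.1 ∧
        ∃ m < pathK η ζ α.1 β.1, ∃ n : ℕ,
          p = PowerSeries.coeff n (seriesW 𝕜 η ζ α.1 β.1 m)} =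
      relationIdeal 𝕜 (toricGen 𝕜 (polygon η ζ)) ∧
    (∀ α β : LatticePoint (polygon η ζ), Precedes α.1 β.1 →
      ∀ m < pathK η ζ α.1 β.1, ∀ n : ℕ,
        IsInitialPart MonomialLT (PowerSeries.coeff n (seriesW 𝕜 η ζ α.1 β.1 m))
          (PowerSeries.coeff n (seriesIn 𝕜 α β m))) ∧
    Ideal.span {p | ∃ α β : LatticePoint (polygon η ζ), Precedes α.1 β.1 ∧
        ∃ m < pathK η ζ α.1 β.1, ∃ n : ℕ,
          p = PowerSeries.coeff n (seriesIn 𝕜 α β m)} =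
      initialIdeal MonomialLT (relationIdeal 𝕜 (toricGen 𝕜 (polygon η ζ))) := by
  have := finite_latticePoint hη hζ
  refine ⟨?_, fun α β hαβ m _ n => isInitialPart_coeff_seriesW hη hζ α β hαβ m n,
    le_antisymm ?_ ?_⟩
  · -- pairs of a coefficient of `W'` and its initial part
    set G : Set (MvPolynomial (LatticePoint (polygon η ζ) × ℕ) 𝕜 ×
        MvPolynomial (LatticePoint (polygon η ζ) × ℕ) 𝕜) :=
      {p | ∃ α β : LatticePoint (polygon η ζ), Precedes α.1 β.1 ∧
        ∃ m < pathK η ζ α.1 β.1, ∃ n : ℕ,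
          p = (PowerSeries.coeff n (seriesW 𝕜 η ζ α.1 β.1 m),
            PowerSeries.coeff n (seriesIn 𝕜 α β m))} with hG
    have h := span_eq_of_isInitialPart (lt := MonomialLT) (G := G)
      (I := relationIdeal 𝕜 (toricGen 𝕜 (polygon η ζ))) (fun _ _ s hlt => hlt.add_right s)
      (by
        rintro _ ⟨α, β, hαβ, m, _, n, rfl⟩
        exact isInitialPart_coeff_seriesW hη hζ α β hαβ m n)
      (by
        rintro _ ⟨α, β, hαβ, m, hm, n, rfl⟩
        exact coeff_seriesW_mem_relationIdeal 𝕜 hη hζ α β hαβ hm n)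
      (fun f hf h hh => by
        refine Ideal.span_mono ?_ (initialPart_mem_span hη hζ hf hh)
        rintro _ ⟨α, β, hαβ, m, hm, n, rfl⟩
        exact ⟨_, ⟨α, β, hαβ, m, hm, n, rfl⟩, rfl⟩)
    rw [← h]
    congr 1
    ext p
    constructor
    · rintro ⟨α, β, hαβ, m, hm, n, rfl⟩
      exact ⟨_, ⟨α, β, hαβ, m, hm, n, rfl⟩, rfl⟩
    · rintro ⟨_, ⟨α, β, hαβ, m, hm, n, rfl⟩, rfl⟩
      exact ⟨α, β, hαβ, m, hm, n, rfl⟩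
  · rw [Ideal.span_le]
    rintro _ ⟨α, β, hαβ, m, hm, n, rfl⟩
    exact Ideal.subset_span ⟨_, coeff_seriesW_mem_relationIdeal 𝕜 hη hζ α β hαβ hm n,
      isInitialPart_coeff_seriesW hη hζ α β hαβ m n⟩
  · rw [initialIdeal, Ideal.span_le]
    rintro h ⟨f, hf, hh⟩
    exact initialPart_mem_span hη hζ hf hh
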